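/- Let $\mathbb{K}$ be a field of characteristic $0$ and let $X$ be a smooth separated irreducible $\mathbb{K}$-scheme of dimension $n$. **Notation.** Let $\mathcal{I}_{\mathrm{alg}} \subset \mathcal{O}_{X\times X}$ be the ideal of the diagonal of $X \times_{\mathbb{K}} X$, and let $\mathcal{P}_X := \varprojlim_d \mathcal{O}_{X\times X}/\mathcal{I}_{\mathrm{alg}}^{d+1}$ be the sheaf of principal parts, regarded as a sheaf of $\mathcal{O}_X$-algebras on $X$ via $f \mapsto f\otimes 1$, with $\mathcal{I}_X := \mathrm{Ker}(\mathcal{P}_X \to \mathcal{O}_X)$. For a morphism $g : Y \to X$ the complete inverse image is $g^{\hat{*}}\mathcal{P}_X := \varprojlim_d g^*(\mathcal{O}_{X\times X}/\mathcal{I}_{\mathrm{alg}}^{d+1})$, a sheaf of $\mathcal{O}_Y$-algebras, and $g^{\hat{*}}\mathcal{I}_X$ is the kernel of $g^{\hat{*}}\mathcal{P}_X \to \mathcal{O}_Y$. Let $\boldsymbol{t} = (t_1,\dots,t_n)$ be variables; $\mathcal{O}_Y[[\boldsymbol{t}]]$ is the sheaf $V \mapsto \Gamma(V,\mathcal{O}_Y)[[\boldsymbol{t}]]$.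 Let $\mathcal{D}_X := \mathcal{H}om^{\mathrm{cont}}_{\mathcal{O}_X}(\mathcal{P}_X,\mathcal{O}_X)$ be the sheaf of differential operators, a left $\mathcal{O}_X$-module containing $\mathcal{O}_X$ as the operators of order zero. The bundle of formal coordinate systems $\pi : \mathrm{Coor}\,X \to X$ is the open subscheme of $E := \mathrm{Spec}_X\, \mathrm{S}_{\mathcal{O}_X}\bigl((\mathcal{D}_X/\mathcal{O}_X)^{\oplus n}\bigr)$ consisting of the points $y$ such that, on some open neighbourhood $U$ of the image of $y$ in $X$, there are differential operators $\partial_1,\dots,\partial_n$ of order $\le 1$ for which the function $\det[\xi_{i,j}]$ does not vanish at $y$, where $\xi_{i,j}$ is the function on the preimage of $U$ in $E$ given by $\partial_i$ in the $j$-th copy of $\mathcal{D}_X/\mathcal{O}_X$. A system of formal coordinates on an open set $U\subset X$ is a sequence $(a_1,\dots,a_n)$ in $\Gamma(U,\mathcal{I}_X)$ for which the homomorphism of sheaves of $\mathcal{O}_U$-algebras $\mathcal{O}_U[[\boldsymbol{t}]]\to\mathcal{P}_X|_U$, $t_j\mapsto a_j$, is an isomorphism. **Theorem.** The relative spectrum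 $E$ exists. For an $X$-scheme $g : Y\to X$ let $F(Y)$ be the set of isomorphisms of sheaves of $\mathcal{O}_Y$-algebras $\phi:\mathcal{O}_Y[[\boldsymbol{t}]] \to g^{\hat{*}}\mathcal{P}_X$ such that $\phi(\mathcal{O}_Y[[\boldsymbol{t}]]\cdot\boldsymbol{t}) = g^{\hat{*}}\mathcal{I}_X$. For every morphism $h : Y'\to Y$ of $X$-schemes every $\phi\in F(Y)$ has a unique inverse image $h^{\hat{*}}\phi\in F(Y')$ compatible with $\phi$, and with these maps $F$ is a functor $(\mathsf{Sch}/X)^{\mathrm{op}}\to\mathsf{Sets}$. Then $\mathrm{Coor}\,X$ is a fine moduli space for $F$: there is an isomorphism of functors $$F\cong\mathrm{Hom}_{\mathsf{Sch}/X}(-,\mathrm{Coor}\,X).$$ The identity of $\mathrm{Coor}\,X$ corresponds to an isomorphism $\phi_0 : \mathcal{O}_{\mathrm{Coor}\,X}[[\boldsymbol{t}]]\cong\pi^{\hat{*}}\mathcal{P}_X$ of $\mathcal{O}_{\mathrm{Coor}\,X}$-algebras with the following universal property: for every open set $U\subset X$ the assignment $\sigma\mapsto(\sigma^*(\phi_0(t_1)),\dots,\sigma^*(\phi_0(t_n)))$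 is a bijection from the set $\mathrm{Hom}_{\mathsf{Sch}/X}(U,\mathrm{Coor}\,X)$ of sections over $U$ to the set of systems of formal coordinates on $U$. -/

import Mathlib

open CategoryTheory CategoryTheory.Limits AlgebraicGeometry TopologicalSpace Opposite

universe u

noncomputable section

namespace FormalGeometry

/-! ### Complete inverse systems of algebras

On a scheme `Y`, an inverse system `… → 𝒜₂ → 𝒜₁ → 𝒜₀` of quasi-coherent `𝒪_Y`-algebras is the same
thing as a direct system `Z₀ → Z₁ → Z₂ → …` of schemes that are affine over `Y`, where `𝒜_d` is the
direct image of the structure sheaf of `Z_d`. The associated complete `𝒪_Y`-algebra is `lim 𝒜_d`,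
and the inverse image of `𝒜_d` along `g : Y' ⟶ Y` is the direct image of the structure sheaf of
`Y' ×_Y Z_d`. -/

/-- A sequence `Z₀ → Z₁ → Z₂ → …` of schemes over `Y`. -/
structure Tower (Y : Scheme.{u}) where
  obj : ℕ → Scheme.{u}
  hom : ∀ d, obj d ⟶ Y
  trans : ∀ d, obj d ⟶ obj (d + 1)
  trans_hom : ∀ d, trans d ≫ hom (d + 1) = hom d

/-- Morphisms of towers lying over a morphism `h` of the bases. -/
structure TowerHom {Y' Y : Scheme.{u}} (h : Y' ⟶ Y) (T' : Tower Y') (T : Tower Y) where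
  map : ∀ d, T'.obj d ⟶ T.obj d
  map_hom : ∀ d, map d ≫ T.hom d = T'.hom d ≫ h
  trans_map : ∀ d, T'.trans d ≫ map (d + 1) = map d ≫ T.trans d

namespace Tower

variable {Y : Scheme.{u}} (T : Tower Y)

theorem preimage_le (d : ℕ) (V : Y.Opens) :
    T.hom d ⁻¹ᵁ V ≤ T.trans d ⁻¹ᵁ (T.hom (d + 1) ⁻¹ᵁ V) := by
  rw [← Scheme.Hom.comp_preimage, T.trans_hom]

/-- `Γ(V, lim_d 𝒜_d)`: compatible sequences of sections of the `𝒜_d` over `V`. -/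
def sectionsSubring (V : Y.Opens) : Subring (∀ d, Γ(T.obj d, T.hom d ⁻¹ᵁ V)) where
  carrier := {s | ∀ d, (T.trans d).appLE _ _ (T.preimage_le d V) (s (d + 1)) = s d}
  mul_mem' {a b} ha hb d := by simp only [Pi.mul_apply, map_mul, ha d, hb d]
  one_mem' d := by simp only [Pi.one_apply, map_one]
  add_mem' {a b} ha hb d := by simp only [Pi.add_apply, map_add, ha d, hb d]
  zero_mem' d := by simp only [Pi.zero_apply, map_zero]
  neg_mem' {a} ha d := by simp only [Pi.neg_apply, map_neg, ha d]

/-- The ring of sections over `V` of the complete algebra `lim_d 𝒜_d`. -/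
def Sections (V : Y.Opens) : Type u := T.sectionsSubring V

instance (V : Y.Opens) : CommRing (T.Sections V) :=
  inferInstanceAs (CommRing (T.sectionsSubring V))

/-- The projection `Γ(V, lim 𝒜) → Γ(V, 𝒜_d)`. -/
def proj (V : Y.Opens) (d : ℕ) : T.Sections V →+* Γ(T.obj d, T.hom d ⁻¹ᵁ V) :=
  (Pi.evalRingHom _ d).comp (T.sectionsSubring V).subtype

variable {T} in
@[ext]
theorem Sections.ext {V : Y.Opens} {s t : T.Sections V}
    (h : ∀ d, T.proj V d s = T.proj V d t) : s = t :=
  Subtype.ext (funext h)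

theorem structureMap_mem (V : Y.Opens) (f : Γ(Y, V)) :
    (fun d => (T.hom d).app V f) ∈ T.sectionsSubring V := by
  intro d
  have h : (T.hom (d + 1)).app V ≫ (T.trans d).appLE _ _ (T.preimage_le d V) =
      (T.hom d).app V := by
    rw [Scheme.Hom.app_eq_appLE, Scheme.Hom.app_eq_appLE, Scheme.Hom.appLE_comp_appLE]
    simp only [T.trans_hom]
  exact congr($h f)

/-- The structure of `Γ(V, 𝒪_Y)`-algebra on the sections. -/
def structureMap (V : Y.Opens) : Γ(Y, V) →+* T.Sections V where
  toFun f := ⟨fun d => (T.hom d).app V f, T.structureMap_mem V f⟩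
  map_one' := Subtype.ext (funext fun _ => map_one _)
  map_mul' _ _ := Subtype.ext (funext fun _ => map_mul _ _ _)
  map_zero' := Subtype.ext (funext fun _ => map_zero _)
  map_add' _ _ := Subtype.ext (funext fun _ => map_add _ _ _)

instance (V : Y.Opens) : Algebra Γ(Y, V) (T.Sections V) := (T.structureMap V).toAlgebra

/-- The kernel of `lim 𝒜 → 𝒜₀`, an ideal sheaf in `lim 𝒜`. -/
def idealZero (V : Y.Opens) : Ideal (T.Sections V) := RingHom.ker (T.proj V 0)

/-- The morphism `Y' ×_Y Z_d ⟶ Y' ×_Y Z_{d+1}`. -/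
def pullbackTrans {Y' : Scheme.{u}} (g : Y' ⟶ Y) (d : ℕ) :
    Limits.pullback g (T.hom d) ⟶ Limits.pullback g (T.hom (d + 1)) :=
  pullback.lift (pullback.fst g (T.hom d)) (pullback.snd g (T.hom d) ≫ T.trans d)
    (by rw [Category.assoc, T.trans_hom, pullback.condition])

/-- The complete inverse image of a tower along `g`: the base change, levelwise. -/
def pullback {Y' : Scheme.{u}} (g : Y' ⟶ Y) : Tower Y' where
  obj d := Limits.pullback g (T.hom d)
  hom d := pullback.fst g (T.hom d)
  trans d := T.pullbackTrans g d
  trans_hom _ := pullback.lift_fst _ _ _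

/-- The projection from the base change to the tower, lying over `g`. -/
def pullbackSnd {Y' : Scheme.{u}} (g : Y' ⟶ Y) : TowerHom g (T.pullback g) T where
  map d := pullback.snd g (T.hom d)
  map_hom _ := pullback.condition.symm
  trans_map _ := pullback.lift_snd _ _ _

section Transitivity

variable {Z' Z : Scheme.{u}} {g' : Z' ⟶ Y} {g : Z ⟶ Y} (h : Z' ⟶ Z) (w : h ≫ g = g')

/-- The morphism `Z' ×_Y Z_d ⟶ Z ×_Y Z_d` induced by a morphism `h : Z' ⟶ Z` of `Y`-schemes. -/
def pullbackMap (d : ℕ) : Limits.pullback g' (T.hom d) ⟶ Limits.pullback g (T.hom d) :=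
  pullback.lift (pullback.fst g' (T.hom d) ≫ h) (pullback.snd g' (T.hom d))
    (by rw [Category.assoc, w, pullback.condition])

theorem pullbackTrans_map (d : ℕ) :
    T.pullbackTrans g' d ≫ T.pullbackMap h w (d + 1) =
      T.pullbackMap h w d ≫ T.pullbackTrans g d := by
  apply pullback.hom_ext <;>
    simp only [pullbackTrans, pullbackMap, Category.assoc, pullback.lift_fst, pullback.lift_snd,
      pullback.lift_fst_assoc, pullback.lift_snd_assoc]

/-- Transitivity of base change: for a morphism `h : Z' ⟶ Z` of `Y`-schemes, the base change to `Z'`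
maps to the base change to `Z`. -/
def pullbackOver : TowerHom h (T.pullback g') (T.pullback g) where
  map d := T.pullbackMap h w d
  map_hom _ := pullback.lift_fst _ _ _
  trans_map d := T.pullbackTrans_map h w d

end Transitivity

end Tower

namespace TowerHom

variable {Y' Y : Scheme.{u}} {h : Y' ⟶ Y} {T' : Tower Y'} {T : Tower Y} (m : TowerHom h T' T)

theorem preimage_le {V : Y.Opens} {V' : Y'.Opens} (e : V' ≤ h ⁻¹ᵁ V) (d : ℕ) :
    T'.hom d ⁻¹ᵁ V' ≤ m.map d ⁻¹ᵁ (T.hom d ⁻¹ᵁ V) := by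
  rw [← Scheme.Hom.comp_preimage, m.map_hom, Scheme.Hom.comp_preimage]
  exact (T'.hom d).preimage_mono e

theorem pull_mem {V : Y.Opens} {V' : Y'.Opens} (e : V' ≤ h ⁻¹ᵁ V) (s : T.Sections V) :
    (fun d => (m.map d).appLE _ _ (m.preimage_le e d) (T.proj V d s)) ∈ T'.sectionsSubring V' := by
  intro d
  have hs : T.proj V d s = (T.trans d).appLE _ _ (T.preimage_le d V) (T.proj V (d + 1) s) :=
    (s.2 d).symm
  have hc : (m.map (d + 1)).appLE _ _ (m.preimage_le e (d + 1)) ≫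
        (T'.trans d).appLE _ _ (T'.preimage_le d V') =
      (T.trans d).appLE _ _ (T.preimage_le d V) ≫ (m.map d).appLE _ _ (m.preimage_le e d) := by
    rw [Scheme.Hom.appLE_comp_appLE, Scheme.Hom.appLE_comp_appLE]
    simp only [m.trans_map]
  dsimp only
  rw [hs]
  exact congr($hc (T.proj V (d + 1) s))

/-- Pulling back sections along a morphism of towers. -/
def pull (V : Y.Opens) (V' : Y'.Opens) (e : V' ≤ h ⁻¹ᵁ V) : T.Sections V →+* T'.Sections V' where
  toFun s := ⟨fun d => (m.map d).appLE _ _ (m.preimage_le e d) (T.proj V d s), m.pull_mem e s⟩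
  map_one' := Subtype.ext (funext fun d =>
    (congrArg _ (map_one (T.proj V d))).trans (map_one _))
  map_mul' a b := Subtype.ext (funext fun d =>
    (congrArg _ (map_mul (T.proj V d) a b)).trans (map_mul _ _ _))
  map_zero' := Subtype.ext (funext fun d =>
    (congrArg _ (map_zero (T.proj V d))).trans (map_zero _))
  map_add' a b := Subtype.ext (funext fun d =>
    (congrArg _ (map_add (T.proj V d) a b)).trans (map_add _ _ _))

end TowerHom

namespace Tower

variable {Y : Scheme.{u}} (T : Tower Y)

/-- The identity morphism of a tower. -/
def idHom : TowerHom (𝟙 Y) T T where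
  map d := 𝟙 _
  map_hom d := by simp
  trans_map d := by simp

/-- Restriction of sections of `lim 𝒜` to a smaller open set. -/
def res {V W : Y.Opens} (e : W ≤ V) : T.Sections V →+* T.Sections W :=
  T.idHom.pull V W e

end Tower

/-- Restriction of functions. -/
abbrev resO (Y : Scheme.{u}) {V W : Y.Opens} (e : W ≤ V) : Γ(Y, V) →+* Γ(Y, W) :=
  (Y.presheaf.map (homOfLE e).op).hom

/-! ### Power series algebras -/

/-- An isomorphism `𝒪_U[[t₁,…,tₙ]] ≅ (lim 𝒜)|_U` of sheaves of `𝒪_U`-algebras; here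
`Γ(V, 𝒪_U[[t]]) = Γ(V, 𝒪_U)[[t]]`. -/
structure PowerSeriesIso (n : ℕ) {Y : Scheme.{u}} (T : Tower Y) (U : Y.Opens) where
  iso : ∀ V : Y.Opens, V ≤ U → (MvPowerSeries (Fin n) Γ(Y, V) ≃ₐ[Γ(Y, V)] T.Sections V)
  natural : ∀ (V : Y.Opens) (hV : V ≤ U) (W : Y.Opens) (e : W ≤ V)
    (f : MvPowerSeries (Fin n) Γ(Y, V)),
      iso W (e.trans hV) (MvPowerSeries.map (resO Y e) f) = T.res e (iso V hV f)

/-! ### Continuous duals -/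

/-- Families of `𝒪`-linear maps `Γ(W, lim 𝒜) → Γ(W, 𝒪)`, for `W ⊆ U` open. -/
def LinearFamily {Y : Scheme.{u}} (T : Tower Y) (U : Y.Opens) : Type u :=
  ∀ W : {W : Y.Opens // W ≤ U}, T.Sections W.1 →ₗ[Γ(Y, W.1)] Γ(Y, W.1)

instance {Y : Scheme.{u}} (T : Tower Y) (U : Y.Opens) : AddCommGroup (LinearFamily T U) :=
  inferInstanceAs (AddCommGroup
    (∀ W : {W : Y.Opens // W ≤ U}, T.Sections W.1 →ₗ[Γ(Y, W.1)] Γ(Y, W.1)))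

/-- `Γ(U, 𝒪)` acts on a family through restriction of functions. -/
instance {Y : Scheme.{u}} (T : Tower Y) (U : Y.Opens) : Module Γ(Y, U) (LinearFamily T U) where
  smul f δ := fun W => resO Y W.2 f • δ W
  one_smul δ := funext fun W =>
    (congrArg (· • δ W) (map_one (resO Y W.2))).trans (one_smul _ _)
  mul_smul f g δ := funext fun W =>
    (congrArg (· • δ W) (map_mul (resO Y W.2) f g)).trans (mul_smul _ _ _)
  smul_zero f := funext fun W => smul_zero (resO Y W.2 f)
  smul_add f δ ε := funext fun W => smul_add (resO Y W.2 f) (δ W) (ε W)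
  add_smul f g δ := funext fun W =>
    (congrArg (· • δ W) (map_add (resO Y W.2) f g)).trans (add_smul _ _ _)
  zero_smul δ := funext fun W =>
    (congrArg (· • δ W) (map_zero (resO Y W.2))).trans (zero_smul _ _)

theorem Tower.proj_eq_zero_of_le {Y : Scheme.{u}} (T : Tower Y) (V : Y.Opens) {d e : ℕ}
    (h : d ≤ e) (s : T.Sections V) (hs : T.proj V e s = 0) : T.proj V d s = 0 := by
  induction h with
  | refl => exact hs
  | @step m hm ih =>
    refine ih ?_
    have : T.proj V m s = (T.trans m).appLE _ _ (T.preimage_le m V) (T.proj V (m + 1) s) :=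
      (s.2 m).symm
    rw [this, hs, map_zero]

/-- `Γ(U, ℋom^cont(lim 𝒜, 𝒪))`: the `𝒪_U`-linear sheaf homomorphisms `(lim 𝒜)|_U → 𝒪_U` which are
continuous, where `𝒪` is discrete and `lim 𝒜` has the inverse structure given by the kernels of the
projections `lim 𝒜 → 𝒜_d`. Continuity is imposed locally, so that this is a sheaf in `U`. -/
def continuousDual {Y : Scheme.{u}} (T : Tower Y) (U : Y.Opens) :
    Submodule Γ(Y, U) (LinearFamily T U) where
  carrier := {δ |
    (∀ (V : Y.Opens) (hV : V ≤ U) (W : Y.Opens) (e : W ≤ V) (s : T.Sections V),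
      δ ⟨W, e.trans hV⟩ (T.res e s) = resO Y e (δ ⟨V, hV⟩ s)) ∧
    ∀ x ∈ U, ∃ V : Y.Opens, x ∈ V ∧ ∃ d : ℕ, ∀ (W : Y.Opens) (hW : W ≤ U), W ≤ V →
      ∀ s : T.Sections W, T.proj W d s = 0 → δ ⟨W, hW⟩ s = 0}
  add_mem' {a b} ha hb := by
    refine ⟨fun V hV W e s => ?_, fun x hx => ?_⟩
    · change a ⟨W, e.trans hV⟩ (T.res e s) + b ⟨W, e.trans hV⟩ (T.res e s) =
        resO Y e (a ⟨V, hV⟩ s + b ⟨V, hV⟩ s)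
      rw [ha.1 V hV W e s, hb.1 V hV W e s, map_add]
    · obtain ⟨V₁, hx₁, d₁, h₁⟩ := ha.2 x hx
      obtain ⟨V₂, hx₂, d₂, h₂⟩ := hb.2 x hx
      refine ⟨V₁ ⊓ V₂, ⟨hx₁, hx₂⟩, max d₁ d₂, fun W hW hWV s hs => ?_⟩
      change a ⟨W, hW⟩ s + b ⟨W, hW⟩ s = 0
      rw [h₁ W hW (hWV.trans inf_le_left) s (T.proj_eq_zero_of_le W (le_max_left _ _) s hs),
        h₂ W hW (hWV.trans inf_le_right) s (T.proj_eq_zero_of_le W (le_max_right _ _) s hs),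
        add_zero]
  zero_mem' := by
    refine ⟨fun V hV W e s => ?_, fun x hx => ⟨U, hx, 0, fun W hW _ s _ => rfl⟩⟩
    change 0 = resO Y e 0
    rw [map_zero]
  smul_mem' f a ha := by
    refine ⟨fun V hV W e s => ?_, fun x hx => ?_⟩
    · change resO Y (e.trans hV) f * a ⟨W, e.trans hV⟩ (T.res e s) =
        resO Y e (resO Y hV f * a ⟨V, hV⟩ s)
      rw [ha.1 V hV W e s, map_mul]
      congr 1
      rw [← CommRingCat.comp_apply, ← Functor.map_comp]
      rfl
    · obtain ⟨V, hxV, d, h⟩ := ha.2 x hx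
      refine ⟨V, hxV, d, fun W hW hWV s hs => ?_⟩
      change resO Y hW f * a ⟨W, hW⟩ s = 0
      rw [h W hW hWV s hs, mul_zero]

/-! ### Principal parts and differential operators -/

section PrincipalParts

variable {S X : Scheme.{u}} (p : X ⟶ S)

/-- The tower of infinitesimal neighbourhoods of the diagonal: `X_d ⊆ X ×_S X` is the closed
subscheme defined by `ℐ^(d+1)`, where `ℐ` is the ideal of the diagonal, and is viewed as a scheme
over `X` by the first projection. Thus `𝒜_d` is the sheaf `𝒪_{X × X} / ℐ^(d+1)`, supported on the
diagonal, regarded as a sheaf of `𝒪_X`-algebras on `X` via `f ↦ f ⊗ 1`; the complete algebra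
`lim 𝒜_d` is the sheaf `𝒫_X` of principal parts, and `idealZero` is its ideal
`ℐ_X = Ker(𝒫_X → 𝒪_X)`. For `g : Y ⟶ X`, the complete inverse images of `𝒫_X` and `ℐ_X` are the
complete algebra and `idealZero` of the tower `(principalParts p).pullback g`. -/
def principalParts : Tower X where
  obj d := ((pullback.diagonal p).ker ^ (d + 1)).subscheme
  hom d := ((pullback.diagonal p).ker ^ (d + 1)).subschemeι ≫ pullback.fst p p
  trans d := Scheme.IdealSheafData.inclusion
    (pow_le_pow_right_of_le_one' le_top (Nat.le_succ (d + 1)))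
  trans_hom _ := by rw [← Category.assoc, Scheme.IdealSheafData.inclusion_subschemeι]

/-- `Γ(U, 𝒟_X)`, where `𝒟_X = ℋom^cont(𝒫_X, 𝒪_X)` is the sheaf of differential operators,
as a left `𝒪_X`-module. -/
abbrev DiffOp (U : X.Opens) : Submodule Γ(X, U) (LinearFamily (principalParts p) U) :=
  continuousDual (principalParts p) U

/-- Differential operators of order `≤ d`: those that vanish on `Ker(𝒫_X → 𝒪_{X × X} / ℐ^(d+1))`. -/
def diffOpLE (U : X.Opens) (d : ℕ) : Submodule Γ(X, U) (DiffOp p U) where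
  carrier := {δ | ∀ (W : X.Opens) (hW : W ≤ U) (s : (principalParts p).Sections W),
    (principalParts p).proj W d s = 0 → δ.1 ⟨W, hW⟩ s = 0}
  add_mem' {a b} ha hb W hW s hs := by
    change a.1 ⟨W, hW⟩ s + b.1 ⟨W, hW⟩ s = 0
    rw [ha W hW s hs, hb W hW s hs, add_zero]
  zero_mem' W hW s hs := rfl
  smul_mem' f a ha W hW s hs := by
    change resO X hW f * a.1 ⟨W, hW⟩ s = 0
    rw [ha W hW s hs, mul_zero]

/-- `Γ(U, 𝒟_X / 𝒪_X)`, where `𝒪_X ⊆ 𝒟_X` consists of the operators of order zero. The quotient of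
presheaves is already a sheaf, because `δ ↦ δ(1)` splits the inclusion `𝒪_X ⊆ 𝒟_X`. -/
abbrev DiffOpModO (U : X.Opens) : Type u := DiffOp p U ⧸ diffOpLE p U 0

/-- The class of a differential operator modulo `𝒪_X`. -/
abbrev DiffOpModO.mk (U : X.Opens) : DiffOp p U →ₗ[Γ(X, U)] DiffOpModO p U :=
  (diffOpLE p U 0).mkQ

/-- Restriction of differential operators to a smaller open set. -/
def DiffOp.res {U V : X.Opens} (e : V ≤ U) (δ : DiffOp p U) : DiffOp p V :=
  ⟨fun W => δ.1 ⟨W.1, W.2.trans e⟩, fun V' hV' W e' s => δ.2.1 V' (hV'.trans e) W e' s,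
    fun x hx =>
      let ⟨V', hxV', d, h⟩ := δ.2.2 x (e hx)
      ⟨V', hxV', d, fun W hW hWV s hs => h W (hW.trans e) hWV s hs⟩⟩

/-! ### The bundle of formal coordinate systems -/

/-- A relative spectrum `π : E ⟶ X` of the symmetric algebra of the `𝒪_X`-module
`(𝒟_X / 𝒪_X)^{⊕ n}`: the morphism `π` is affine, and the direct image of `𝒪_E` is the symmetric
algebra, which is expressed by an `𝒪_X`-linear homomorphism `taut` of sheaves from
`(𝒟_X / 𝒪_X)^{⊕ n}` to the direct image of `𝒪_E` that exhibits `Γ(π⁻¹ U, 𝒪_E)` as the symmetric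
algebra of the `Γ(U, 𝒪_X)`-module `Γ(U, 𝒟_X / 𝒪_X)^{⊕ n}` for every affine open set `U`. As usual, a
relative spectrum is determined by this up to a unique isomorphism over `X`. -/
structure SymSpec (n : ℕ) where
  E : Scheme.{u}
  π : E ⟶ X
  isAffineHom : IsAffineHom π
  taut : ∀ U : X.Opens, (Fin n → DiffOpModO p U) →ₛₗ[(π.app U).hom] Γ(E, π ⁻¹ᵁ U)
  taut_res : ∀ (U V : X.Opens) (e : V ≤ U) (δ : Fin n → DiffOp p U),
    taut V (fun j => DiffOpModO.mk p V (DiffOp.res p e (δ j))) =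
      resO E (π.preimage_mono e) (taut U fun j => DiffOpModO.mk p U (δ j))
  isSymmetricAlgebra : ∀ U : X.Opens, IsAffineOpen U →
    ∃ ψ : SymmetricAlgebra Γ(X, U) (Fin n → DiffOpModO p U) ≃+* Γ(E, π ⁻¹ᵁ U),
      (∀ f : Γ(X, U), ψ (algebraMap _ _ f) = π.app U f) ∧
      ∀ m : Fin n → DiffOpModO p U, ψ (SymmetricAlgebra.ι Γ(X, U) _ m) = taut U m

namespace SymSpec

variable {p} {n : ℕ} (A : SymSpec p n)

/-- The function on `π⁻¹ U` that corresponds to the operator `δ` in the `j`-th copy of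
`𝒟_X / 𝒪_X`. -/
def coord (U : X.Opens) (δ : DiffOp p U) (j : Fin n) : Γ(A.E, A.π ⁻¹ᵁ U) :=
  A.taut U (Pi.single j (DiffOpModO.mk p U δ))

/-- The open set of `E` where the universal sequence `(t₁, …, tₙ)` satisfies `t₁ ∧ ⋯ ∧ tₙ ≠ 0` in
the top exterior power of `ℐ_X / ℐ_X² = Ω¹_X`: locally on `X` there are first order operators
`∂₁, …, ∂ₙ` for which the determinant of the matrix of the coordinate functions of `∂ᵢ` in the
`j`-th copy of `𝒟_X / 𝒪_X` does not vanish. -/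
def coorOpen : A.E.Opens :=
  ⨆ (U : X.Opens) (δ : Fin n → diffOpLE p U 1),
    A.E.basicOpen (Matrix.of fun i j : Fin n => A.coord U (δ i).1 j).det

/-- The bundle `Coor X` of formal coordinate systems, as an `X`-scheme. -/
def coor : Over X := Over.mk (A.coorOpen.ι ≫ A.π)

end SymSpec

/-! ### The moduli problem -/

/-- For an `X`-scheme `g : Y ⟶ X`: the isomorphisms `φ : 𝒪_Y[[t]] ≅ g^*^ 𝒫_X` of sheaves of
`𝒪_Y`-algebras that carry the ideal generated by `t` onto the complete inverse image of `ℐ_X`. -/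
structure FormalIso (n : ℕ) (Y : Over X) extends
    PowerSeriesIso n ((principalParts p).pullback Y.hom) (⊤ : Y.left.Opens) where
  map_ideal : ∀ V : Y.left.Opens,
    (Ideal.span (Set.range fun j : Fin n => (MvPowerSeries.X j : MvPowerSeries (Fin n) Γ(Y.left, V)))).map
        (iso V le_top : MvPowerSeries (Fin n) Γ(Y.left, V) →+* _) =
      ((principalParts p).pullback Y.hom).idealZero V

variable {p}

/-- `φ'` is the (complete) inverse image of `φ` along the morphism `h : Y' ⟶ Y` of `X`-schemes. -/
def FormalIso.IsBaseChange {n : ℕ} {Y' Y : Over X} (h : Y' ⟶ Y) (φ : FormalIso p n Y)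
    (φ' : FormalIso p n Y') : Prop :=
  ∀ (V : Y.left.Opens) (f : MvPowerSeries (Fin n) Γ(Y.left, V)),
    φ'.iso (h.left ⁻¹ᵁ V) le_top (MvPowerSeries.map (h.left.app V).hom f) =
      ((principalParts p).pullbackOver h.left (Over.w h)).pull V (h.left ⁻¹ᵁ V) le_rfl (φ.iso V le_top f)

/-- The sequence `(φ(t₁), …, φ(tₙ))` of global sections. -/
def FormalIso.coords {n : ℕ} {Y : Over X} (φ : FormalIso p n Y) (j : Fin n) :
    ((principalParts p).pullback Y.hom).Sections ⊤ :=
  φ.iso ⊤ le_top (MvPowerSeries.X j)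

variable (p)

/-- Systems of formal coordinates on an open set `U` of `X`: sequences of sections of `ℐ_X` over `U`
for which the homomorphism `𝒪_U[[t]] → 𝒫_X|_U` of sheaves of rings that extends
`f ↦ f ⊗ 1` and sends the variables to the sequence is an isomorphism. (An algebra homomorphism that
sends the variables into `ℐ_X` is determined by the images of the variables.) -/
def FormalCoords (n : ℕ) (U : X.Opens) : Type u :=
  {t : Fin n → (principalParts p).Sections U //
    (∀ j, t j ∈ (principalParts p).idealZero U) ∧
    ∃ ψ : PowerSeriesIso n (principalParts p) U, ∀ j, ψ.iso U le_rfl (MvPowerSeries.X j) = t j}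

/-- `F` is the functor `Y ↦ {φ : 𝒪_Y[[t]] ≅ g^*^ 𝒫_X}`, acting on morphisms by inverse image;
`e` is the identification of the values of `F` with the sets of isomorphisms. -/
def IsModuliFunctor (n : ℕ) (F : (Over X)ᵒᵖ ⥤ Type u)
    (e : ∀ Y : Over X, F.obj (op Y) ≃ FormalIso p n Y) : Prop :=
  ∀ (Y' Y : Over X) (h : Y' ⟶ Y) (x : F.obj (op Y)),
    FormalIso.IsBaseChange h (e Y x) (e Y' (F.map h.op x))

end PrincipalParts

end FormalGeometry

end

/-! The theorem rests on local coordinates, on a duality between differential operators and Taylor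
coefficients, and on the inverse function theorem for power series.

Coordinates. If `U` is a small affine open set with algebra `A` over the base, smoothness makes the
conormal module of the diagonal in `A ⊗ A` free of rank `n`. Formal smoothness of `A ⊗ A` over the
left factor then lifts a basis to `s₁, …, sₙ` for which every quotient of `A ⊗ A` by a power
`ℐ^(d+1)` is `A[t]/(t)^(d+1)` (`isTruncBasis_of_formallySmooth`, `exists_chart`). Freeness on
monomials survives base change, so along any `g : Y ⟶ X` the complete inverse image of `𝒫_X` is
locally `𝒪_Y[[s]]`, and sections have Taylor coefficients.

Formal isomorphisms. An isomorphism from `𝒪_Y[[t]]` that sends the variables into the augmentation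
ideal is determined by their images and respects all truncations, without a continuity assumption
(`PowerSeriesIso.isCoord`). Hence `F(Y)` is the set of `n`-tuples of global sections that are formal
coordinates (`IsCoord`). In a chart these are the tuples in the augmentation ideal whose matrix of
linear Taylor coefficients is invertible (`IsCoord.isUnit_det`, `IsCoord.of_isUnit_det`).

Duality. Over a chart the operators "coefficient of `s^α`" form a basis of `𝒟_X`, and the one with
`α = 0` spans `𝒪_X`. A section of the inverse image of `ℐ_X` is therefore the same as an
`𝒪_X`-linear map from `𝒟_X / 𝒪_X` to functions on `Y`, so `n` such sections are the same as an
`X`-morphism `Y ⟶ E`. The relation `Corr` expresses this in every chart at once;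
`CorrAt.change_chart` shows its independence of the chart, and `Corr.exists_sections`, `Corr.eq`,
`exists_hom`, `Corr.hom_eq` make it a bijection. The Jacobian is the transpose of the pulled back
matrix of first order coordinate functions, so coordinates correspond exactly to morphisms that land
in `Coor X` (`Corr.isCoord_iff`). Compatibility with pullback gives representability, and the case
of an open `U ⊆ X` gives the statement about sections.

Existence of `E`. On affine open sets `𝒟_X / 𝒪_X` commutes with localization: this is checked in
charts, where operators are finite sums of coefficient operators, and then glued after clearing
denominators. Symmetric algebras inherit the property (`isLocalization_symMap`), so the spectra
glue. -/

noncomputable section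

namespace FormalGeometry

/-! ### Truncated polynomial algebras -/

section Trunc

variable {n : ℕ} {R A : Type*} [CommRing R] [CommRing A]

open MvPolynomial Finsupp

/-- The algebra `A` over `R` is `R[t]/(t)^(d+1)`, where `t` corresponds to `s`. -/
structure IsTruncBasis (φ : R →+* A) (s : Fin n → A) (d : ℕ) : Prop where
  surj : Function.Surjective (eval₂Hom φ s)
  ker : RingHom.ker (eval₂Hom φ s) = idealOfVars (Fin n) R ^ (d + 1)

/-- The finite set of exponents of degree at most `d`. -/
def degLE (n d : ℕ) : Finset (Fin n →₀ ℕ) := (Finsupp.finite_of_degree_le d).toFinset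

@[simp]
theorem mem_degLE {d : ℕ} {α : Fin n →₀ ℕ} : α ∈ degLE n d ↔ α.degree ≤ d := by
  simp [degLE]

/-- The monomial in `s` with exponent `α`. -/
def mono (s : Fin n → A) (α : Fin n →₀ ℕ) : A := ∏ j, s j ^ α j

theorem eval₂Hom_monomial_eq (φ : R →+* A) (s : Fin n → A) (α : Fin n →₀ ℕ) (r : R) :
    eval₂Hom φ s (monomial α r) = φ r * mono s α := by
  rw [coe_eval₂Hom, eval₂_monomial, Finsupp.prod_fintype _ _ (fun _ => pow_zero _), mono]

theorem map_mono {A' : Type*} [CommRing A'] (ψ : A →+* A') (s : Fin n → A) (α : Fin n →₀ ℕ) :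
    ψ (mono s α) = mono (fun j => ψ (s j)) α := by
  simp [mono]

/-- Polynomials with exponents in `degLE`. -/
def polyOfCoeff (d : ℕ) (c : degLE n d → R) : MvPolynomial (Fin n) R :=
  ∑ α, monomial α.1 (c α)

theorem coeff_polyOfCoeff (d : ℕ) (c : degLE n d → R) (α : degLE n d) :
    coeff α.1 (polyOfCoeff d c) = c α := by
  classical
  simp only [polyOfCoeff, coeff_sum, coeff_monomial]
  rw [Finset.sum_eq_single α]
  · simp
  · intro b _ hb
    rw [if_neg fun h => hb (Subtype.ext h)]
  · simp

theorem sub_polyOfCoeff_mem (d : ℕ) (p : MvPolynomial (Fin n) R) :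
    p - polyOfCoeff d (fun α => coeff α.1 p) ∈ idealOfVars (Fin n) R ^ (d + 1) := by
  rw [mem_pow_idealOfVars_iff']
  intro α hα
  rw [coeff_sub, coeff_polyOfCoeff d (fun α => coeff α.1 p) ⟨α, by simp; omega⟩, sub_self]

theorem polyOfCoeff_mem_iff (d : ℕ) (c : degLE n d → R) :
    polyOfCoeff d c ∈ idealOfVars (Fin n) R ^ (d + 1) ↔ c = 0 := by
  rw [mem_pow_idealOfVars_iff']
  constructor
  · intro h
    ext α
    rw [← coeff_polyOfCoeff d c α]
    exact h _ (Nat.lt_succ_of_le (mem_degLE.1 α.2))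
  · rintro rfl α hα
    exact coeff_polyOfCoeff d 0 ⟨α, by simp; omega⟩

theorem eval₂Hom_polyOfCoeff (φ : R →+* A) (s : Fin n → A) (d : ℕ) (c : degLE n d → R) :
    eval₂Hom φ s (polyOfCoeff d c) = ∑ α, φ (c α) * mono s α.1 := by
  rw [polyOfCoeff, map_sum]
  exact Finset.sum_congr rfl fun α _ => eval₂Hom_monomial_eq ..

theorem idealOfVars_pow_le_ker {φ : R →+* A} {s : Fin n → A} {d : ℕ}
    (h : ∀ α : Fin n →₀ ℕ, d < α.degree → mono s α = 0) :
    idealOfVars (Fin n) R ^ (d + 1) ≤ RingHom.ker (eval₂Hom φ s) := by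
  intro p hp
  rw [mem_pow_idealOfVars_iff] at hp
  rw [RingHom.mem_ker, p.as_sum, map_sum]
  refine Finset.sum_eq_zero fun α hα => ?_
  rw [eval₂Hom_monomial_eq, h α (hp α hα), mul_zero]

theorem IsTruncBasis.mono_eq_zero {φ : R →+* A} {s : Fin n → A} {d : ℕ}
    (h : IsTruncBasis φ s d) {α : Fin n →₀ ℕ} (hα : d < α.degree) : mono s α = 0 := by
  have : monomial α (1 : R) ∈ RingHom.ker (eval₂Hom φ s) := by
    rw [h.ker, mem_pow_idealOfVars_iff']
    intro β hβ
    classical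
    rw [coeff_monomial, if_neg]
    rintro rfl
    omega
  rw [RingHom.mem_ker, eval₂Hom_monomial_eq, map_one, one_mul] at this
  exact this

/-- Truncated polynomial algebras have the monomials of degree at most `d` as a basis. -/
theorem isTruncBasis_iff {φ : R →+* A} {s : Fin n → A} {d : ℕ} :
    IsTruncBasis φ s d ↔ (∀ α : Fin n →₀ ℕ, d < α.degree → mono s α = 0) ∧
      Function.Bijective (fun c : degLE n d → R => ∑ α, φ (c α) * mono s α.1) := by
  constructor
  · intro h
    refine ⟨fun α hα => h.mono_eq_zero hα, fun c c' hc => ?_, fun a => ?_⟩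
    · have : polyOfCoeff d (c - c') ∈ RingHom.ker (eval₂Hom φ s) := by
        rw [RingHom.mem_ker, eval₂Hom_polyOfCoeff]
        simp only [Pi.sub_apply, map_sub, sub_mul, Finset.sum_sub_distrib]
        exact sub_eq_zero.2 hc
      rw [h.ker, polyOfCoeff_mem_iff] at this
      exact sub_eq_zero.1 this
    · obtain ⟨p, rfl⟩ := h.surj a
      refine ⟨fun α => coeff α.1 p, ?_⟩
      have := sub_polyOfCoeff_mem d p
      rw [← h.ker, RingHom.mem_ker, map_sub, eval₂Hom_polyOfCoeff, sub_eq_zero] at this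
      exact this.symm
  · rintro ⟨h₁, h₂, h₃⟩
    refine ⟨fun a => ?_, le_antisymm (fun p hp => ?_) (idealOfVars_pow_le_ker h₁)⟩
    · obtain ⟨c, rfl⟩ := h₃ a
      exact ⟨polyOfCoeff d c, eval₂Hom_polyOfCoeff ..⟩
    · have h := sub_polyOfCoeff_mem d p
      suffices (fun α : degLE n d => coeff α.1 p) = 0 by
        rw [this] at h
        simpa [polyOfCoeff] using h
      apply h₂
      have h' := idealOfVars_pow_le_ker (φ := φ) h₁ h
      rw [RingHom.mem_ker, map_sub, RingHom.mem_ker.1 hp, zero_sub, neg_eq_zero,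
        eval₂Hom_polyOfCoeff] at h'
      simpa using h'

/-- Finiteness over `R` is what allows a surjective endomorphism of this module to be recognized as
bijective. -/
theorem finite_quotient_idealOfVars_pow (n d : ℕ) (R : Type*) [CommRing R] :
    Module.Finite R (MvPolynomial (Fin n) R ⧸ idealOfVars (Fin n) R ^ (d + 1)) := by
  let f : (degLE n d → R) →ₗ[R] MvPolynomial (Fin n) R :=
    { toFun := polyOfCoeff d
      map_add' := fun c c' => by simp [polyOfCoeff, Finset.sum_add_distrib]
      map_smul' := fun r c => by simp [polyOfCoeff, Finset.smul_sum, smul_monomial] }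
  refine Module.Finite.of_surjective ((Ideal.Quotient.mkₐ R _).toLinearMap ∘ₗ f) fun a => ?_
  obtain ⟨p, rfl⟩ := Ideal.Quotient.mk_surjective a
  exact ⟨fun α => coeff α.1 p, (Ideal.Quotient.eq.2 (sub_polyOfCoeff_mem d p)).symm⟩

/-- A subring that contains representatives modulo a nilpotent ideal `J`, and representatives of `J`
modulo `J²`, is the whole ring. -/
theorem subring_eq_top_of_nilpotent (S : Subring A) (J : Ideal A) (hJ : IsNilpotent J)
    (h₀ : ∀ x : A, ∃ y ∈ S, x - y ∈ J) (h₁ : ∀ x ∈ J, ∃ y ∈ S, x - y ∈ J ^ 2) : S = ⊤ := by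
  have h₁' : ∀ x ∈ J, ∃ y ∈ S, y ∈ J ∧ x - y ∈ J ^ 2 := fun x hx => by
    obtain ⟨y, hy, h⟩ := h₁ x hx
    refine ⟨y, hy, ?_, h⟩
    have := J.sub_mem hx (Ideal.pow_le_self two_ne_zero h)
    simpa using this
  -- Approximants are kept inside `J ^ k`: the error `(a - a') * b + a' * (b - b')` of a product
  -- gains an order only if `a'` itself lies in `J ^ k`.
  have h₂ : ∀ k, ∀ x ∈ J ^ k, ∃ y ∈ S, y ∈ J ^ k ∧ x - y ∈ J ^ (k + 1) := by
    intro k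
    induction k with
    | zero =>
      intro x _
      obtain ⟨y, hy, h⟩ := h₀ x
      exact ⟨y, hy, by simp, by simpa using h⟩
    | succ k ih =>
      intro x hx
      rw [pow_succ] at hx
      induction hx using Submodule.mul_induction_on' with
      | mem_mul_mem a ha b hb =>
        obtain ⟨a', ha', ha'', ha3⟩ := ih a ha
        obtain ⟨b', hb', hb'', hb3⟩ := h₁' b hb
        refine ⟨a' * b', S.mul_mem ha' hb', ?_, ?_⟩
        · rw [pow_succ]
          exact Ideal.mul_mem_mul ha'' hb''
        · have : a * b - a' * b' = (a - a') * b + a' * (b - b') := by ring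
          rw [this]
          refine Ideal.add_mem _ ?_ ?_
          · rw [pow_succ]
            exact Ideal.mul_mem_mul ha3 hb
          · rw [add_assoc, pow_add]
            exact Ideal.mul_mem_mul ha'' hb3
      | add a _ b _ ha hb =>
        obtain ⟨a', ha', ha'', ha3⟩ := ha
        obtain ⟨b', hb', hb'', hb3⟩ := hb
        refine ⟨a' + b', S.add_mem ha' hb', Ideal.add_mem _ ha'' hb'', ?_⟩
        rw [add_sub_add_comm]
        exact Ideal.add_mem _ ha3 hb3
  have h₃ : ∀ k, ∀ x : A, ∃ y ∈ S, x - y ∈ J ^ k := by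
    intro k
    induction k with
    | zero => exact fun x => ⟨0, S.zero_mem, by simp⟩
    | succ k ih =>
      intro x
      obtain ⟨y, hy, h⟩ := ih x
      obtain ⟨z, hz, -, h'⟩ := h₂ k _ h
      exact ⟨y + z, S.add_mem hy hz, by rwa [← sub_sub]⟩
  obtain ⟨k, hk⟩ := hJ
  refine eq_top_iff.2 fun x _ => ?_
  obtain ⟨y, hy, h⟩ := h₃ k x
  rw [hk, Ideal.zero_eq_bot, Ideal.mem_bot, sub_eq_zero] at h
  rwa [h]

/-- A Nakayama argument for algebras: the range of the evaluation is a subring that contains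
constants and the linear forms in `a`, hence everything once `J` is nilpotent. -/
theorem eval₂Hom_surjective_of_nilpotent (φ : R →+* A) (a : Fin n → A) (J : Ideal A)
    (hJ : IsNilpotent J) (h₀ : ∀ x : A, ∃ r : R, x - φ r ∈ J)
    (h₁ : ∀ x ∈ J, ∃ c : Fin n → R, x - ∑ i, φ (c i) * a i ∈ J ^ 2) :
    Function.Surjective (eval₂Hom φ a) := by
  rw [← RingHom.range_eq_top]
  refine subring_eq_top_of_nilpotent _ J hJ (fun x => ?_) fun x hx => ?_
  · obtain ⟨r, hr⟩ := h₀ x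
    exact ⟨φ r, ⟨C r, by simp⟩, hr⟩
  · obtain ⟨c, hc⟩ := h₁ x hx
    exact ⟨_, ⟨∑ i, C (c i) * X i, by simp⟩, hc⟩

/-- Generators of the augmentation ideal of a truncated polynomial algebra modulo its square form a
system of coordinates. -/
theorem IsTruncBasis.of_surjective {φ : R →+* A} {s : Fin n → A} {d : ℕ} (h : IsTruncBasis φ s d)
    (a : Fin n → A) (ha : ∀ α : Fin n →₀ ℕ, d < α.degree → mono a α = 0)
    (hsurj : Function.Surjective (eval₂Hom φ a)) : IsTruncBasis φ a d := by
  refine ⟨hsurj, le_antisymm ?_ (idealOfVars_pow_le_ker ha)⟩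
  let _ := φ.toAlgebra
  let P := MvPolynomial (Fin n) R ⧸ idealOfVars (Fin n) R ^ (d + 1)
  have := finite_quotient_idealOfVars_pow n d R
  let f : P →ₐ[R] A := Ideal.Quotient.liftₐ _ (aeval s) fun p hp => by
    rw [← h.ker] at hp
    exact hp
  let g : P →ₐ[R] A := Ideal.Quotient.liftₐ _ (aeval a) fun p hp =>
    idealOfVars_pow_le_ker (φ := φ) ha hp
  have hf : Function.Bijective f := by
    constructor
    · rw [injective_iff_map_eq_zero]
      intro x hx
      obtain ⟨p, rfl⟩ := Ideal.Quotient.mk_surjective x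
      rw [Ideal.Quotient.eq_zero_iff_mem, ← h.ker]
      exact hx
    · intro x
      obtain ⟨p, hp⟩ := h.surj x
      exact ⟨Ideal.Quotient.mk _ p, hp⟩
  let e := AlgEquiv.ofBijective f hf
  have hg : Function.Surjective g := fun x => by
    obtain ⟨p, hp⟩ := hsurj x
    exact ⟨Ideal.Quotient.mk _ p, hp⟩
  -- Both `s` and `a` present `A` as a quotient of the finite module `P`, the first one
  -- isomorphically. The comparison is a surjective endomorphism of a finite module, hence
  -- injective.
  have := OrzechProperty.bijective_of_surjective_endomorphism
    (e.symm.toLinearMap ∘ₗ g.toLinearMap) (e.symm.surjective.comp hg)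
  intro p hp
  rw [← Ideal.Quotient.eq_zero_iff_mem]
  apply this.1
  have : g (Ideal.Quotient.mk _ p) = 0 := hp
  simp [this]

theorem map_idealOfVars (φ : R →+* A) (s : Fin n → A) :
    (idealOfVars (Fin n) R).map (eval₂Hom φ s) = Ideal.span (Set.range s) := by
  rw [idealOfVars, Ideal.map_span, ← Set.range_comp]
  congr 2
  ext j
  simp

theorem IsTruncBasis.span_pow_eq_bot {φ : R →+* A} {s : Fin n → A} {d : ℕ}
    (h : IsTruncBasis φ s d) : Ideal.span (Set.range s) ^ (d + 1) = ⊥ := by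
  rw [← map_idealOfVars φ, ← Ideal.map_pow, eq_bot_iff, Ideal.map_le_iff_le_comap, ← h.ker]
  exact le_rfl

theorem mono_mem_pow {J : Ideal A} {a : Fin n → A} (ha : ∀ i, a i ∈ J) (α : Fin n →₀ ℕ) :
    mono a α ∈ J ^ α.degree := by
  rw [degree_eq_sum, ← Finset.prod_pow_eq_pow_sum]
  exact Ideal.prod_mem_prod fun i _ => Ideal.pow_mem_pow (ha i) _

theorem sub_C_mem_idealOfVars (p : MvPolynomial (Fin n) R) :
    p - C (coeff 0 p) ∈ idealOfVars (Fin n) R := by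
  rw [← pow_one (idealOfVars _ _), mem_pow_idealOfVars_iff']
  intro α hα
  obtain rfl : α = 0 := (degree_eq_zero_iff α).1 (by omega)
  simp

theorem exists_eq_single_of_degree_eq_one {α : Fin n →₀ ℕ} (h : α.degree = 1) :
    ∃ j, α = single j 1 := by
  have h₀ : α ≠ 0 := by
    rintro rfl
    simp at h
  obtain ⟨j, hj⟩ := Finsupp.ne_iff.1 h₀
  have h₁ : single j 1 ≤ α := Finsupp.single_le_iff.2 (Nat.one_le_iff_ne_zero.2 hj)
  obtain ⟨β, rfl⟩ := exists_add_of_le h₁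
  rw [map_add, degree_single, Nat.add_eq_left, degree_eq_zero_iff] at h
  exact ⟨j, by rw [h, add_zero]⟩

theorem sub_linear_mem_idealOfVars_sq {p : MvPolynomial (Fin n) R}
    (hp : p ∈ idealOfVars (Fin n) R) :
    p - ∑ j, C (coeff (single j 1) p) * X j ∈ idealOfVars (Fin n) R ^ 2 := by
  classical
  rw [mem_pow_idealOfVars_iff']
  rw [← pow_one (idealOfVars _ _), mem_pow_idealOfVars_iff'] at hp
  intro α hα
  simp only [coeff_sub, coeff_sum, coeff_C_mul, coeff_X]
  obtain h | h : α.degree = 0 ∨ α.degree = 1 := by omega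
  · obtain rfl : α = 0 := (degree_eq_zero_iff α).1 h
    rw [hp 0 (by simp)]
    simp
  · obtain ⟨j, rfl⟩ := exists_eq_single_of_degree_eq_one h
    simp [Finsupp.single_left_inj]

theorem IsTruncBasis.exists_sub_mem {φ : R →+* A} {s : Fin n → A} {d : ℕ}
    (h : IsTruncBasis φ s d) (x : A) : ∃ r : R, x - φ r ∈ Ideal.span (Set.range s) := by
  obtain ⟨p, rfl⟩ := h.surj x
  refine ⟨coeff 0 p, ?_⟩
  have := Ideal.mem_map_of_mem (eval₂Hom φ s) (sub_C_mem_idealOfVars p)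
  rw [map_idealOfVars] at this
  simpa using this

theorem IsTruncBasis.exists_linear {φ : R →+* A} {s : Fin n → A} {d : ℕ}
    (h : IsTruncBasis φ s d) {x : A} (hx : x ∈ Ideal.span (Set.range s)) :
    ∃ c : Fin n → R, x - ∑ j, φ (c j) * s j ∈ Ideal.span (Set.range s) ^ 2 := by
  rw [← map_idealOfVars φ, Ideal.mem_map_iff_of_surjective _ h.surj] at hx
  obtain ⟨p, hp, rfl⟩ := hx
  refine ⟨fun j => coeff (single j 1) p, ?_⟩
  have := Ideal.mem_map_of_mem (eval₂Hom φ s) (sub_linear_mem_idealOfVars_sq hp)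
  rw [Ideal.map_pow, map_idealOfVars] at this
  simpa using this

/-- The inverse function theorem for truncated polynomial algebras. -/
theorem IsTruncBasis.of_isUnit_det {φ : R →+* A} {s : Fin n → A} {d : ℕ} (h : IsTruncBasis φ s d)
    (a : Fin n → A) (M : Matrix (Fin n) (Fin n) R) (hM : IsUnit M.det)
    (ha : ∀ i, a i - ∑ j, φ (M i j) * s j ∈ Ideal.span (Set.range s) ^ 2) :
    IsTruncBasis φ a d := by
  set J := Ideal.span (Set.range s) with hJ
  have hs : ∀ j, s j ∈ J := fun j => Ideal.subset_span ⟨j, rfl⟩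
  have haJ : ∀ i, a i ∈ J := fun i => by
    have h₁ := Ideal.pow_le_self two_ne_zero (ha i)
    have h₂ : ∑ j, φ (M i j) * s j ∈ J := Ideal.sum_mem _ fun j _ => Ideal.mul_mem_left _ _ (hs j)
    simpa using J.add_mem h₁ h₂
  refine h.of_surjective a (fun α hα => ?_) ?_
  · have := Ideal.pow_le_pow_right (Nat.succ_le_of_lt hα) (mono_mem_pow haJ α)
    rwa [Nat.succ_eq_add_one, h.span_pow_eq_bot, Ideal.mem_bot] at this
  · refine eval₂Hom_surjective_of_nilpotent φ a J ⟨d + 1, h.span_pow_eq_bot⟩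
      (fun x => h.exists_sub_mem x) fun x hx => ?_
    obtain ⟨c, hc⟩ := h.exists_linear hx
    -- Modulo `J²` one has `a = M s`, so the linear form `c · s` equals `(c M⁻¹) · a`.
    refine ⟨Matrix.vecMul c M⁻¹, ?_⟩
    have key : ∑ i, φ (Matrix.vecMul c M⁻¹ i) * (a i - ∑ j, φ (M i j) * s j) ∈ J ^ 2 :=
      Ideal.sum_mem _ fun i _ => Ideal.mul_mem_left _ _ (ha i)
    have h₂ : ∑ i, φ (Matrix.vecMul c M⁻¹ i) * ∑ j, φ (M i j) * s j = ∑ j, φ (c j) * s j := by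
      have : ∀ j, ∑ i, Matrix.vecMul c M⁻¹ i * M i j = c j := fun j => by
        change Matrix.vecMul (Matrix.vecMul c M⁻¹) M j = c j
        rw [Matrix.vecMul_vecMul, Matrix.nonsing_inv_mul _ hM, Matrix.vecMul_one]
      simp only [Finset.mul_sum]
      rw [Finset.sum_comm]
      refine Finset.sum_congr rfl fun j _ => ?_
      rw [← this j, map_sum, Finset.sum_mul]
      exact Finset.sum_congr rfl fun i _ => by rw [map_mul, mul_assoc]
    simp only [mul_sub, Finset.sum_sub_distrib, h₂] at key
    have := Ideal.sub_mem _ hc key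
    rwa [sub_sub_sub_cancel_right] at this

theorem isTruncBasis_quotient (n d : ℕ) (R : Type*) [CommRing R] :
    IsTruncBasis ((Ideal.Quotient.mk (idealOfVars (Fin n) R ^ (d + 1))).comp C)
      (fun j => Ideal.Quotient.mk _ (X j)) d := by
  have : eval₂Hom ((Ideal.Quotient.mk (idealOfVars (Fin n) R ^ (d + 1))).comp C)
      (fun j => Ideal.Quotient.mk _ (X j)) = Ideal.Quotient.mk _ := by
    ext <;> simp
  refine ⟨?_, ?_⟩
  · rw [this]
    exact Ideal.Quotient.mk_surjective
  · rw [this, Ideal.mk_ker]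

/-- An augmented formally smooth algebra with a free conormal module has truncated polynomial
algebras as its infinitesimal neighbourhoods. -/
theorem isTruncBasis_of_formallySmooth {B C' : Type*} [CommRing B] [CommRing C'] [Algebra R B]
    [Algebra.FormallySmooth R B] (ε : B →ₐ[R] R) (a : Fin n → B) (ha : ∀ i, ε (a i) = 0)
    (hgen : ∀ x, ε x = 0 → ∃ c : Fin n → R,
      x - ∑ i, algebraMap R B (c i) * a i ∈ RingHom.ker ε ^ 2)
    (hind : ∀ c : Fin n → R, ∑ i, algebraMap R B (c i) * a i ∈ RingHom.ker ε ^ 2 → c = 0)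
    (q : B →+* C') (hq : Function.Surjective q) (d : ℕ)
    (hker : RingHom.ker q = RingHom.ker ε ^ (d + 1)) :
    IsTruncBasis (q.comp (algebraMap R B)) (fun i => q (a i)) d := by
  set I := RingHom.ker ε with hI
  have haI : ∀ i, a i ∈ I := ha
  have hε : ∀ x : B, x - algebraMap R B (ε x) ∈ I := fun x => by
    rw [hI, RingHom.mem_ker, map_sub, AlgHom.commutes, Algebra.algebraMap_self, RingHom.id_apply,
      sub_self]
  have hqI : (I.map q) ^ (d + 1) = ⊥ := by
    rw [← Ideal.map_pow, ← hker, eq_bot_iff, Ideal.map_le_iff_le_comap]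
    exact le_rfl
  have hnil : ∀ α : Fin n →₀ ℕ, d < α.degree → mono (fun i => q (a i)) α = 0 := fun α hα => by
    have := Ideal.pow_le_pow_right (Nat.succ_le_of_lt hα)
      (mono_mem_pow (fun i => Ideal.mem_map_of_mem q (haI i)) α)
    rwa [Nat.succ_eq_add_one, hqI, Ideal.mem_bot] at this
  refine ⟨?_, le_antisymm (fun p hp => ?_) (idealOfVars_pow_le_ker hnil)⟩
  · refine eval₂Hom_surjective_of_nilpotent _ _ (I.map q) ⟨d + 1, hqI⟩ (fun x => ?_) fun x hx => ?_
    · obtain ⟨y, rfl⟩ := hq x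
      refine ⟨ε y, ?_⟩
      have := Ideal.mem_map_of_mem q (hε y)
      simpa using this
    · obtain ⟨y, hy, rfl⟩ := (Ideal.mem_map_iff_of_surjective q hq).1 hx
      obtain ⟨c, hc⟩ := hgen y hy
      refine ⟨c, ?_⟩
      have := Ideal.mem_map_of_mem q hc
      rw [Ideal.map_pow] at this
      simpa using this
  · let T := idealOfVars (Fin n) R
    -- To first order `B` already is a polynomial algebra; bijectivity of `F` combines the
    -- augmentation (constant term) with freeness of `I / I²` (linear term).
    let F : MvPolynomial (Fin n) R ⧸ T ^ 2 →ₐ[R] B ⧸ I ^ 2 :=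
      Ideal.Quotient.liftₐ _ ((Ideal.Quotient.mkₐ R (I ^ 2)).comp (aeval a)) fun p hp => by
        change Ideal.Quotient.mk (I ^ 2) (aeval a p) = 0
        rw [Ideal.Quotient.eq_zero_iff_mem]
        have h₁ := Ideal.mem_map_of_mem (eval₂Hom (algebraMap R B) a) hp
        rw [Ideal.map_pow, map_idealOfVars] at h₁
        refine Ideal.pow_right_mono (Ideal.span_le.2 ?_) 2 h₁
        rintro _ ⟨i, rfl⟩
        exact haI i
    have hF : ∀ p, F (Ideal.Quotient.mk _ p) = Ideal.Quotient.mk _ (aeval a p) := fun _ => rfl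
    have hFb : Function.Bijective F := by
      constructor
      · rw [injective_iff_map_eq_zero]
        intro x hx
        obtain ⟨p, rfl⟩ := Ideal.Quotient.mk_surjective x
        rw [hF, Ideal.Quotient.eq_zero_iff_mem] at hx
        have hp₀ : coeff 0 p = 0 := by
          have h₁ : ε (aeval a p) = 0 := Ideal.pow_le_self two_ne_zero hx
          rw [← AlgHom.comp_apply, comp_aeval, show (fun i => ε (a i)) = 0 from funext ha,
            aeval_zero] at h₁
          simpa [constantCoeff_eq] using h₁
        have hpT : p ∈ T := by
          have := sub_C_mem_idealOfVars p
          rwa [hp₀, C_0, sub_zero] at this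
        have h₁ := sub_linear_mem_idealOfVars_sq hpT
        have h₂ : F (Ideal.Quotient.mk _ (p - ∑ j, C (coeff (single j 1) p) * X j)) = 0 := by
          rw [Ideal.Quotient.eq_zero_iff_mem.2 h₁, map_zero]
        rw [hF, Ideal.Quotient.eq_zero_iff_mem, map_sub] at h₂
        have h₃ := Ideal.sub_mem _ hx h₂
        rw [sub_sub_cancel] at h₃
        have h₄ := hind (fun j => coeff (single j 1) p) (by
          simpa [algebraMap_eq] using h₃)
        rw [Ideal.Quotient.eq_zero_iff_mem]
        have h₅ : ∀ j, coeff (single j 1) p = 0 := fun j => congrFun h₄ j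
        simpa [h₅] using h₁
      · intro x
        obtain ⟨y, rfl⟩ := Ideal.Quotient.mk_surjective x
        obtain ⟨c, hc⟩ := hgen _ (hε y)
        refine ⟨Ideal.Quotient.mk _ (C (ε y) + ∑ i, C (c i) * X i), ?_⟩
        rw [hF, eq_comm, Ideal.Quotient.eq]
        simpa [sub_sub, algebraMap_eq] using hc
    let E := AlgEquiv.ofBijective F hFb
    -- The exponent `d + 2` is large enough for the quotient to map both to first order and to order
    -- `d`, including `d = 0`.
    have hTT : T ^ (d + 2) ≤ T ^ 2 := Ideal.pow_le_pow_right (by omega)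
    have hTT' : T ^ (d + 2) ≤ T ^ (d + 1) := Ideal.pow_le_pow_right (by omega)
    let π₂ : MvPolynomial (Fin n) R ⧸ T ^ (d + 2) →ₐ[R] MvPolynomial (Fin n) R ⧸ T ^ 2 :=
      Ideal.Quotient.factorₐ R hTT
    let π' : MvPolynomial (Fin n) R ⧸ T ^ (d + 2) →ₐ[R] MvPolynomial (Fin n) R ⧸ T ^ (d + 1) :=
      Ideal.Quotient.factorₐ R hTT'
    have hπ₂ : Function.Surjective π₂ := Ideal.Quotient.factor_surjective hTT
    have hπ₂k : IsNilpotent (RingHom.ker π₂) := by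
      refine ⟨d + 2, ?_⟩
      have h₁ : RingHom.ker π₂ ≤
          T.map (Ideal.Quotient.mk (T ^ (d + 2))) := by
        intro x hx
        obtain ⟨p, rfl⟩ := Ideal.Quotient.mk_surjective x
        have : Ideal.Quotient.mk (T ^ 2) p = 0 := hx
        exact Ideal.mem_map_of_mem _
          (Ideal.pow_le_self two_ne_zero (Ideal.Quotient.eq_zero_iff_mem.1 this))
      refine le_bot_iff.1 ((Ideal.pow_right_mono h₁ _).trans ?_)
      rw [← Ideal.map_pow, Ideal.map_quotient_self]
    -- Formal smoothness lifts the inverse of `F` through a nilpotent thickening. This provides a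
    -- map out of `B` that detects polynomial relations among the `a i`.
    let g : B →ₐ[R] MvPolynomial (Fin n) R ⧸ T ^ (d + 2) :=
      Algebra.FormallySmooth.liftOfSurjective
        (E.symm.toAlgHom.comp (Ideal.Quotient.mkₐ R (I ^ 2))) π₂ hπ₂ hπ₂k
    have hg : ∀ x, F (π₂ (g x)) = Ideal.Quotient.mk _ x := fun x => by
      rw [Algebra.FormallySmooth.liftOfSurjective_apply]
      exact E.apply_symm_apply _
    have hgp : ∀ (x : B) (p : MvPolynomial (Fin n) R),
        x - aeval a p ∈ I ^ 2 → g x - Ideal.Quotient.mk _ p ∈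
          (T ^ 2).map (Ideal.Quotient.mk (T ^ (d + 2))) := fun x p hp => by
      obtain ⟨r, hr⟩ := Ideal.Quotient.mk_surjective (g x)
      rw [← hr, ← map_sub]
      refine Ideal.mem_map_of_mem _ (Ideal.Quotient.eq.1 (hFb.1 ?_))
      have h₁ := hg x
      rw [← hr] at h₁
      exact h₁.trans (Ideal.Quotient.eq.2 hp)
    let g' := π'.comp g
    have hg'p : ∀ (x : B) (p : MvPolynomial (Fin n) R),
        x - aeval a p ∈ I ^ 2 → g' x - Ideal.Quotient.mk _ p ∈
          (T ^ 2).map (Ideal.Quotient.mk (T ^ (d + 1))) := fun x p hp => by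
      have := Ideal.mem_map_of_mem (Ideal.Quotient.factor hTT') (hgp x p hp)
      rw [Ideal.map_map, map_sub, Ideal.Quotient.factor_comp_mk] at this
      exact this
    have hmk : T.map (Ideal.Quotient.mk (T ^ (d + 1))) =
        Ideal.span (Set.range fun j : Fin n => Ideal.Quotient.mk (T ^ (d + 1)) (X j)) := by
      change Ideal.map _ (idealOfVars _ _) = _
      rw [idealOfVars, Ideal.map_span, ← Set.range_comp]
      rfl
    have hg'I : I ≤ (T.map (Ideal.Quotient.mk (T ^ (d + 1)))).comap g' := fun x hx => by
      obtain ⟨c, hc⟩ := hgen x hx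
      have h₁ := hg'p x (∑ i, C (c i) * X i) (by simpa [algebraMap_eq] using hc)
      have h₂ : Ideal.Quotient.mk (T ^ (d + 1)) (∑ i, C (c i) * X i) ∈
          T.map (Ideal.Quotient.mk (T ^ (d + 1))) := Ideal.mem_map_of_mem _
        (Ideal.sum_mem _ fun i _ => Ideal.mul_mem_left _ _ (Ideal.subset_span ⟨i, rfl⟩))
      simpa using Ideal.add_mem _ (Ideal.map_mono (Ideal.pow_le_self two_ne_zero) h₁) h₂
    -- The lift sends `a i` to `X i` up to second order, so the Jacobian is the identity matrix.
    have hB := (isTruncBasis_quotient n d R).of_isUnit_det (fun i => g' (a i)) 1 (by simp)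
      fun i => by
        have := hg'p (a i) (X i) (by simp)
        rw [Ideal.map_pow, hmk] at this
        convert this using 2
        simp only [Matrix.one_apply, Finset.sum_ite_eq, Finset.mem_univ, if_true, apply_ite, map_one,
          map_zero, ite_mul, one_mul, zero_mul]
        rfl
    rw [← hB.ker, RingHom.mem_ker]
    have h₁ : aeval a p ∈ I ^ (d + 1) := by
      rw [← hker, RingHom.mem_ker]
      rw [RingHom.mem_ker] at hp
      rw [← hp, aeval_def, ← coe_eval₂Hom]
      exact (map_eval₂Hom _ _ _ _)
    -- Since `g'` carries `I` into the ideal of the variables, it kills `I ^ (d + 1)`. Thus `p`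
    -- vanishes at the coordinates `g' (a i)`, which forces `p` into `T ^ (d + 1)`.
    have h₂ : g' (aeval a p) = 0 := by
      have h₃ := Ideal.mem_map_of_mem g'.toRingHom h₁
      rw [Ideal.map_pow] at h₃
      have h₄ := Ideal.pow_right_mono (Ideal.map_le_iff_le_comap.2 hg'I) (d + 1) h₃
      rw [← Ideal.map_pow, Ideal.map_quotient_self] at h₄
      exact h₄
    rw [← h₂, ← AlgHom.comp_apply, comp_aeval]
    rfl

end Trunc

/-! ### Evaluation of power series in truncated algebras; base change. -/

section PowerSeries

variable {n : ℕ} {R A : Type*} [CommRing R] [CommRing A]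

open Finsupp

/-- Evaluation of power series in a truncated polynomial algebra. -/
def IsTruncBasis.evalPS {φ : R →+* A} {s : Fin n → A} {d : ℕ} (h : IsTruncBasis φ s d) :
    MvPowerSeries (Fin n) R →+* A :=
  (Ideal.Quotient.lift (MvPolynomial.idealOfVars (Fin n) R ^ (d + 1)) (MvPolynomial.eval₂Hom φ s)
    fun _ hp => (h.ker.ge hp :)).comp (MvPowerSeries.truncTotalAlgHom (Fin n) R (d + 1)).toRingHom

theorem IsTruncBasis.evalPS_apply {φ : R →+* A} {s : Fin n → A} {d : ℕ} (h : IsTruncBasis φ s d)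
    (f : MvPowerSeries (Fin n) R) :
    h.evalPS f = MvPolynomial.eval₂Hom φ s (f.truncTotal (d + 1)) := rfl

theorem IsTruncBasis.evalPS_eq_zero_iff {φ : R →+* A} {s : Fin n → A} {d : ℕ}
    (h : IsTruncBasis φ s d) (f : MvPowerSeries (Fin n) R) :
    h.evalPS f = 0 ↔ ∀ α : Fin n →₀ ℕ, α.degree ≤ d → MvPowerSeries.coeff α f = 0 := by
  rw [h.evalPS_apply, ← RingHom.mem_ker, h.ker, MvPolynomial.mem_pow_idealOfVars_iff']
  refine forall_congr' fun α => ?_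
  rw [Nat.lt_succ_iff]
  refine imp_congr_right fun hα => ?_
  rw [MvPowerSeries.coeff_truncTotal _ (Nat.lt_succ_of_le hα)]

theorem IsTruncBasis.evalPS_coe {φ : R →+* A} {s : Fin n → A} {d : ℕ}
    (h : IsTruncBasis φ s d) (p : MvPolynomial (Fin n) R) :
    h.evalPS (p : MvPowerSeries (Fin n) R) = MvPolynomial.eval₂Hom φ s p := by
  rw [h.evalPS_apply, ← sub_eq_zero, ← map_sub, ← RingHom.mem_ker, h.ker,
    MvPolynomial.mem_pow_idealOfVars_iff']
  intro α hα
  rw [MvPolynomial.coeff_sub, MvPowerSeries.coeff_truncTotal _ hα, MvPolynomial.coeff_coe, sub_self]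

theorem IsTruncBasis.evalPS_surjective {φ : R →+* A} {s : Fin n → A} {d : ℕ}
    (h : IsTruncBasis φ s d) : Function.Surjective h.evalPS := fun x => by
  obtain ⟨p, rfl⟩ := h.surj x
  exact ⟨p, h.evalPS_coe p⟩

theorem IsTruncBasis.evalPS_C {φ : R →+* A} {s : Fin n → A} {d : ℕ}
    (h : IsTruncBasis φ s d) (r : R) : h.evalPS (MvPowerSeries.C r) = φ r := by
  rw [← MvPolynomial.coe_C, h.evalPS_coe]
  simp

theorem IsTruncBasis.evalPS_X {φ : R →+* A} {s : Fin n → A} {d : ℕ}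
    (h : IsTruncBasis φ s d) (j : Fin n) : h.evalPS (MvPowerSeries.X j) = s j := by
  rw [← MvPolynomial.coe_X, h.evalPS_coe]
  simp

theorem IsTruncBasis.map_evalPS {R' A' : Type*} [CommRing R'] [CommRing A'] {φ : R →+* A}
    {s : Fin n → A} {d : ℕ} (h : IsTruncBasis φ s d) {φ' : R' →+* A'} {s' : Fin n → A'}
    (h' : IsTruncBasis φ' s' d) (θ : R →+* R') (ψ : A →+* A') (w : ψ.comp φ = φ'.comp θ)
    (hs : ∀ j, ψ (s j) = s' j) (f : MvPowerSeries (Fin n) R) :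
    ψ (h.evalPS f) = h'.evalPS (MvPowerSeries.map θ f) := by
  have h₁ : (MvPowerSeries.map θ f).truncTotal (d + 1) =
      MvPolynomial.map θ (f.truncTotal (d + 1)) := MvPowerSeries.truncFinset_map ..
  rw [h.evalPS_apply, h'.evalPS_apply, h₁, MvPolynomial.map_eval₂Hom, w]
  simp only [MvPolynomial.coe_eval₂Hom, MvPolynomial.eval₂_map, hs]

/-- Evaluations at different orders are compatible with truncation, so they assemble into a map to
the inverse limit. -/
theorem IsTruncBasis.evalPS_of_le {A' : Type*} [CommRing A'] {φ : R →+* A} {s : Fin n → A} {d : ℕ}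
    (h : IsTruncBasis φ s d) {φ' : R →+* A'} {s' : Fin n → A'} {d' : ℕ} (hd : d ≤ d')
    (h' : IsTruncBasis φ' s' d') (ψ : A' →+* A) (w : ψ.comp φ' = φ)
    (hs : ∀ j, ψ (s' j) = s j) (f : MvPowerSeries (Fin n) R) :
    ψ (h'.evalPS f) = h.evalPS f := by
  have h₁ := MvPowerSeries.truncTotal_sub_truncTotal_mem_pow_idealOfVars
    (show d + 1 ≤ d' + 1 by omega) le_rfl f
  rw [← h.ker, RingHom.mem_ker, map_sub, sub_eq_zero] at h₁
  rw [h.evalPS_apply, h'.evalPS_apply, ← h₁, MvPolynomial.map_eval₂Hom, w]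
  simp only [MvPolynomial.coe_eval₂Hom, hs]

/-- The power series with given coefficients. -/
def psMk (c : (Fin n →₀ ℕ) → R) : MvPowerSeries (Fin n) R := c

@[simp]
theorem coeff_psMk (c : (Fin n →₀ ℕ) → R) (α : Fin n →₀ ℕ) :
    MvPowerSeries.coeff α (psMk c) = c α := rfl

/-- The ideal of power series without constant term. -/
def idealX (n : ℕ) (R : Type*) [CommRing R] : Ideal (MvPowerSeries (Fin n) R) :=
  Ideal.span (Set.range fun j : Fin n => (MvPowerSeries.X j : MvPowerSeries (Fin n) R))

/-- One direction passes to the truncated polynomial ring. The other needs an explicit division,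
because a power series is an infinite sum of monomials: every nonzero exponent is assigned to one
variable that divides it, and `f` splits into finitely many multiples of variables. -/
theorem mem_idealX_pow_iff (d : ℕ) (f : MvPowerSeries (Fin n) R) :
    f ∈ idealX n R ^ (d + 1) ↔ ∀ α : Fin n →₀ ℕ, α.degree ≤ d → MvPowerSeries.coeff α f = 0 := by
  classical
  constructor
  · intro hf
    rw [← (isTruncBasis_quotient n d R).evalPS_eq_zero_iff]
    have h₁ := Ideal.mem_map_of_mem (isTruncBasis_quotient n d R).evalPS hf
    rw [Ideal.map_pow, idealX, Ideal.map_span, ← Set.range_comp] at h₁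
    have h₂ : ((isTruncBasis_quotient n d R).evalPS ∘ fun j => MvPowerSeries.X j) =
      fun j => Ideal.Quotient.mk _ (MvPolynomial.X j) :=
        funext fun j => (isTruncBasis_quotient n d R).evalPS_X j
    rw [h₂, (isTruncBasis_quotient n d R).span_pow_eq_bot] at h₁
    exact h₁
  -- `Option` supplies a value at `α = 0`, where no variable divides the monomial and `Fin n` may be
  -- empty.
  · have hex : ∀ α : Fin n →₀ ℕ, ∃ o : Option (Fin n), α ≠ 0 → ∃ i, o = Option.some i ∧ α i ≠ 0 := by
      intro α
      by_cases h : α = 0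
      · exact ⟨none, fun h' => (h' h).elim⟩
      · obtain ⟨i, hi⟩ := Finsupp.ne_iff.1 h
        exact ⟨Option.some i, fun _ => ⟨i, rfl, hi⟩⟩
    choose ι hι using hex
    have key : ∀ f : MvPowerSeries (Fin n) R, MvPowerSeries.coeff 0 f = 0 →
        f = ∑ i, MvPowerSeries.X i * psMk (fun β =>
          if ι (β + single i 1) = Option.some i then MvPowerSeries.coeff (β + single i 1) f else 0) := by
      intro f hf
      ext γ
      rw [map_sum]
      simp only [MvPowerSeries.X, MvPowerSeries.coeff_monomial_mul, one_mul, coeff_psMk]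
      by_cases hγ : γ = 0
      · subst hγ
        rw [hf, Finset.sum_eq_zero]
        intro i _
        rw [if_neg]
        simp
      · obtain ⟨k, hk, hk'⟩ := hι γ hγ
        have h₁ : single k 1 ≤ γ := Finsupp.single_le_iff.2 (Nat.one_le_iff_ne_zero.2 hk')
        rw [Finset.sum_eq_single k]
        · rw [if_pos h₁]
          rw [tsub_add_cancel_of_le h₁, if_pos hk]
        · intro i _ hi
          split_ifs with h h'
          · rw [tsub_add_cancel_of_le h, hk] at h'
            exact (hi (Option.some.inj h').symm).elim
          · rfl
          · rfl
        · simp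
    induction d generalizing f with
    | zero =>
      intro hf
      rw [zero_add, pow_one, key f (hf 0 (by simp))]
      exact Ideal.sum_mem _ fun i _ => Ideal.mul_mem_right _ _ (Ideal.subset_span ⟨i, rfl⟩)
    | succ d ih =>
      intro hf
      rw [key f (hf 0 (by simp)), pow_succ']
      refine Ideal.sum_mem _ fun i _ =>
        Ideal.mul_mem_mul (Ideal.subset_span ⟨i, rfl⟩) (ih _ fun α hα => ?_)
      rw [coeff_psMk, hf _ (by rw [map_add, degree_single]; omega), ite_self]

theorem mem_idealX_iff (f : MvPowerSeries (Fin n) R) :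
    f ∈ idealX n R ↔ MvPowerSeries.coeff 0 f = 0 := by
  rw [← pow_one (idealX n R), mem_idealX_pow_iff 0]
  simp [degree_eq_zero_iff]

theorem sub_coe_truncTotal_mem (d : ℕ) (f : MvPowerSeries (Fin n) R) :
    f - (f.truncTotal (d + 1) : MvPolynomial (Fin n) R) ∈ idealX n R ^ (d + 1) := by
  rw [mem_idealX_pow_iff]
  intro α hα
  rw [map_sub, MvPolynomial.coeff_coe, MvPowerSeries.coeff_truncTotal _ (Nat.lt_succ_of_le hα),
    sub_self]

/-- Endomorphisms of a power series algebra that fix the variables are trivial. -/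
theorem algHom_apply_eq_self (ψ : MvPowerSeries (Fin n) R →ₐ[R] MvPowerSeries (Fin n) R)
    (hψ : ∀ j, ψ (MvPowerSeries.X j) = MvPowerSeries.X j) (f : MvPowerSeries (Fin n) R) :
    ψ f = f := by
  have h₁ : ψ.comp (MvPolynomial.coeToMvPowerSeries.algHom R) =
      MvPolynomial.coeToMvPowerSeries.algHom R := MvPolynomial.algHom_ext fun j => by
    simpa using hψ j
  have h₂ : (idealX n R).map ψ.toRingHom ≤ idealX n R := by
    rw [Ideal.map_le_iff_le_comap, idealX, Ideal.span_le]
    rintro _ ⟨j, rfl⟩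
    have : ψ (MvPowerSeries.X j) ∈ idealX n R := by
      rw [hψ]
      exact Ideal.subset_span ⟨j, rfl⟩
    exact this
  ext α
  have h₃ := sub_coe_truncTotal_mem α.degree f
  have h₄ := Ideal.mem_map_of_mem ψ.toRingHom h₃
  rw [Ideal.map_pow] at h₄
  have h₅ := (mem_idealX_pow_iff _ _).1 (Ideal.pow_right_mono h₂ _ h₄) α le_rfl
  have h₆ := (mem_idealX_pow_iff _ _).1 h₃ α le_rfl
  have h₇ : ψ (f.truncTotal (α.degree + 1) : MvPolynomial (Fin n) R) =
    (f.truncTotal (α.degree + 1) : MvPolynomial (Fin n) R) := by simpa using congr($h₁ _)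
  rw [map_sub, sub_eq_zero] at h₆
  rw [AlgHom.toRingHom_eq_coe, RingHom.coe_coe, map_sub, map_sub, sub_eq_zero, h₇] at h₅
  rw [h₅, h₆]

/-- Truncated polynomial algebras are stable under base change. -/
theorem IsTruncBasis.baseChange {R' A' : Type*} [CommRing R'] [CommRing A'] [Algebra R A]
    [Algebra R R'] [Algebra A A'] [Algebra R' A'] [Algebra R A'] [IsScalarTower R A A']
    [IsScalarTower R R' A'] [Algebra.IsPushout R R' A A'] {s : Fin n → A} {d : ℕ}
    (h : IsTruncBasis (algebraMap R A) s d) :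
    IsTruncBasis (algebraMap R' A') (fun j => algebraMap A A' (s j)) d := by
  rw [isTruncBasis_iff] at h ⊢
  refine ⟨fun α hα => by rw [← map_mono, h.1 α hα, map_zero], ?_⟩
  let e : (degLE n d → R) ≃ₗ[R] A := LinearEquiv.ofBijective
    { toFun := fun c => ∑ α, algebraMap R A (c α) * mono s α.1
      map_add' := fun c c' => by simp [add_mul, Finset.sum_add_distrib]
      map_smul' := fun r c => by simp [Finset.mul_sum, Algebra.smul_def, mul_assoc] } h.2
  -- A truncated polynomial algebra is free on its monomials of degree at most `d`, and bases are
  -- preserved by base change.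
  let b : Module.Basis (degLE n d) R A := Module.Basis.ofEquivFun e.symm
  have hb : ∀ α, b α = mono s α.1 := fun α => by
    classical
    have : b α = e (Pi.single α 1) := by simp [b]
    rw [this]
    simp [e, Pi.single_apply]
  let b' := IsBaseChange.basis b (Algebra.IsPushout.out (R := R) (S := R') (R' := A) (S' := A'))
  have hb' : ∀ α, b' α = mono (fun j => algebraMap A A' (s j)) α.1 := fun α => by
    rw [IsBaseChange.basis_apply, hb, ← map_mono]
    rfl
  convert b'.equivFun.symm.bijective using 2 with c
  rw [b'.equivFun_symm_apply]
  exact Finset.sum_congr rfl fun α _ => by rw [hb', Algebra.smul_def]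

end PowerSeries

/-! ### Sections of the structure sheaf -/

section Functions

variable {X Y Z : Scheme.{u}}

theorem resO_resO (Y : Scheme.{u}) {U V W : Y.Opens} (e : V ≤ U) (e' : W ≤ V) (a : Γ(Y, U)) :
    resO Y e' (resO Y e a) = resO Y (e'.trans e) a := by
  rw [← CommRingCat.comp_apply, ← Functor.map_comp]
  rfl

@[simp]
theorem resO_self (Y : Scheme.{u}) {U : Y.Opens} (e : U ≤ U) (a : Γ(Y, U)) : resO Y e a = a := by
  change (Y.presheaf.map (𝟙 (op U))) a = a
  rw [CategoryTheory.Functor.map_id]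
  rfl

theorem appLE_appLE (f : X ⟶ Y) (g : Y ⟶ Z) (U : Z.Opens) (V : Y.Opens) (W : X.Opens)
    (e₁ : V ≤ g ⁻¹ᵁ U) (e₂ : W ≤ f ⁻¹ᵁ V) (a : Γ(Z, U)) :
    f.appLE V W e₂ (g.appLE U V e₁ a) =
      (f ≫ g).appLE U W (e₂.trans (f.preimage_mono e₁)) a := by
  rw [← CommRingCat.comp_apply, Scheme.Hom.appLE_comp_appLE]

theorem resO_appLE (f : X ⟶ Y) {U : Y.Opens} {V W : X.Opens} (e : V ≤ f ⁻¹ᵁ U) (e' : W ≤ V)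
    (a : Γ(Y, U)) : resO X e' (f.appLE U V e a) = f.appLE U W (e'.trans e) a := by
  rw [← CommRingCat.comp_apply, Scheme.Hom.appLE_map]

theorem appLE_resO (f : X ⟶ Y) {U V : Y.Opens} {W : X.Opens} (e : V ≤ U) (e' : W ≤ f ⁻¹ᵁ V)
    (a : Γ(Y, U)) : f.appLE V W e' (resO Y e a) =
      f.appLE U W (e'.trans (f.preimage_mono e)) a := by
  rw [← CommRingCat.comp_apply, Scheme.Hom.map_appLE]

theorem app_eq_appLE (f : X ⟶ Y) (U : Y.Opens) (a : Γ(Y, U)) :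
    f.app U a = f.appLE U (f ⁻¹ᵁ U) le_rfl a := by
  rw [Scheme.Hom.app_eq_appLE]

theorem id_appLE {U V : X.Opens} (e : V ≤ (𝟙 X) ⁻¹ᵁ U) (a : Γ(X, U)) :
    (𝟙 X : X ⟶ X).appLE U V e a = resO X e a := by
  have h : (𝟙 X : X ⟶ X).appLE U V e = X.presheaf.map (homOfLE e).op := by
    simp [Scheme.Hom.appLE]
    rfl
  exact congr($h a)

theorem appLE_congr {f g : X ⟶ Y} (h : f = g) {U : Y.Opens} {V : X.Opens} (e : V ≤ f ⁻¹ᵁ U)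
    (a : Γ(Y, U)) : f.appLE U V e a = g.appLE U V (h ▸ e) a := by
  subst h
  rfl

theorem ext_of_resO {V : Y.Opens} {a b : Γ(Y, V)}
    (h : ∀ x ∈ V, ∃ (W : Y.Opens) (e : W ≤ V), x ∈ W ∧ resO Y e a = resO Y e b) : a = b :=
  Y.IsSheaf.section_ext (U := op V) h

theorem exists_glue {ι : Type*} (U : ι → Y.Opens) (V : Y.Opens) (hU : ∀ i, U i ≤ V)
    (hV : ∀ x ∈ V, ∃ i, x ∈ U i) (s : ∀ i, Γ(Y, U i))
    (hs : ∀ i j (W : Y.Opens) (e : W ≤ U i) (e' : W ≤ U j), resO Y e (s i) = resO Y e' (s j)) :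
    ∃ t : Γ(Y, V), ∀ i, resO Y (hU i) t = s i :=
  (Y.sheaf.existsUnique_gluing' U V (fun i => homOfLE (hU i))
    (fun x hx => by simpa using hV x hx) s fun i j => hs i j _ _ _).exists

end Functions

/-! ### Towers -/

theorem Tower.proj_res {Y : Scheme.{u}} (T : Tower Y) {V W : Y.Opens} (e : W ≤ V)
    (s : T.Sections V) (d : ℕ) :
    T.proj W d (T.res e s) = resO (T.obj d) ((T.hom d).preimage_mono e) (T.proj V d s) :=
  id_appLE _ _

namespace TowerHom

variable {Y Y' Y'' : Scheme.{u}} {h : Y' ⟶ Y} {h' : Y'' ⟶ Y'} {T : Tower Y} {T' : Tower Y'}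
  {T'' : Tower Y''}

theorem proj_pull (m : TowerHom h T' T) (V : Y.Opens) (V' : Y'.Opens) (e : V' ≤ h ⁻¹ᵁ V)
    (s : T.Sections V) (d : ℕ) :
    T'.proj V' d (m.pull V V' e s) = (m.map d).appLE _ _ (m.preimage_le e d) (T.proj V d s) := rfl

/-- Composition of morphisms of towers. -/
def comp (m' : TowerHom h' T'' T') (m : TowerHom h T' T) : TowerHom (h' ≫ h) T'' T where
  map d := m'.map d ≫ m.map d
  map_hom d := by rw [Category.assoc, m.map_hom, ← Category.assoc, m'.map_hom, Category.assoc]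
  trans_map d := by rw [← Category.assoc, m'.trans_map, Category.assoc, m.trans_map, Category.assoc]

theorem pull_pull (m' : TowerHom h' T'' T') (m : TowerHom h T' T) (V : Y.Opens) (V' : Y'.Opens)
    (V'' : Y''.Opens) (e : V' ≤ h ⁻¹ᵁ V) (e' : V'' ≤ h' ⁻¹ᵁ V') (s : T.Sections V) :
    m'.pull V' V'' e' (m.pull V V' e s) =
      (m'.comp m).pull V V'' (e'.trans (h'.preimage_mono e)) s := by
  ext d
  simp only [proj_pull, appLE_appLE]
  rfl

theorem pull_congr {h₁ h₂ : Y' ⟶ Y} (m₁ : TowerHom h₁ T' T) (m₂ : TowerHom h₂ T' T)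
    (w : ∀ d, m₁.map d = m₂.map d) (V : Y.Opens) (V' : Y'.Opens) (e₁ : V' ≤ h₁ ⁻¹ᵁ V)
    (e₂ : V' ≤ h₂ ⁻¹ᵁ V) (s : T.Sections V) : m₁.pull V V' e₁ s = m₂.pull V V' e₂ s := by
  ext d
  simp only [proj_pull]
  exact appLE_congr (w d) _ _

theorem res_pull (m : TowerHom h T' T) (V : Y.Opens) (V' W' : Y'.Opens) (e : V' ≤ h ⁻¹ᵁ V)
    (e' : W' ≤ V') (s : T.Sections V) :
    T'.res e' (m.pull V V' e s) = m.pull V W' (e'.trans e) s := by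
  ext d
  rw [Tower.proj_res, proj_pull, proj_pull, resO_appLE]

theorem pull_res (m : TowerHom h T' T) (V W : Y.Opens) (V' : Y'.Opens) (e : W ≤ V)
    (e' : V' ≤ h ⁻¹ᵁ W) (s : T.Sections V) :
    m.pull W V' e' (T.res e s) = m.pull V V' (e'.trans (h.preimage_mono e)) s := by
  ext d
  rw [proj_pull, proj_pull, Tower.proj_res, appLE_resO]

theorem pull_algebraMap (m : TowerHom h T' T) (V : Y.Opens) (V' : Y'.Opens) (e : V' ≤ h ⁻¹ᵁ V)
    (r : Γ(Y, V)) : m.pull V V' e (algebraMap _ _ r) = algebraMap _ _ (h.appLE V V' e r) := by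
  ext d
  rw [proj_pull]
  change (m.map d).appLE _ _ _ ((T.hom d).app V r) = (T'.hom d).app V' (h.appLE V V' e r)
  rw [app_eq_appLE, app_eq_appLE, appLE_appLE, appLE_appLE]
  exact appLE_congr (m.map_hom d) _ _

theorem pull_smul (m : TowerHom h T' T) (V : Y.Opens) (V' : Y'.Opens) (e : V' ≤ h ⁻¹ᵁ V)
    (r : Γ(Y, V)) (s : T.Sections V) :
    m.pull V V' e (r • s) = h.appLE V V' e r • m.pull V V' e s := by
  rw [Algebra.smul_def, map_mul, pull_algebraMap, Algebra.smul_def]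

theorem proj_pull_eq_zero (m : TowerHom h T' T) (V : Y.Opens) (V' : Y'.Opens) (e : V' ≤ h ⁻¹ᵁ V)
    (s : T.Sections V) (d : ℕ) (hs : T.proj V d s = 0) : T'.proj V' d (m.pull V V' e s) = 0 := by
  rw [proj_pull, hs, map_zero]

/-- A morphism of towers that exhibits the source as a base change of the target. -/
def IsCartesian (m : TowerHom h T' T) : Prop :=
  ∀ d, IsPullback (m.map d) (T'.hom d) (T.hom d) h

end TowerHom

namespace Tower

variable {Y : Scheme.{u}} (T : Tower Y)

@[simp]
theorem res_self {V : Y.Opens} (e : V ≤ V) (s : T.Sections V) : T.res e s = s := by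
  ext d
  rw [proj_res, resO_self]

theorem res_res {U V W : Y.Opens} (e : V ≤ U) (e' : W ≤ V) (s : T.Sections U) :
    T.res e' (T.res e s) = T.res (e'.trans e) s := by
  ext d
  simp only [proj_res, resO_resO]

theorem res_smul {V W : Y.Opens} (e : W ≤ V) (r : Γ(Y, V)) (s : T.Sections V) :
    T.res e (r • s) = resO Y e r • T.res e s := by
  exact (T.idHom.pull_smul V W e r s).trans (congrArg (· • T.res e s) (id_appLE e r))

theorem trans_proj (V : Y.Opens) (s : T.Sections V) (d : ℕ) :
    (T.trans d).appLE _ _ (T.preimage_le d V) (T.proj V (d + 1) s) = T.proj V d s := s.2 d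

theorem ext_of_res {V : Y.Opens} {s t : T.Sections V}
    (h : ∀ x ∈ V, ∃ (W : Y.Opens) (e : W ≤ V), x ∈ W ∧ T.res e s = T.res e t) : s = t := by
  ext d
  refine ext_of_resO fun z hz => ?_
  obtain ⟨W, e, hW, hst⟩ := h _ hz
  exact ⟨_, (T.hom d).preimage_mono e, hW, by rw [← T.proj_res e, ← T.proj_res e, hst]⟩

/-- The inverse limit of sheaves is glued level by level; compatibility of the levels is local, and
there it is inherited from the given sections. -/
theorem exists_glue {ι : Type*} (U : ι → Y.Opens) (V : Y.Opens) (hU : ∀ i, U i ≤ V)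
    (hV : ∀ x ∈ V, ∃ i, x ∈ U i) (s : ∀ i, T.Sections (U i))
    (hs : ∀ i j (W : Y.Opens) (e : W ≤ U i) (e' : W ≤ U j), T.res e (s i) = T.res e' (s j)) :
    ∃ t : T.Sections V, ∀ i, T.res (hU i) t = s i := by
  have h₁ : ∀ d, ∃ t : Γ(T.obj d, T.hom d ⁻¹ᵁ V), ∀ i,
      resO (T.obj d) ((T.hom d).preimage_mono (hU i)) t = T.proj (U i) d (s i) := by
    intro d
    refine FormalGeometry.exists_glue (fun i => T.hom d ⁻¹ᵁ U i) _ _ (fun z hz => hV _ hz) _ ?_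
    intro i j W e e'
    have h₂ := congr(T.proj _ d $(hs i j (U i ⊓ U j) inf_le_left inf_le_right))
    rw [proj_res, proj_res] at h₂
    have h₃ : W ≤ T.hom d ⁻¹ᵁ (U i ⊓ U j) := le_inf e e'
    have h₄ := congr(resO (T.obj d) h₃ $h₂)
    rwa [resO_resO, resO_resO] at h₄
  choose t ht using h₁
  refine ⟨⟨t, fun d => ?_⟩, fun i => Sections.ext fun d => ?_⟩
  · refine ext_of_resO fun z hz => ?_
    obtain ⟨i, hi⟩ := hV _ hz
    refine ⟨T.hom d ⁻¹ᵁ U i, (T.hom d).preimage_mono (hU i), hi, ?_⟩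
    rw [ht, ← trans_proj, ← ht, resO_appLE, appLE_resO]
  · exact (T.proj_res (hU i) _ d).trans (ht d i)

end Tower

/-! ### Coordinates of a tower -/

section Local

variable {Z Y : Scheme.{u}} {n : ℕ}

/-- Being a truncated polynomial algebra can be checked on a basis of open sets. -/
theorem isTruncBasis_of_local (f : Z ⟶ Y) {V : Y.Opens} (s : Fin n → Γ(Z, f ⁻¹ᵁ V)) (d : ℕ)
    (h : ∀ y ∈ V, ∀ W ≤ V, y ∈ W → ∃ (B : Y.Opens) (e : B ≤ V), B ≤ W ∧ y ∈ B ∧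
      IsTruncBasis (f.app B).hom (fun j => resO Z (f.preimage_mono e) (s j)) d) :
    IsTruncBasis (f.app V).hom s d := by
  rw [isTruncBasis_iff]
  let Φ (W : Y.Opens) (e : W ≤ V) (c : degLE n d → Γ(Y, W)) : Γ(Z, f ⁻¹ᵁ W) :=
    ∑ α, (f.app W).hom (c α) * mono (fun j => resO Z (f.preimage_mono e) (s j)) α.1
  have Φ_res : ∀ (W : Y.Opens) (e : W ≤ V) (B : Y.Opens) (e' : B ≤ W) (c : degLE n d → Γ(Y, W)),
      resO Z (f.preimage_mono e') (Φ W e c) = Φ B (e'.trans e) fun α => resO Y e' (c α) := by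
    intro W e B e' c
    simp only [Φ, map_sum, map_mul, map_mono]
    refine Finset.sum_congr rfl fun α _ => ?_
    congr 1
    · change resO Z _ (f.app W (c α)) = f.app B _
      rw [app_eq_appLE, app_eq_appLE, resO_appLE, appLE_resO]
    · congr 1
      funext j
      exact resO_resO _ _ _ _
  -- Injectivity is needed over every `W`, not only over `V`: on overlaps it forces the local
  -- coefficients to agree, so that they glue.
  have inj : ∀ (W : Y.Opens) (e : W ≤ V), Function.Injective (Φ W e) := by
    intro W e c c' hc
    funext α
    refine ext_of_resO fun x hx => ?_
    obtain ⟨B, e', hB, hxB, H⟩ := h x (e hx) W e hx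
    refine ⟨B, hB, hxB, ?_⟩
    have h₁ := congr(resO Z (f.preimage_mono hB) $hc)
    rw [Φ_res W e, Φ_res W e] at h₁
    exact congrFun ((isTruncBasis_iff.mp H).2.1 h₁) α
  refine ⟨fun α hα => ?_, ?_⟩
  · refine ext_of_resO fun z hz => ?_
    obtain ⟨B, e', hB, hxB, H⟩ := h _ hz V le_rfl hz
    refine ⟨_, f.preimage_mono e', hxB, ?_⟩
    rw [map_mono, map_zero]
    exact H.mono_eq_zero hα
  · have hΦ : Φ V le_rfl = fun c : degLE n d → Γ(Y, V) =>
        ∑ α, (f.app V).hom (c α) * mono s α.1 := by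
      funext c
      simp only [Φ]
      refine Finset.sum_congr rfl fun α _ => ?_
      congr 2
      funext j
      exact resO_self _ _ _
    rw [← hΦ]
    refine ⟨inj V le_rfl, fun x => ?_⟩
    have H₁ : ∀ y : V, ∃ (B : Y.Opens) (e : B ≤ V) (c : degLE n d → Γ(Y, B)), y.1 ∈ B ∧
        Φ B e c = resO Z (f.preimage_mono e) x := by
      intro y
      obtain ⟨B, e, -, hy, H⟩ := h y.1 y.2 V le_rfl y.2
      obtain ⟨c, hc⟩ := (isTruncBasis_iff.mp H).2.2 (resO Z (f.preimage_mono e) x)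
      exact ⟨B, e, c, hy, hc⟩
    choose B e c hy hc using H₁
    have H₂ : ∀ α, ∃ t : Γ(Y, V), ∀ y, resO Y (e y) t = c y α := by
      intro α
      refine exists_glue B V e (fun y hyV => ⟨⟨y, hyV⟩, hy ⟨y, hyV⟩⟩) (fun y => c y α) ?_
      intro y y' W e₁ e₂
      have : (fun α => resO Y e₁ (c y α)) = fun α => resO Y e₂ (c y' α) := by
        apply inj W (e₁.trans (e y))
        rw [← Φ_res (B y) (e y) W e₁, ← Φ_res (B y') (e y') W e₂, hc, hc, resO_resO, resO_resO]
      exact congrFun this α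
    choose t ht using H₂
    refine ⟨t, ext_of_resO fun z hz => ⟨_, f.preimage_mono (e ⟨_, hz⟩), hy ⟨_, hz⟩, ?_⟩⟩
    rw [Φ_res V le_rfl _ (e ⟨_, hz⟩), ← hc]
    exact congrArg (Φ _ (e ⟨_, hz⟩)) (funext fun α => ht α _)

theorem IsTruncBasis.of_isPushout {R R' A A' : CommRingCat.{u}} {f : R ⟶ A} {g : R ⟶ R'}
    {g' : A ⟶ A'} {f' : R' ⟶ A'} (w : IsPushout f g g' f') {s : Fin n → A} {d : ℕ}
    (h : IsTruncBasis f.hom s d) : IsTruncBasis f'.hom (fun j => g' (s j)) d := by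
  algebraize [f.hom, g.hom, g'.hom, f'.hom, g'.hom.comp f.hom]
  have : IsScalarTower R R' A' := .of_algebraMap_eq' (congr(($(w.w)).hom))
  have : Algebra.IsPushout R R' A A' := CommRingCat.isPushout_iff_isPushout.mp w.flip
  exact IsTruncBasis.baseChange (R := R) (R' := R') (A := A) (A' := A') h

end Local

/-- The sections `s` of `lim 𝒜` over `V` are formal coordinates: they identify `𝒜_d` with
`𝒪[t]/(t)^(d+1)` over `V`, for every `d`. -/
def IsCoord {Y : Scheme.{u}} (T : Tower Y) {n : ℕ} (V : Y.Opens) (s : Fin n → T.Sections V) : Prop :=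
  ∀ (d : ℕ) (W : Y.Opens) (e : W ≤ V),
    IsTruncBasis ((T.hom d).app W).hom (fun j => T.proj W d (T.res e (s j))) d

namespace IsCoord

variable {Y Y' : Scheme.{u}} {T : Tower Y} {T' : Tower Y'} {n : ℕ} {V : Y.Opens}
  {s : Fin n → T.Sections V}

theorem res (hs : IsCoord T V s) {W : Y.Opens} (e : W ≤ V) :
    IsCoord T W (fun j => T.res e (s j)) := by
  intro d B e'
  simp only [Tower.res_res]
  exact hs d B (e'.trans e)

theorem isTruncBasis (hs : IsCoord T V s) (d : ℕ) :
    IsTruncBasis ((T.hom d).app V).hom (fun j => T.proj V d (s j)) d := by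
  simpa using hs d V le_rfl

/-- The order `d` is fixed before the neighbourhood is chosen, so the basis of open sets may depend
on `d`. -/
theorem of_basis (h : ∀ d, ∀ y ∈ V, ∀ W ≤ V, y ∈ W → ∃ (B : Y.Opens) (e : B ≤ V), B ≤ W ∧ y ∈ B ∧
    IsTruncBasis ((T.hom d).app B).hom (fun j => T.proj B d (T.res e (s j))) d) :
    IsCoord T V s := by
  intro d W e
  refine isTruncBasis_of_local _ _ _ fun y hy W' hW' hyW' => ?_
  obtain ⟨B, e', hB, hyB, H⟩ := h d y (e hy) W' (hW'.trans e) hyW'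
  refine ⟨B, hB.trans hW', hB, hyB, ?_⟩
  have key : ∀ j, resO (T.obj d) ((T.hom d).preimage_mono (hB.trans hW'))
      (T.proj W d (T.res e (s j))) = T.proj B d (T.res e' (s j)) := fun j => by
    rw [← T.proj_res (hB.trans hW'), Tower.res_res]
  simpa only [key] using H

theorem of_cover (h : ∀ y ∈ V, ∃ (W : Y.Opens) (e : W ≤ V), y ∈ W ∧
    IsCoord T W (fun j => T.res e (s j))) : IsCoord T V s := by
  refine of_basis fun d y hy W hW hyW => ?_
  obtain ⟨B, e, hyB, H⟩ := h y hy
  refine ⟨B ⊓ W, inf_le_left.trans e, inf_le_right, ⟨hyB, hyW⟩, ?_⟩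
  simpa only [Tower.res_res] using H d (B ⊓ W) inf_le_left

end IsCoord

theorem exists_affine_le {Y : Scheme.{u}} {y : Y} {W : Y.Opens} (hy : y ∈ W) :
    ∃ U : Y.Opens, IsAffineOpen U ∧ y ∈ U ∧ U ≤ W := by
  obtain ⟨_, ⟨U, hU, rfl⟩, hyU, hUW⟩ := Y.isBasis_affineOpens.exists_subset_of_mem_open hy W.2
  exact ⟨U, hU, hyU, hUW⟩

/-! ### Base change of formal coordinates. -/

section BaseChange

variable {Y Y' : Scheme.{u}} {h : Y' ⟶ Y} {T : Tower Y} {T' : Tower Y'} {n : ℕ}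

/-- Over affine open sets the cartesian square becomes a pushout of rings, and a truncated basis is
stable under pushout. -/
theorem TowerHom.IsCartesian.isTruncBasis {m : TowerHom h T' T} (hm : m.IsCartesian)
    {d : ℕ} [IsAffineHom (T.hom d)] {U : Y.Opens} (hU : IsAffineOpen U) {U' : Y'.Opens}
    (hU' : IsAffineOpen U') (e : U' ≤ h ⁻¹ᵁ U) {s : Fin n → Γ(T.obj d, T.hom d ⁻¹ᵁ U)}
    (hs : IsTruncBasis ((T.hom d).app U).hom s d) :
    IsTruncBasis ((T'.hom d).app U').hom
      (fun j => (m.map d).appLE _ _ (m.preimage_le e d) (s j)) d := by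
  have hUX : IsAffineOpen (T.hom d ⁻¹ᵁ U) := hU.preimage _
  have hUY : T'.hom d ⁻¹ᵁ U' = m.map d ⁻¹ᵁ (T.hom d ⁻¹ᵁ U) ⊓ T'.hom d ⁻¹ᵁ U' :=
    (inf_eq_right.mpr (m.preimage_le e d)).symm
  have h₁ := isIso_pushoutSection_of_isAffineOpen (hm d) e le_rfl hUY hU hU' hUX
  rw [isIso_pushoutSection_iff] at h₁
  rw [Scheme.Hom.app_eq_appLE] at hs ⊢
  exact hs.of_isPushout h₁

/-- Formal coordinates are stable under base change. -/
theorem IsCoord.pull {m : TowerHom h T' T} (hm : m.IsCartesian) [∀ d, IsAffineHom (T.hom d)]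
    {V : Y.Opens} {s : Fin n → T.Sections V} (hs : IsCoord T V s) {V' : Y'.Opens}
    (e : V' ≤ h ⁻¹ᵁ V) : IsCoord T' V' (fun j => m.pull V V' e (s j)) := by
  refine of_basis fun d y hy W hW hyW => ?_
  obtain ⟨U, hU, hyU, hUV⟩ := exists_affine_le (show h y ∈ V from e hy)
  obtain ⟨B, hB, hyB, hBW⟩ := exists_affine_le (show y ∈ W ⊓ h ⁻¹ᵁ U from ⟨hyW, hyU⟩)
  refine ⟨B, (hBW.trans inf_le_left).trans hW, hBW.trans inf_le_left, hyB, ?_⟩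
  have hBU : B ≤ h ⁻¹ᵁ U := hBW.trans inf_le_right
  have := hm.isTruncBasis hU hB hBU (hs d U hUV)
  have key : ∀ j, (m.map d).appLE _ _ (m.preimage_le hBU d)
      (T.proj U d (T.res hUV (s j))) =
        T'.proj B d (T'.res ((hBW.trans inf_le_left).trans hW) (m.pull V V' e (s j))) := fun j => by
    rw [← m.proj_pull U B hBU, TowerHom.pull_res, TowerHom.res_pull]
  simpa only [key] using this

theorem Tower.idHom_isCartesian (T : Tower Y) : T.idHom.IsCartesian := fun d =>
  IsPullback.id_horiz (T.hom d)

theorem Tower.pullbackSnd_isCartesian (T : Tower Y) (g : Y' ⟶ Y) : (T.pullbackSnd g).IsCartesian :=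
  fun d => (IsPullback.of_hasPullback g (T.hom d)).flip

theorem Tower.pullbackMap_fst (T : Tower Y) {Z' Z : Scheme.{u}} {g' : Z' ⟶ Y} {g : Z ⟶ Y}
    (h : Z' ⟶ Z) (w : h ≫ g = g') (d : ℕ) : T.pullbackMap h w d ≫ pullback.fst g (T.hom d) =
      pullback.fst g' (T.hom d) ≫ h := pullback.lift_fst _ _ _

theorem Tower.pullbackMap_snd (T : Tower Y) {Z' Z : Scheme.{u}} {g' : Z' ⟶ Y} {g : Z ⟶ Y}
    (h : Z' ⟶ Z) (w : h ≫ g = g') (d : ℕ) : T.pullbackMap h w d ≫ pullback.snd g (T.hom d) =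
      pullback.snd g' (T.hom d) := pullback.lift_snd _ _ _

theorem Tower.pullbackOver_isCartesian (T : Tower Y) {Z' Z : Scheme.{u}} {g' : Z' ⟶ Y} {g : Z ⟶ Y}
    (h : Z' ⟶ Z) (w : h ≫ g = g') : (T.pullbackOver h w).IsCartesian := by
  intro d
  change IsPullback (T.pullbackMap h w d) (pullback.fst g' (T.hom d)) (pullback.fst g (T.hom d)) h
  refine IsPullback.of_right (h₁₂ := pullback.snd g (T.hom d)) (v₁₃ := T.hom d) (h₂₂ := g) ?_
    (T.pullbackMap_fst h w d) (IsPullback.of_hasPullback g (T.hom d)).flip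
  rw [T.pullbackMap_snd, w]
  exact (IsPullback.of_hasPullback g' (T.hom d)).flip

instance (T : Tower Y) (g : Y' ⟶ Y) (d : ℕ) [IsAffineHom (T.hom d)] :
    IsAffineHom ((T.pullback g).hom d) :=
  MorphismProperty.of_isPullback (P := @IsAffineHom) (T.pullbackSnd_isCartesian g d) ‹_›

/-- On an affine open set, formal coordinates can be checked on global sections. -/
theorem IsCoord.of_isAffineOpen [∀ d, IsAffineHom (T.hom d)] {U : Y.Opens} (hU : IsAffineOpen U)
    {s : Fin n → T.Sections U}
    (hs : ∀ d, IsTruncBasis ((T.hom d).app U).hom (fun j => T.proj U d (s j)) d) :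
    IsCoord T U s := by
  refine of_basis fun d y hy W hW hyW => ?_
  obtain ⟨B, hB, hyB, hBW⟩ := exists_affine_le hyW
  exact ⟨B, hBW.trans hW, hBW, hyB, T.idHom_isCartesian.isTruncBasis hU hB (hBW.trans hW) (hs d)⟩

end BaseChange

/-- Compatibility of the base changes along `h` and along the structure morphisms. -/
theorem Tower.pullbackOver_pullbackSnd {Y : Scheme.{u}} (T : Tower Y) {Z' Z : Scheme.{u}}
    {g' : Z' ⟶ Y} {g : Z ⟶ Y} (h : Z' ⟶ Z) (w : h ≫ g = g') (V : Y.Opens) (V' : Z.Opens)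
    (V'' : Z'.Opens) (e : V' ≤ g ⁻¹ᵁ V) (e' : V'' ≤ h ⁻¹ᵁ V') (s : T.Sections V) :
    (T.pullbackOver h w).pull V' V'' e' ((T.pullbackSnd g).pull V V' e s) =
      (T.pullbackSnd g').pull V V''
        (e'.trans ((h.preimage_mono e).trans (by rw [← Scheme.Hom.comp_preimage, w]))) s := by
  rw [TowerHom.pull_pull]
  exact TowerHom.pull_congr _ _ (fun d => pullback.lift_snd _ _ _) _ _ _ _ _

theorem Tower.pullbackOver_pullbackOver {Y : Scheme.{u}} (T : Tower Y) {Z'' Z' Z : Scheme.{u}}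
    {g'' : Z'' ⟶ Y} {g' : Z' ⟶ Y} {g : Z ⟶ Y} (h : Z' ⟶ Z) (w : h ≫ g = g') (h' : Z'' ⟶ Z')
    (w' : h' ≫ g' = g'') (k : Z'' ⟶ Z) (hk : h' ≫ h = k) (wk : k ≫ g = g'') (V : Z.Opens)
    (V' : Z'.Opens) (V'' : Z''.Opens) (e : V' ≤ h ⁻¹ᵁ V) (e' : V'' ≤ h' ⁻¹ᵁ V') (e'' : V'' ≤ k ⁻¹ᵁ V)
    (s : (T.pullback g).Sections V) :
    (T.pullbackOver h' w').pull V' V'' e' ((T.pullbackOver h w).pull V V' e s) =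
      (T.pullbackOver k wk).pull V V'' e'' s := by
  rw [TowerHom.pull_pull]
  refine TowerHom.pull_congr _ _ (fun d => ?_) _ _ _ _ _
  change T.pullbackMap h' w' d ≫ T.pullbackMap h w d = T.pullbackMap k wk d
  apply pullback.hom_ext
  · rw [Category.assoc, pullbackMap_fst, ← Category.assoc, pullbackMap_fst, pullbackMap_fst,
      Category.assoc, hk]
  · rw [Category.assoc, pullbackMap_snd, pullbackMap_snd, pullbackMap_snd]

/-! ### Principal parts -/

section Kaehler

open TensorProduct

variable (k A : Type u) [CommRing k] [CommRing A] [Algebra k A] (n : ℕ)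

/-- The conormal module of the diagonal of a standard smooth algebra is free of the right rank. -/
theorem exists_basis_conormal [Algebra.IsStandardSmoothOfRelativeDimension n k A] :
    ∃ a : Fin n → A ⊗[k] A, (∀ i, Algebra.TensorProduct.lmul' k (S := A) (a i) = 0) ∧
      (∀ x ∈ KaehlerDifferential.ideal k A, ∃ c : Fin n → A,
        x - ∑ i, algebraMap A (A ⊗[k] A) (c i) * a i ∈ KaehlerDifferential.ideal k A ^ 2) ∧
      (∀ c : Fin n → A, ∑ i, algebraMap A (A ⊗[k] A) (c i) * a i ∈
        KaehlerDifferential.ideal k A ^ 2 → c = 0) := by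
  -- Over the zero ring the rank does not produce a basis indexed by `Fin n`; there every claim is
  -- trivial.
  cases subsingleton_or_nontrivial A
  · have : Subsingleton (A ⊗[k] A) := Module.subsingleton A _
    refine ⟨0, fun i => Subsingleton.elim _ _, fun x _ => ⟨0, ?_⟩, fun c _ => Subsingleton.elim _ _⟩
    rw [Subsingleton.elim (x - _) 0]
    exact zero_mem _
  have : Algebra.IsStandardSmooth k A :=
    Algebra.IsStandardSmoothOfRelativeDimension.isStandardSmooth n
  have hr : Module.rank A Ω[A⁄k] = n :=
    Algebra.IsStandardSmoothOfRelativeDimension.rank_kaehlerDifferential n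
  let b : Module.Basis (Fin n) A Ω[A⁄k] := (Module.finBasisOfFinrankEq A Ω[A⁄k]
    (Module.finrank_eq_of_rank_eq hr))
  have hb : ∀ i, ∃ a : KaehlerDifferential.ideal k A,
      (KaehlerDifferential.ideal k A).toCotangent a = b i :=
    fun i => Ideal.toCotangent_surjective _ _
  choose a ha using hb
  have key : ∀ c : Fin n → A, (KaehlerDifferential.ideal k A).toCotangent
      (∑ i, algebraMap A (A ⊗[k] A) (c i) • a i) = ∑ i, c i • b i := by
    intro c
    rw [map_sum]
    refine Finset.sum_congr rfl fun i _ => ?_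
    rw [map_smul, ha]
    exact algebraMap_smul (A ⊗[k] A) (c i) (b i)
  have coe : ∀ c : Fin n → A, ((∑ i, algebraMap A (A ⊗[k] A) (c i) • a i :
      KaehlerDifferential.ideal k A) : A ⊗[k] A) =
        ∑ i, algebraMap A (A ⊗[k] A) (c i) * (a i : A ⊗[k] A) := by
    intro c
    simp
  refine ⟨fun i => a i, fun i => (a i).2, fun x hx => ⟨b.repr (Ideal.toCotangent _ ⟨x, hx⟩), ?_⟩,
    fun c hc => ?_⟩
  · have := (key (b.repr (Ideal.toCotangent _ ⟨x, hx⟩))).trans (b.sum_repr _)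
    have := (Ideal.toCotangent_eq _).mp this.symm
    rwa [coe] at this
  · rw [← coe, ← Ideal.toCotangent_eq_zero, key] at hc
    funext i
    exact Fintype.linearIndependent_iff.mp b.linearIndependent c hc i

/-- The algebra `A ⊗ A` over its left factor is formally smooth by base change and augmented by
multiplication. The quotient is left abstract so that it can be taken to be the ring of functions on
an infinitesimal neighbourhood. -/
theorem exists_isTruncBasis_tensor [Algebra.IsStandardSmoothOfRelativeDimension n k A] :
    ∃ a : Fin n → A ⊗[k] A, (∀ i, Algebra.TensorProduct.lmul' k (S := A) (a i) = 0) ∧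
      ∀ (d : ℕ) (C : Type u) [CommRing C] (q : A ⊗[k] A →+* C), Function.Surjective q →
        RingHom.ker q = KaehlerDifferential.ideal k A ^ (d + 1) →
        IsTruncBasis (q.comp (algebraMap A (A ⊗[k] A))) (fun i => q (a i)) d := by
  obtain ⟨a, ha, hgen, hind⟩ := exists_basis_conormal k A n
  have : Algebra.IsStandardSmooth k A :=
    Algebra.IsStandardSmoothOfRelativeDimension.isStandardSmooth n
  have : Algebra.FormallySmooth k A := inferInstance
  refine ⟨a, ha, fun d C _ q hq hker => ?_⟩
  let ε : A ⊗[k] A →ₐ[A] A := Algebra.TensorProduct.lmul'' k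
  have hε : RingHom.ker ε = KaehlerDifferential.ideal k A := rfl
  exact isTruncBasis_of_formallySmooth ε a ha hgen hind q hq d hker

end Kaehler

/-! ### Infinitesimal neighbourhoods of the diagonal and existence of charts. -/

section PrincipalParts

open TensorProduct

variable {S X : Scheme.{u}} (p : X ⟶ S)

/-- The inclusion of an infinitesimal neighbourhood of the diagonal. -/
def nbhdι (d : ℕ) : (principalParts p).obj d ⟶ pullback p p :=
  ((pullback.diagonal p).ker ^ (d + 1)).subschemeι

theorem nbhdι_fst (d : ℕ) : nbhdι p d ≫ pullback.fst p p = (principalParts p).hom d := rfl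

theorem trans_nbhdι (d : ℕ) : (principalParts p).trans d ≫ nbhdι p (d + 1) = nbhdι p d :=
  Scheme.IdealSheafData.inclusion_subschemeι _

instance (d : ℕ) : IsAffineHom (nbhdι p d) :=
  inferInstanceAs (IsAffineHom ((pullback.diagonal p).ker ^ (d + 1)).subschemeι)

/-- The open set `U × U` of the fibre product. -/
abbrev sqOpen (U : X.Opens) : (pullback p p).Opens :=
  pullback.fst p p ⁻¹ᵁ U ⊓ pullback.snd p p ⁻¹ᵁ U

theorem isAffineOpen_sqOpen {U : X.Opens} (hU : IsAffineOpen U) {W : S.Opens} (hW : IsAffineOpen W)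
    (e : U ≤ p ⁻¹ᵁ W) : IsAffineOpen (sqOpen p U) := by
  have : IsAffine _ := hU
  have : IsAffine _ := hW
  exact .of_isIso (Scheme.Hom.isPullback_resLE (IsPullback.of_hasPullback p p) e e
    (UY := sqOpen p U) rfl).isoPullback.hom

variable [IsSeparated p]

/-- A power of the ideal of the diagonal has the closure of the diagonal as its support, and for a
separated morphism the diagonal is closed. So every point of the neighbourhood lies on the diagonal.
-/
theorem fst_nbhdι_apply (d : ℕ) (z : (principalParts p).obj d) :
    pullback.fst p p (nbhdι p d z) = pullback.snd p p (nbhdι p d z) := by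
  have h₁ : nbhdι p d z ∈ Set.range (pullback.diagonal p) := by
    have h₂ : nbhdι p d z ∈ Set.range (nbhdι p d) := ⟨z, rfl⟩
    have h₃ : Set.range (nbhdι p d) = closure (Set.range (pullback.diagonal p)) := by
      rw [← Scheme.Hom.support_ker]
      exact Scheme.IdealSheafData.range_subschemeι _
    rwa [h₃, (pullback.diagonal p).isClosedEmbedding.isClosed_range.closure_eq] at h₂
  obtain ⟨x, hx⟩ := h₁
  rw [← hx, ← Scheme.Hom.comp_apply, ← Scheme.Hom.comp_apply, pullback.diagonal_fst,
    pullback.diagonal_snd]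

/-- Both projections agree on points, so the part of the neighbourhood over `U` sits inside `U × U`.
This makes the computation affine when `U` is small. -/
theorem hom_preimage_eq (d : ℕ) (U : X.Opens) :
    (principalParts p).hom d ⁻¹ᵁ U = nbhdι p d ⁻¹ᵁ sqOpen p U := by
  ext z
  change pullback.fst p p (nbhdι p d z) ∈ U ↔
    pullback.fst p p (nbhdι p d z) ∈ U ∧ pullback.snd p p (nbhdι p d z) ∈ U
  rw [← fst_nbhdι_apply, and_self_iff]

instance (d : ℕ) : IsAffineHom ((principalParts p).hom d) := by
  refine isAffineHom_of_forall_exists_isAffineOpen _ fun x => ?_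
  obtain ⟨W, hW, hxW, -⟩ := exists_affine_le (Y := S) (y := p x) (W := ⊤) trivial
  obtain ⟨U, hU, hxU, hUW⟩ := exists_affine_le (Y := X) (y := x) (W := p ⁻¹ᵁ W) hxW
  refine ⟨U, hxU, hU, ?_⟩
  rw [hom_preimage_eq]
  exact (isAffineOpen_sqOpen p hU hW hUW).preimage _

/-- The section of the principal parts defined by a function near the diagonal. -/
def ofFunction (U : X.Opens) (b : Γ(pullback p p, sqOpen p U)) : (principalParts p).Sections U :=
  ⟨fun d => (nbhdι p d).appLE (sqOpen p U) _ (hom_preimage_eq p d U).le b, fun d => by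
    rw [appLE_appLE]
    exact appLE_congr (trans_nbhdι p d) _ _⟩

theorem appLE_nbhdι_surjective {U : X.Opens} (hU : IsAffineOpen (sqOpen p U)) (d : ℕ) :
    Function.Surjective
      ((nbhdι p d).appLE (sqOpen p U) _ (hom_preimage_eq p d U).le).hom := by
  -- The two preimages are equal but not by definition. Generalizing one of them to a variable `V`
  -- lets the equality be substituted.
  have : ∀ (V : ((principalParts p).obj d).Opens) (h : V = nbhdι p d ⁻¹ᵁ sqOpen p U),
      Function.Surjective ((nbhdι p d).appLE (sqOpen p U) V h.le).hom := by
    rintro _ rfl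
    rw [← Scheme.Hom.app_eq_appLE]
    exact ((pullback.diagonal p).ker ^ (d + 1)).subschemeι_app_surjective ⟨_, hU⟩
  exact this _ (hom_preimage_eq p d U)

theorem ker_appLE_nbhdι {U : X.Opens} (hU : IsAffineOpen (sqOpen p U)) (d : ℕ) :
    RingHom.ker ((nbhdι p d).appLE (sqOpen p U) _ (hom_preimage_eq p d U).le).hom =
      RingHom.ker ((pullback.diagonal p).app (sqOpen p U)).hom ^ (d + 1) := by
  have : ∀ (V : ((principalParts p).obj d).Opens) (h : V = nbhdι p d ⁻¹ᵁ sqOpen p U),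
      RingHom.ker ((nbhdι p d).appLE (sqOpen p U) V h.le).hom =
      RingHom.ker ((pullback.diagonal p).app (sqOpen p U)).hom ^ (d + 1) := by
    rintro _ rfl
    rw [← Scheme.Hom.app_eq_appLE]
    refine (((pullback.diagonal p).ker ^ (d + 1)).ker_subschemeι_app ⟨_, hU⟩).trans ?_
    rw [Scheme.IdealSheafData.ideal_pow, Pi.pow_apply, Scheme.Hom.ker_apply]
  exact this _ (hom_preimage_eq p d U)

/-- A smooth scheme has formal coordinates locally. -/
theorem exists_chart (n : ℕ) [SmoothOfRelativeDimension n p] (x : X) :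
    ∃ (U : X.Opens) (s : Fin n → (principalParts p).Sections U), x ∈ U ∧ IsAffineOpen U ∧
      IsCoord (principalParts p) U s := by
  obtain ⟨W, hW, U, hU, hxU, e, hst⟩ :=
    SmoothOfRelativeDimension.exists_isStandardSmoothOfRelativeDimension (n := n) (f := p) x
  algebraize [(p.appLE W U e).hom]
  have hO := isAffineOpen_sqOpen p hU hW e
  obtain ⟨a, ha, H⟩ := exists_isTruncBasis_tensor Γ(S, W) Γ(X, U) n
  have h₁ := isIso_pushoutSection_of_isAffineOpen (IsPullback.of_hasPullback p p) e e
    (UY := sqOpen p U) rfl hW hU hU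
  rw [isIso_pushoutSection_iff] at h₁
  have h₂ := CommRingCat.isPushout_tensorProduct Γ(S, W) Γ(X, U) Γ(X, U)
  -- Functions on the affine open set `U × U` are identified with `A ⊗ A`, where `A = Γ(X, U)`.
  let Θ := h₂.isoIsPushout _ _ h₁
  have hΘl : ∀ r, Θ.hom (algebraMap Γ(X, U) _ r) =
      (pullback.fst p p).appLE U (sqOpen p U) inf_le_left r :=
    fun r => congr($(h₂.inl_isoIsPushout_hom _ _ h₁) r)
  have hΘr : ∀ r, Θ.hom (1 ⊗ₜ r) = (pullback.snd p p).appLE U (sqOpen p U) inf_le_right r :=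
    fun r => congr($(h₂.inr_isoIsPushout_hom _ _ h₁) r)
  have hpre : U = pullback.diagonal p ⁻¹ᵁ sqOpen p U := by
    rw [Scheme.Hom.preimage_inf, ← Scheme.Hom.comp_preimage, ← Scheme.Hom.comp_preimage,
      pullback.diagonal_fst, pullback.diagonal_snd]
    simp
  have hid : ∀ (f : pullback p p ⟶ X) (w : pullback.diagonal p ≫ f = 𝟙 X)
      (e' : sqOpen p U ≤ f ⁻¹ᵁ U) (r : Γ(X, U)),
      (pullback.diagonal p).appLE (sqOpen p U) U hpre.le (f.appLE U (sqOpen p U) e' r) = r := by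
    intro f w e' r
    rw [appLE_appLE]
    refine (appLE_congr w _ r).trans ((id_appLE _ r).trans (resO_self _ _ r))
  -- Restriction to the diagonal becomes multiplication, so the ideal of the diagonal becomes the
  -- ideal that defines Kähler differentials.
  have hdiag : ∀ z, (pullback.diagonal p).appLE (sqOpen p U) U hpre.le (Θ.hom z) =
      Algebra.TensorProduct.lmul' Γ(S, W) z := by
    intro z
    induction z using TensorProduct.induction_on with
    | zero => rw [map_zero, map_zero, map_zero]
    | add y z hy hz => rw [map_add, map_add, map_add, hy, hz]
    | tmul y z =>
      have : (y ⊗ₜ[Γ(S, W)] z : Γ(X, U) ⊗[Γ(S, W)] Γ(X, U)) =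
          algebraMap Γ(X, U) _ y * (1 ⊗ₜ z) := by
        rw [Algebra.TensorProduct.algebraMap_apply, Algebra.TensorProduct.tmul_mul_tmul]
        simp
      rw [this, map_mul, map_mul, hΘl, hΘr, hid _ (pullback.diagonal_fst p),
        hid _ (pullback.diagonal_snd p), ← this, Algebra.TensorProduct.lmul'_apply_tmul]
  have hker : ∀ (V : X.Opens) (h : V = pullback.diagonal p ⁻¹ᵁ sqOpen p U),
      RingHom.ker ((pullback.diagonal p).app (sqOpen p U)).hom =
        RingHom.ker ((pullback.diagonal p).appLE (sqOpen p U) V h.le).hom := by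
    rintro _ rfl
    rw [Scheme.Hom.app_eq_appLE]
  refine ⟨U, fun j => ofFunction p U (Θ.hom (a j)), hxU, hU, IsCoord.of_isAffineOpen hU fun d => ?_⟩
  have hΘb : Function.Bijective Θ.hom.hom := Θ.commRingCatIsoToRingEquiv.bijective
  have := H d _ (((nbhdι p d).appLE (sqOpen p U) _ (hom_preimage_eq p d U).le).hom.comp Θ.hom.hom)
    ((appLE_nbhdι_surjective p hO d).comp hΘb.2) (by
      rw [← RingHom.comap_ker, ker_appLE_nbhdι p hO, hker U hpre]
      have hI : KaehlerDifferential.ideal Γ(S, W) Γ(X, U) =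
          (RingHom.ker ((pullback.diagonal p).appLE (sqOpen p U) U hpre.le).hom).comap
            Θ.hom.hom := by
        ext z
        rw [Ideal.mem_comap, RingHom.mem_ker, RingHom.mem_ker]
        exact (congrArg (· = 0) (hdiag z)).symm.to_iff
      rw [hI]
      change Ideal.comap Θ.commRingCatIsoToRingEquiv _ = Ideal.comap Θ.commRingCatIsoToRingEquiv _ ^ _
      rw [← Ideal.map_symm, ← Ideal.map_symm, Ideal.map_pow])
  convert this using 1
  · ext r
    change ((principalParts p).hom d).app U r = (nbhdι p d).appLE _ _ _ (Θ.hom (algebraMap _ _ r))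
    rw [hΘl, appLE_appLE, app_eq_appLE]
    exact appLE_congr (nbhdι_fst p d).symm _ _
  · rfl

end PrincipalParts

/-! ### Power series expansions in formal coordinates -/

namespace IsCoord

variable {Y Y' : Scheme.{u}} {T : Tower Y} {T' : Tower Y'} {n : ℕ} {V : Y.Opens}
  {s : Fin n → T.Sections V}

/-- Evaluation of power series at formal coordinates. -/
def eval (hs : IsCoord T V s) (W : Y.Opens) (e : W ≤ V) :
    MvPowerSeries (Fin n) Γ(Y, W) →ₐ[Γ(Y, W)] T.Sections W where
  toFun f := ⟨fun d => (hs d W e).evalPS f, fun d =>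
    (hs d W e).evalPS_of_le (Nat.le_succ d) (hs (d + 1) W e)
      ((T.trans d).appLE _ _ (T.preimage_le d W)).hom
      (RingHom.ext fun r => T.trans_proj W (algebraMap _ _ r) d) (fun _ => T.trans_proj W _ d) f⟩
  map_one' := Subtype.ext (funext fun d => map_one ((hs d W e).evalPS))
  map_mul' f g := Subtype.ext (funext fun d => map_mul ((hs d W e).evalPS) f g)
  map_zero' := Subtype.ext (funext fun d => map_zero ((hs d W e).evalPS))
  map_add' f g := Subtype.ext (funext fun d => map_add ((hs d W e).evalPS) f g)
  commutes' r := Subtype.ext (funext fun d => (hs d W e).evalPS_C r)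

theorem proj_eval (hs : IsCoord T V s) (W : Y.Opens) (e : W ≤ V)
    (f : MvPowerSeries (Fin n) Γ(Y, W)) (d : ℕ) :
    T.proj W d (hs.eval W e f) = (hs d W e).evalPS f := rfl

theorem proj_eval_eq_zero_iff (hs : IsCoord T V s) (W : Y.Opens) (e : W ≤ V)
    (f : MvPowerSeries (Fin n) Γ(Y, W)) (d : ℕ) : T.proj W d (hs.eval W e f) = 0 ↔
      ∀ α : Fin n →₀ ℕ, α.degree ≤ d → MvPowerSeries.coeff α f = 0 :=
  (hs d W e).evalPS_eq_zero_iff f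

/-- A section of the limit is a compatible sequence of truncated polynomials, and these determine
one power series. -/
theorem eval_bijective (hs : IsCoord T V s) (W : Y.Opens) (e : W ≤ V) :
    Function.Bijective (hs.eval W e) := by
  constructor
  · rw [injective_iff_map_eq_zero]
    intro f hf
    ext α
    refine (hs.proj_eval_eq_zero_iff W e f α.degree).mp ?_ α le_rfl
    rw [hf, map_zero]
  · intro x
    have h₁ : ∀ d, ∃ f, T.proj W d (hs.eval W e f - x) = 0 := fun d => by
      obtain ⟨f, hf⟩ := (hs d W e).evalPS_surjective (T.proj W d x)
      exact ⟨f, by rw [map_sub, proj_eval, hf, sub_self]⟩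
    choose f hf using h₁
    -- The coefficient of exponent `α` is read off at level `α.degree`, the first level that sees
    -- it; all higher levels agree with it.
    refine ⟨psMk fun α => MvPowerSeries.coeff α (f α.degree), Tower.Sections.ext fun d => ?_⟩
    rw [← sub_eq_zero, ← map_sub]
    have h₂ : T.proj W d (hs.eval W e ((psMk fun α => MvPowerSeries.coeff α (f α.degree)) - f d)) =
        0 := by
      rw [hs.proj_eval_eq_zero_iff]
      intro α hα
      have h₃ := T.proj_eq_zero_of_le W hα _ (hf d)
      have h₄ := hf α.degree
      rw [map_sub, sub_eq_zero] at h₃ h₄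
      have h₅ : T.proj W α.degree (hs.eval W e (f α.degree - f d)) = 0 := by
        rw [map_sub, map_sub, h₃, h₄, sub_self]
      rw [map_sub, coeff_psMk, ← map_sub]
      exact (hs.proj_eval_eq_zero_iff W e _ _).mp h₅ α le_rfl
    rw [map_sub, map_sub, sub_eq_zero] at h₂
    rw [map_sub, h₂, ← map_sub]
    exact hf d

/-- The expansion in formal coordinates, as an isomorphism. -/
def equiv (hs : IsCoord T V s) (W : Y.Opens) (e : W ≤ V) :
    MvPowerSeries (Fin n) Γ(Y, W) ≃ₐ[Γ(Y, W)] T.Sections W :=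
  AlgEquiv.ofBijective (hs.eval W e) (hs.eval_bijective W e)

theorem proj_equiv_eq_zero_iff (hs : IsCoord T V s) (W : Y.Opens) (e : W ≤ V)
    (f : MvPowerSeries (Fin n) Γ(Y, W)) (d : ℕ) : T.proj W d (hs.equiv W e f) = 0 ↔
      ∀ α : Fin n →₀ ℕ, α.degree ≤ d → MvPowerSeries.coeff α f = 0 :=
  hs.proj_eval_eq_zero_iff W e f d

theorem equiv_X (hs : IsCoord T V s) (W : Y.Opens) (e : W ≤ V) (j : Fin n) :
    hs.equiv W e (MvPowerSeries.X j) = T.res e (s j) :=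
  Tower.Sections.ext fun d => (hs d W e).evalPS_X j

theorem pull_equiv {h : Y' ⟶ Y} (m : TowerHom h T' T) (hs : IsCoord T V s) {V' : Y'.Opens}
    {s' : Fin n → T'.Sections V'} (hs' : IsCoord T' V' s') {W : Y.Opens} (eW : W ≤ V)
    {W' : Y'.Opens} (eW' : W' ≤ V') (e : W' ≤ h ⁻¹ᵁ W)
    (w : ∀ j, m.pull W W' e (T.res eW (s j)) = T'.res eW' (s' j))
    (f : MvPowerSeries (Fin n) Γ(Y, W)) :
    m.pull W W' e (hs.equiv W eW f) =
      hs'.equiv W' eW' (MvPowerSeries.map (h.appLE W W' e).hom f) := by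
  refine Tower.Sections.ext fun d => ?_
  refine (hs d W eW).map_evalPS (hs' d W' eW') (h.appLE W W' e).hom
    ((m.map d).appLE _ _ (m.preimage_le e d)).hom ?_ (fun j => ?_) f
  · ext r
    exact congr(T'.proj W' d $(m.pull_algebraMap W W' e r))
  · exact congr(T'.proj W' d $(w j))

theorem res_equiv (hs : IsCoord T V s) {W W' : Y.Opens} (e : W ≤ V) (e' : W' ≤ W)
    (f : MvPowerSeries (Fin n) Γ(Y, W)) :
    T.res e' (hs.equiv W e f) = hs.equiv W' (e'.trans e) (MvPowerSeries.map (resO Y e') f) := by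
  have h₁ : ((𝟙 Y : Y ⟶ Y).appLE W W' e').hom = resO Y e' := RingHom.ext fun r => id_appLE _ _
  refine (pull_equiv T.idHom hs hs e (e'.trans e) e' (fun j => T.res_res _ _ _) f).trans ?_
  rw [h₁]

/-- The coefficient of a section in its expansion in formal coordinates. -/
def coeff (hs : IsCoord T V s) (W : Y.Opens) (e : W ≤ V) (α : Fin n →₀ ℕ) :
    T.Sections W →ₗ[Γ(Y, W)] Γ(Y, W) :=
  MvPowerSeries.coeff α ∘ₗ (hs.equiv W e).symm.toLinearMap

theorem coeff_apply (hs : IsCoord T V s) (W : Y.Opens) (e : W ≤ V) (α : Fin n →₀ ℕ)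
    (x : T.Sections W) : hs.coeff W e α x = MvPowerSeries.coeff α ((hs.equiv W e).symm x) := rfl

theorem coeff_equiv (hs : IsCoord T V s) (W : Y.Opens) (e : W ≤ V) (α : Fin n →₀ ℕ)
    (f : MvPowerSeries (Fin n) Γ(Y, W)) :
    hs.coeff W e α (hs.equiv W e f) = MvPowerSeries.coeff α f := by
  rw [coeff_apply, AlgEquiv.symm_apply_apply]

theorem ext_coeff (hs : IsCoord T V s) (W : Y.Opens) (e : W ≤ V) {x y : T.Sections W}
    (h : ∀ α, hs.coeff W e α x = hs.coeff W e α y) : x = y :=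
  (hs.equiv W e).symm.injective (MvPowerSeries.ext h)

/-- Expansion is natural: if the coordinates downstairs pull back to those upstairs, Taylor
coefficients pull back as functions. -/
theorem coeff_pull {h : Y' ⟶ Y} (m : TowerHom h T' T) (hs : IsCoord T V s) {V' : Y'.Opens}
    {s' : Fin n → T'.Sections V'} (hs' : IsCoord T' V' s') {W : Y.Opens} (eW : W ≤ V)
    {W' : Y'.Opens} (eW' : W' ≤ V') (e : W' ≤ h ⁻¹ᵁ W)
    (w : ∀ j, m.pull W W' e (T.res eW (s j)) = T'.res eW' (s' j)) (α : Fin n →₀ ℕ)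
    (x : T.Sections W) :
    hs'.coeff W' eW' α (m.pull W W' e x) = h.appLE W W' e (hs.coeff W eW α x) := by
  obtain ⟨f, rfl⟩ := (hs.equiv W eW).surjective x
  rw [pull_equiv m hs hs' eW eW' e w, coeff_equiv, coeff_equiv]
  rfl

theorem coeff_res (hs : IsCoord T V s) {W W' : Y.Opens} (e : W ≤ V) (e' : W' ≤ W)
    (α : Fin n →₀ ℕ) (x : T.Sections W) :
    hs.coeff W' (e'.trans e) α (T.res e' x) = resO Y e' (hs.coeff W e α x) := by
  obtain ⟨f, rfl⟩ := (hs.equiv W e).surjective x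
  rw [res_equiv, coeff_equiv, coeff_equiv]
  rfl

theorem proj_eq_zero_iff (hs : IsCoord T V s) (W : Y.Opens) (e : W ≤ V) (x : T.Sections W)
    (d : ℕ) : T.proj W d x = 0 ↔ ∀ α : Fin n →₀ ℕ, α.degree ≤ d → hs.coeff W e α x = 0 := by
  obtain ⟨f, rfl⟩ := (hs.equiv W e).surjective x
  rw [proj_equiv_eq_zero_iff]
  simp only [coeff_equiv]

theorem mem_idealZero_iff (hs : IsCoord T V s) (W : Y.Opens) (e : W ≤ V) (x : T.Sections W) :
    x ∈ T.idealZero W ↔ hs.coeff W e 0 x = 0 := by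
  rw [Tower.idealZero, RingHom.mem_ker, hs.proj_eq_zero_iff W e]
  constructor
  · intro h
    exact h 0 (by simp)
  · intro h α hα
    rw [(Finsupp.degree_eq_zero_iff _).mp (Nat.le_zero.mp hα), h]

theorem mem_idealZero (hs : IsCoord T V s) (j : Fin n) : s j ∈ T.idealZero V := by
  have := (hs.isTruncBasis 0).mono_eq_zero (α := Finsupp.single j 1) (by simp)
  rw [Tower.idealZero, RingHom.mem_ker]
  simpa [mono, Finsupp.single_apply, Finset.prod_pow_boole] using this

theorem equiv_monomial (hs : IsCoord T V s) (W : Y.Opens) (e : W ≤ V) (α : Fin n →₀ ℕ)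
    (r : Γ(Y, W)) : hs.equiv W e (MvPowerSeries.monomial α r) =
      r • mono (fun j => T.res e (s j)) α := by
  have h₁ : (MvPowerSeries.monomial α r : MvPowerSeries (Fin n) Γ(Y, W)) =
      r • mono MvPowerSeries.X α := by
    rw [MvPowerSeries.monomial_eq', MvPowerSeries.smul_eq_C_mul, mono,
      Finsupp.prod_fintype _ _ fun i => pow_zero _]
  rw [h₁, map_smul]
  congr 1
  exact (map_mono (hs.equiv W e : MvPowerSeries (Fin n) Γ(Y, W) →+* T.Sections W) _ _).trans
    (congrArg (mono · α) (funext fun j => hs.equiv_X W e j))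

theorem coeff_mono (hs : IsCoord T V s) (W : Y.Opens) (e : W ≤ V) (α β : Fin n →₀ ℕ) :
    hs.coeff W e β (mono (fun j => T.res e (s j)) α) = if β = α then 1 else 0 := by
  classical
  have := hs.equiv_monomial W e α 1
  rw [one_smul] at this
  rw [← this, coeff_equiv, MvPowerSeries.coeff_monomial]

/-- Linear functionals that factor through a truncation are determined by their values on
monomials. -/
theorem functional_eq_sum (hs : IsCoord T V s) (W : Y.Opens) (e : W ≤ V)
    (l : T.Sections W →ₗ[Γ(Y, W)] Γ(Y, W)) (d : ℕ) (hl : ∀ x, T.proj W d x = 0 → l x = 0)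
    (x : T.Sections W) :
    l x = ∑ α ∈ degLE n d, hs.coeff W e α x * l (mono (fun j => T.res e (s j)) α) := by
  have h₁ : l (x - ∑ α ∈ degLE n d, hs.coeff W e α x • mono (fun j => T.res e (s j)) α) = 0 := by
    refine hl _ ((hs.proj_eq_zero_iff W e _ d).mpr fun β hβ => ?_)
    simp only [map_sub, map_sum, map_smul, coeff_mono, smul_eq_mul, mul_ite, mul_one, mul_zero,
      Finset.sum_ite_eq, mem_degLE, hβ, if_true, sub_self]
  rw [map_sub, sub_eq_zero] at h₁
  rw [h₁]
  simp only [map_sum, map_smul, smul_eq_mul]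

end IsCoord

/-! ### Formal isomorphisms and formal coordinates -/

/-- A power series and its truncation differ by an element of the kernel, so polynomials already
surject and have the expected relations. -/
theorem IsTruncBasis.of_idealX {n : ℕ} {R A : Type*} [CommRing R] [CommRing A]
    (Ψ : MvPowerSeries (Fin n) R →+* A) (hΨ : Function.Surjective Ψ) (d : ℕ)
    (hker : RingHom.ker Ψ = idealX n R ^ (d + 1)) :
    IsTruncBasis (Ψ.comp MvPowerSeries.C) (fun j => Ψ (MvPowerSeries.X j)) d := by
  have h₁ : ∀ q : MvPolynomial (Fin n) R, MvPolynomial.eval₂Hom (Ψ.comp MvPowerSeries.C)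
      (fun j => Ψ (MvPowerSeries.X j)) q = Ψ (q : MvPowerSeries (Fin n) R) := by
    intro q
    have : MvPolynomial.eval₂Hom (Ψ.comp MvPowerSeries.C) (fun j => Ψ (MvPowerSeries.X j)) =
        Ψ.comp MvPolynomial.coeToMvPowerSeries.ringHom := by
      refine MvPolynomial.ringHom_ext (fun r => ?_) fun i => ?_ <;> simp
    exact congr($this q)
  refine ⟨fun a => ?_, ?_⟩
  · obtain ⟨f, rfl⟩ := hΨ a
    refine ⟨f.truncTotal (d + 1), ?_⟩
    have := sub_coe_truncTotal_mem d f
    rw [← hker, RingHom.mem_ker, map_sub, sub_eq_zero] at this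
    rw [h₁, this]
  · ext q
    rw [RingHom.mem_ker, h₁, ← RingHom.mem_ker, hker, mem_idealX_pow_iff,
      MvPolynomial.mem_pow_idealOfVars_iff']
    simp

/-! ### Power series isomorphisms and formal coordinates of a tower. -/

section Tower

variable {Y Y' : Scheme.{u}} {T : Tower Y} {n : ℕ} {U : Y.Opens}

namespace IsCoord

variable {s : Fin n → T.Sections U}

theorem map_idealX (hs : IsCoord T U s) (W : Y.Opens) (e : W ≤ U) :
    (idealX n Γ(Y, W)).map (hs.equiv W e : MvPowerSeries (Fin n) Γ(Y, W) →+* T.Sections W) =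
      T.idealZero W := by
  ext x
  obtain ⟨f, rfl⟩ := (hs.equiv W e).surjective x
  rw [hs.mem_idealZero_iff W e, hs.coeff_equiv,
    Ideal.mem_map_iff_of_surjective
      (hs.equiv W e : MvPowerSeries (Fin n) Γ(Y, W) →+* T.Sections W) (hs.equiv W e).surjective]
  constructor
  · rintro ⟨f', hf', hff'⟩
    have : f' = f := (hs.equiv W e).injective hff'
    subst this
    simpa [mem_idealX_iff] using hf'
  · intro h
    exact ⟨f, by simpa [mem_idealX_iff] using h, rfl⟩

theorem map_idealX_pow (hs : IsCoord T U s) (W : Y.Opens) (e : W ≤ U) (d : ℕ) :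
    (idealX n Γ(Y, W) ^ (d + 1)).map
      (hs.equiv W e : MvPowerSeries (Fin n) Γ(Y, W) →+* T.Sections W) =
      RingHom.ker (T.proj W d) := by
  ext x
  obtain ⟨f, rfl⟩ := (hs.equiv W e).surjective x
  rw [RingHom.mem_ker, hs.proj_equiv_eq_zero_iff W e,
    Ideal.mem_map_iff_of_surjective
      (hs.equiv W e : MvPowerSeries (Fin n) Γ(Y, W) →+* T.Sections W) (hs.equiv W e).surjective]
  constructor
  · rintro ⟨f', hf', hff'⟩
    have : f' = f := (hs.equiv W e).injective hff'
    subst this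
    simpa [mem_idealX_pow_iff, Nat.lt_succ_iff] using hf'
  · intro h
    exact ⟨f, by simpa [mem_idealX_pow_iff, Nat.lt_succ_iff] using h, rfl⟩

/-- In the presence of coordinates the filtration by the kernels of the projections is the adic one.
It can thus be recovered from the ring and its augmentation ideal alone. -/
theorem idealZero_pow (hs : IsCoord T U s) (W : Y.Opens) (e : W ≤ U) (d : ℕ) :
    T.idealZero W ^ (d + 1) = RingHom.ker (T.proj W d) := by
  rw [← hs.map_idealX W e, ← Ideal.map_pow, hs.map_idealX_pow]

/-- Formal coordinates define an isomorphism with a power series algebra. -/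
def powerSeriesIso (hs : IsCoord T U s) : PowerSeriesIso n T U where
  iso V e := hs.equiv V e
  natural _ hV _ e f := (hs.res_equiv hV e f).symm

end IsCoord

namespace PowerSeriesIso

theorem iso_X (ψ : PowerSeriesIso n T U) (W : Y.Opens) (e : W ≤ U) (j : Fin n) :
    ψ.iso W e (MvPowerSeries.X j) = T.res e (ψ.iso U le_rfl (MvPowerSeries.X j)) := by
  rw [← ψ.natural U le_rfl W e, MvPowerSeries.map_X]

@[ext]
-- Continuity is not assumed but automatic: the composite of one isomorphism with the inverse of the
-- other is an endomorphism of a power series algebra that fixes the variables, hence trivial.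
theorem ext {ψ ψ' : PowerSeriesIso n T U}
    (h : ∀ j, ψ.iso U le_rfl (MvPowerSeries.X j) = ψ'.iso U le_rfl (MvPowerSeries.X j)) :
    ψ = ψ' := by
  have : ψ.iso = ψ'.iso := by
    funext W e
    refine AlgEquiv.ext fun f => ?_
    have := algHom_apply_eq_self ((ψ'.iso W e).symm.toAlgHom.comp (ψ.iso W e).toAlgHom) (fun j => ?_) f
    · exact (AlgEquiv.symm_apply_eq _).mp this
    · exact (AlgEquiv.symm_apply_eq _).mpr (by
        change ψ.iso W e (MvPowerSeries.X j) = ψ'.iso W e (MvPowerSeries.X j)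
        rw [iso_X ψ, iso_X ψ' W, h])
  cases ψ
  cases ψ'
  cases this
  rfl

/-- An abstract isomorphism that sends the variables into the augmentation ideal carries the ideal
of the variables onto it. Powers of the augmentation ideal are the kernels of the projections, so
the isomorphism descends to every truncation. -/
theorem isCoord (ψ : PowerSeriesIso n T U)
    (h₀ : ∀ j, ψ.iso U le_rfl (MvPowerSeries.X j) ∈ T.idealZero U)
    (hT : ∀ y ∈ U, ∃ (V : Y.Opens) (s : Fin n → T.Sections V), y ∈ V ∧ IsCoord T V s) :
    IsCoord T U (fun j => ψ.iso U le_rfl (MvPowerSeries.X j)) := by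
  refine IsCoord.of_cover fun y hy => ?_
  obtain ⟨V, s, hyV, hs⟩ := hT y hy
  refine ⟨U ⊓ V, inf_le_left, ⟨hy, hyV⟩, fun d W e => ?_⟩
  have eV : W ≤ V := e.trans inf_le_right
  have eU : W ≤ U := e.trans inf_le_left
  have hX : ∀ j, ψ.iso W eU (MvPowerSeries.X j) ∈ T.idealZero W := by
    intro j
    rw [iso_X, Tower.idealZero, RingHom.mem_ker, Tower.proj_res]
    rw [show T.proj U 0 _ = 0 from h₀ j, map_zero]
  -- For the reverse inclusion only the constant term matters: being linear over functions, `ψ`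
  -- sends it to the structural image, which lies in the augmentation ideal only if it vanishes.
  have hmap : (idealX n Γ(Y, W)).map
      (ψ.iso W eU : MvPowerSeries (Fin n) Γ(Y, W) →+* T.Sections W) = T.idealZero W := by
    have hle : (idealX n Γ(Y, W)).map
        (ψ.iso W eU : MvPowerSeries (Fin n) Γ(Y, W) →+* T.Sections W) ≤ T.idealZero W := by
      rw [idealX, Ideal.map_span, Ideal.span_le]
      rintro _ ⟨_, ⟨j, rfl⟩, rfl⟩
      exact hX j
    refine le_antisymm hle fun x hx => ?_
    obtain ⟨f, rfl⟩ := (ψ.iso W eU).surjective x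
    refine Ideal.mem_map_of_mem (ψ.iso W eU : MvPowerSeries (Fin n) Γ(Y, W) →+* T.Sections W) ?_
    have h₁ : f - MvPowerSeries.C (MvPowerSeries.coeff 0 f) ∈ idealX n Γ(Y, W) := by
      rw [mem_idealX_iff]
      simp
    have h₂ := hle (Ideal.mem_map_of_mem _ h₁)
    rw [map_sub] at h₂
    have h₃ := Ideal.sub_mem _ hx h₂
    change ψ.iso W eU f - (ψ.iso W eU f - ψ.iso W eU _) ∈ _ at h₃
    rw [sub_sub_cancel] at h₃
    have h₄ : ψ.iso W eU (MvPowerSeries.C (MvPowerSeries.coeff 0 f)) =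
        hs.equiv W eV (MvPowerSeries.C (MvPowerSeries.coeff 0 f)) :=
      ((ψ.iso W eU).commutes _).trans ((hs.equiv W eV).commutes _).symm
    rw [h₄, hs.mem_idealZero_iff W eV, hs.coeff_equiv] at h₃
    simpa [mem_idealX_iff] using h₃
  have hsurj : Function.Surjective (T.proj W d) := by
    intro a
    obtain ⟨f, hf⟩ := (hs d W eV).evalPS_surjective a
    exact ⟨hs.eval W eV f, hf⟩
  have h₅ := IsTruncBasis.of_idealX ((T.proj W d).comp
    (ψ.iso W eU : MvPowerSeries (Fin n) Γ(Y, W) →+* T.Sections W))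
    (hsurj.comp (ψ.iso W eU).surjective) d (by
      rw [← RingHom.comap_ker, ← hs.idealZero_pow W eV, ← hmap, ← Ideal.map_pow]
      exact Ideal.comap_map_of_bijective _ (ψ.iso W eU).bijective)
  convert h₅ using 1
  · ext r
    exact congrArg (T.proj W d) ((ψ.iso W eU).commutes r).symm
  · funext j
    rw [T.res_res]
    exact congrArg (T.proj W d) (ψ.iso_X W eU j).symm

end PowerSeriesIso

end Tower

/-! ### Formal isomorphisms over `X`-schemes and their inverse images. -/

section Moduli

variable {S X : Scheme.{u}} {p : X ⟶ S} {n : ℕ}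

theorem exists_chart_pullback (p : X ⟶ S) [IsSeparated p] (n : ℕ) [SmoothOfRelativeDimension n p]
    {Y : Scheme.{u}} (g : Y ⟶ X) (y : Y) :
    ∃ (V : Y.Opens) (s : Fin n → ((principalParts p).pullback g).Sections V), y ∈ V ∧
      IsCoord ((principalParts p).pullback g) V s := by
  obtain ⟨U, s, hU, -, hs⟩ := exists_chart p n (g y)
  exact ⟨g ⁻¹ᵁ U, _, hU, hs.pull ((principalParts p).pullbackSnd_isCartesian g) le_rfl⟩

namespace FormalIso

@[ext]
theorem ext {Y : Over X} {φ φ' : FormalIso p n Y} (h : ∀ j, φ.coords j = φ'.coords j) :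
    φ = φ' := by
  have : φ.toPowerSeriesIso = φ'.toPowerSeriesIso := PowerSeriesIso.ext h
  cases φ
  cases φ'
  cases this
  rfl

/-- The isomorphism defined by formal coordinates. -/
def ofIsCoord (Y : Over X) {a : Fin n → ((principalParts p).pullback Y.hom).Sections ⊤}
    (ha : IsCoord ((principalParts p).pullback Y.hom) ⊤ a) : FormalIso p n Y where
  toPowerSeriesIso := ha.powerSeriesIso
  map_ideal V := ha.map_idealX V le_top

theorem coords_ofIsCoord (Y : Over X)
    {a : Fin n → ((principalParts p).pullback Y.hom).Sections ⊤}
    (ha : IsCoord ((principalParts p).pullback Y.hom) ⊤ a) (j : Fin n) :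
    (ofIsCoord Y ha).coords j = a j :=
  (ha.equiv_X ⊤ le_top j).trans (Tower.res_self _ _ _)

variable [IsSeparated p] [SmoothOfRelativeDimension n p]

theorem isCoord {Y : Over X} (φ : FormalIso p n Y) :
    IsCoord ((principalParts p).pullback Y.hom) ⊤ φ.coords := by
  refine φ.toPowerSeriesIso.isCoord (fun j => ?_) fun y _ => exists_chart_pullback p n Y.hom y
  rw [← φ.map_ideal]
  exact Ideal.mem_map_of_mem _ (Ideal.subset_span ⟨j, rfl⟩)

theorem iso_eq {Y : Over X} (φ : FormalIso p n Y) (V : Y.left.Opens)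
    (f : MvPowerSeries (Fin n) Γ(Y.left, V)) : φ.iso V le_top f = φ.isCoord.equiv V le_top f := by
  have : φ = ofIsCoord Y φ.isCoord := ext fun j => (coords_ofIsCoord Y φ.isCoord j).symm
  exact congr(($this).iso V le_top f)

/-- Both sides are evaluations of power series at formal coordinates, so compatibility on the
variables implies it for all series. -/
theorem isBaseChange_iff {Y' Y : Over X} (h : Y' ⟶ Y) (φ : FormalIso p n Y)
    (φ' : FormalIso p n Y') : FormalIso.IsBaseChange h φ φ' ↔ ∀ j, φ'.coords j =
      ((principalParts p).pullbackOver h.left (Over.w h)).pull ⊤ ⊤ le_top (φ.coords j) := by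
  constructor
  · intro H j
    have := H ⊤ (MvPowerSeries.X j)
    rw [MvPowerSeries.map_X] at this
    exact this
  · intro H V f
    rw [iso_eq, iso_eq]
    have key := IsCoord.pull_equiv ((principalParts p).pullbackOver h.left (Over.w h)) φ.isCoord
      φ'.isCoord (W := V) le_top (W' := h.left ⁻¹ᵁ V) le_top le_rfl (fun j => ?_) f
    · rw [key, Scheme.Hom.app_eq_appLE]
    · rw [H, TowerHom.pull_res]
      exact (TowerHom.res_pull _ ⊤ ⊤ _ le_top le_top _).symm

/-- The pulled back coordinates are again coordinates and define the inverse image; uniqueness holds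
because coordinates determine a formal isomorphism. -/
theorem exists_isBaseChange {Y' Y : Over X} (h : Y' ⟶ Y) (φ : FormalIso p n Y) :
    ∃! φ' : FormalIso p n Y', FormalIso.IsBaseChange h φ φ' := by
  have H := φ.isCoord.pull ((principalParts p).pullbackOver_isCartesian h.left (Over.w h))
    (V' := ⊤) le_top
  refine ⟨ofIsCoord Y' H, (isBaseChange_iff _ _ _).mpr fun j => coords_ofIsCoord _ _ _,
    fun φ' h' => ext fun j => ?_⟩
  rw [(isBaseChange_iff _ _ _).mp h', coords_ofIsCoord]

end FormalIso

theorem isCoord_iff_formalCoords [IsSeparated p] [SmoothOfRelativeDimension n p] {U : X.Opens}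
    (t : Fin n → (principalParts p).Sections U) :
    IsCoord (principalParts p) U t ↔ (∀ j, t j ∈ (principalParts p).idealZero U) ∧
      ∃ ψ : PowerSeriesIso n (principalParts p) U,
        ∀ j, ψ.iso U le_rfl (MvPowerSeries.X j) = t j := by
  constructor
  · exact fun h => ⟨h.mem_idealZero, h.powerSeriesIso, fun j =>
      (h.equiv_X U le_rfl j).trans (Tower.res_self _ _ _)⟩
  · rintro ⟨h, ψ, hψ⟩
    obtain rfl : _ = t := funext hψ
    refine ψ.isCoord h fun y _ => ?_
    obtain ⟨V, s, hV, -, hs⟩ := exists_chart p n y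
    exact ⟨V, s, hV, hs⟩

end Moduli

/-! ### Cartesian morphisms of towers over open immersions. -/

section OpenImmersion

variable {Y Y' : Scheme.{u}}

theorem isIso_appLE_of_isOpenImmersion (f : Y' ⟶ Y) [IsOpenImmersion f] (V : Y.Opens)
    (hV : V ≤ f.opensRange) (V' : Y'.Opens) (h : V' = f ⁻¹ᵁ V) : IsIso (f.appLE V V' h.le) := by
  subst h
  rw [← Scheme.Hom.app_eq_appLE]
  exact f.isIso_app V hV

variable {h : Y' ⟶ Y} [IsOpenImmersion h] {T : Tower Y} {T' : Tower Y'} {m : TowerHom h T' T}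

theorem TowerHom.IsCartesian.isIso_appLE (hm : m.IsCartesian) (V : Y.Opens)
    (hV : V ≤ h.opensRange) (d : ℕ) :
    IsIso ((m.map d).appLE (T.hom d ⁻¹ᵁ V) (T'.hom d ⁻¹ᵁ (h ⁻¹ᵁ V)) (m.preimage_le le_rfl d)) := by
  have : IsOpenImmersion (m.map d) := MorphismProperty.of_isPullback (hm d).flip ‹_›
  refine isIso_appLE_of_isOpenImmersion _ _ ?_ _ ?_
  · intro z hz
    have h₁ : z ∈ (pullback.fst (T.hom d) h).opensRange := by
      rw [Scheme.Hom.opensRange_pullbackFst]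
      exact hV hz
    obtain ⟨w, rfl⟩ := h₁
    exact ⟨(hm d).isoPullback.inv w, by
      rw [← Scheme.Hom.comp_apply, (hm d).isoPullback_inv_fst]⟩
  · rw [← Scheme.Hom.comp_preimage, ← Scheme.Hom.comp_preimage, m.map_hom]

theorem TowerHom.IsCartesian.pull_bijective (hm : m.IsCartesian) (V : Y.Opens)
    (hV : V ≤ h.opensRange) : Function.Bijective (m.pull V (h ⁻¹ᵁ V) le_rfl) := by
  have hb : ∀ d, Function.Bijective ((m.map d).appLE (T.hom d ⁻¹ᵁ V) (T'.hom d ⁻¹ᵁ (h ⁻¹ᵁ V))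
      (m.preimage_le le_rfl d)) := fun d => by
    have := hm.isIso_appLE V hV d
    exact ConcreteCategory.bijective_of_isIso _
  constructor
  · intro s t hst
    exact Tower.Sections.ext fun d => (hb d).1 congr(T'.proj _ d $hst)
  · intro x
    choose t ht using fun d => (hb d).2 (T'.proj _ d x)
    refine ⟨⟨t, fun d => (hb d).1 ?_⟩, Tower.Sections.ext ht⟩
    rw [ht, ← T'.trans_proj, ← ht, appLE_appLE, appLE_appLE]
    exact appLE_congr (m.trans_map d).symm _ _

/-- Over the image of an open immersion the maps on functions are isomorphisms, at every level of
the tower. Their inverses again form a pushout square, which transports coordinates back. -/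
theorem TowerHom.IsCartesian.isCoord_pull_iff (hm : m.IsCartesian) [∀ d, IsAffineHom (T.hom d)]
    {n : ℕ} (V : Y.Opens) (hV : V ≤ h.opensRange) (s : Fin n → T.Sections V) :
    IsCoord T' (h ⁻¹ᵁ V) (fun j => m.pull V (h ⁻¹ᵁ V) le_rfl (s j)) ↔ IsCoord T V s := by
  refine ⟨fun H d W e => ?_, fun H => H.pull hm le_rfl⟩
  have := hm.isIso_appLE W (e.trans hV) d
  have := isIso_appLE_of_isOpenImmersion h W (e.trans hV) _ rfl
  have w : (T.hom d).app W ≫ (m.map d).appLE (T.hom d ⁻¹ᵁ W) (T'.hom d ⁻¹ᵁ (h ⁻¹ᵁ W))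
      (m.preimage_le le_rfl d) = h.appLE W (h ⁻¹ᵁ W) le_rfl ≫ (T'.hom d).app (h ⁻¹ᵁ W) := by
    rw [Scheme.Hom.app_eq_appLE, Scheme.Hom.app_eq_appLE, Scheme.Hom.appLE_comp_appLE,
      Scheme.Hom.appLE_comp_appLE]
    simp only [m.map_hom]
  have sq : IsPushout ((T.hom d).app W) (h.appLE W (h ⁻¹ᵁ W) le_rfl)
      ((m.map d).appLE (T.hom d ⁻¹ᵁ W) (T'.hom d ⁻¹ᵁ (h ⁻¹ᵁ W)) (m.preimage_le le_rfl d))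
      ((T'.hom d).app (h ⁻¹ᵁ W)) := IsPushout.of_vert_isIso ⟨w⟩
  have sq' : IsPushout ((T'.hom d).app (h ⁻¹ᵁ W)) (inv (h.appLE W (h ⁻¹ᵁ W) le_rfl))
      (inv ((m.map d).appLE (T.hom d ⁻¹ᵁ W) (T'.hom d ⁻¹ᵁ (h ⁻¹ᵁ W)) (m.preimage_le le_rfl d)))
      ((T.hom d).app W) := IsPushout.of_vert_isIso ⟨by
    rw [IsIso.comp_inv_eq, Category.assoc, IsIso.eq_inv_comp, w]⟩
  have H' := (H d (h ⁻¹ᵁ W) (h.preimage_mono e)).of_isPushout sq'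
  convert H' using 1
  funext j
  rw [TowerHom.res_pull, ← TowerHom.pull_res m V W _ e le_rfl, TowerHom.proj_pull]
  exact ((IsIso.hom_inv_id_apply _ _)).symm

end OpenImmersion

/-! ### The Jacobian criterion -/

theorem sum_degLE_one {n : ℕ} {M : Type*} [AddCommMonoid M] (F : (Fin n →₀ ℕ) → M) :
    ∑ α ∈ degLE n 1, F α = F 0 + ∑ k, F (Finsupp.single k 1) := by
  classical
  have h : degLE n 1 = insert 0 (Finset.univ.image fun k : Fin n => Finsupp.single k 1) := by
    ext α
    simp only [mem_degLE, Finset.mem_insert, Finset.mem_image, Finset.mem_univ, true_and]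
    constructor
    · intro hα
      rcases Nat.le_one_iff_eq_zero_or_eq_one.mp hα with h | h
      · exact Or.inl ((Finsupp.degree_eq_zero_iff _).mp h)
      · obtain ⟨k, rfl⟩ := exists_eq_single_of_degree_eq_one h
        exact Or.inr ⟨k, rfl⟩
    · rintro (rfl | ⟨k, rfl⟩) <;> simp
  rw [h, Finset.sum_insert (by simp [Finsupp.single_eq_zero]), Finset.sum_image]
  intro k _ l _ hkl
  exact Finsupp.single_left_injective one_ne_zero hkl

namespace IsCoord

variable {Y : Scheme.{u}} {T : Tower Y} {n : ℕ} {V V' : Y.Opens}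
  {s : Fin n → T.Sections V} {s' : Fin n → T.Sections V'}

/-- Expansions only depend on the restrictions of the coordinates. -/
theorem coeff_congr (hs : IsCoord T V s) (hs' : IsCoord T V' s') (W : Y.Opens) (e : W ≤ V)
    (e' : W ≤ V') (h : ∀ j, T.res e (s j) = T.res e' (s' j)) (α : Fin n →₀ ℕ)
    (x : T.Sections W) : hs.coeff W e α x = hs'.coeff W e' α x := by
  have := hs.coeff_pull T.idHom hs' e e' (W' := W) (W := W) le_rfl
    (fun j => (T.res_self _ _).trans (h j)) α x
  rw [show T.idHom.pull W W _ x = x from T.res_self _ x] at this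
  rw [this]
  exact ((id_appLE _ _).trans (resO_self _ _ _)).symm

theorem coeff_res_coord (hs : IsCoord T V s) {V₁ : Y.Opens} (e₁ : V₁ ≤ V) (W : Y.Opens)
    (e : W ≤ V₁) (α : Fin n →₀ ℕ) (x : T.Sections W) :
    (hs.res e₁).coeff W e α x = hs.coeff W (e.trans e₁) α x :=
  coeff_congr _ _ _ _ _ (fun _ => T.res_res _ _ _) _ _

/-- A functional of order at most one sees, on the augmentation ideal, only the linear Taylor
coefficients. -/
theorem functional_eq_linear (hs : IsCoord T V s)
    (l : T.Sections V →ₗ[Γ(Y, V)] Γ(Y, V)) (hl : ∀ x, T.proj V 1 x = 0 → l x = 0)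
    (x : T.Sections V) (hx : x ∈ T.idealZero V) :
    l x = ∑ k, hs.coeff V le_rfl (Finsupp.single k 1) x * l (s k) := by
  rw [hs.functional_eq_sum V le_rfl l 1 hl x, sum_degLE_one,
    (hs.mem_idealZero_iff V le_rfl x).mp hx, zero_mul, zero_add]
  simp [mono, Finsupp.single_apply]

/-- The chain rule: expanding `s` in `a` and then `a` in `s` shows that the two Jacobian matrices
are inverse to each other. -/
theorem isUnit_det (hs : IsCoord T V s) {a : Fin n → T.Sections V} (ha : IsCoord T V a) :
    IsUnit (Matrix.of fun j k => hs.coeff V le_rfl (Finsupp.single k 1) (a j)).det := by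
  have h : (Matrix.of fun i k => ha.coeff V le_rfl (Finsupp.single k 1) (s i)) *
      (Matrix.of fun j k => hs.coeff V le_rfl (Finsupp.single k 1) (a j)) = 1 := by
    ext i l
    rw [Matrix.mul_apply]
    simp only [Matrix.of_apply]
    rw [← ha.functional_eq_linear (hs.coeff V le_rfl (Finsupp.single l 1)) (fun x hx =>
      (hs.proj_eq_zero_iff V le_rfl x 1).mp hx _ (by simp)) _ (hs.mem_idealZero i)]
    have := hs.coeff_mono V le_rfl (Finsupp.single i 1) (Finsupp.single l 1)
    simp only [mono, Finsupp.single_apply, pow_ite, pow_one, pow_zero, Finset.prod_ite_eq,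
      Finset.mem_univ, if_true, Tower.res_self] at this
    rw [this, Matrix.one_apply]
    simp only [Finsupp.single_left_inj one_ne_zero, eq_comm]
  refine IsUnit.of_mul_eq_one (Matrix.of fun i k => ha.coeff V le_rfl (Finsupp.single k 1) (s i)).det ?_
  rw [mul_comm, ← Matrix.det_mul, h, Matrix.det_one]

/-- The inverse function theorem, reduced to its truncated form by comparing each `a j` with its
linear part. -/
theorem of_isUnit_det (hs : IsCoord T V s) {a : Fin n → T.Sections V}
    (ha : ∀ j, a j ∈ T.idealZero V)
    (h : IsUnit (Matrix.of fun j k => hs.coeff V le_rfl (Finsupp.single k 1) (a j)).det) :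
    IsCoord T V a := by
  intro d W e
  have h₁ := (hs d W e).of_isUnit_det (fun j => T.proj W d (T.res e (a j)))
    ((Matrix.of fun j k => hs.coeff V le_rfl (Finsupp.single k 1) (a j)).map (resO Y e)) (by
      rw [← RingHom.mapMatrix_apply, ← RingHom.map_det]
      exact h.map (resO Y e)) fun i => ?_
  · exact h₁
  obtain ⟨f, hf⟩ := (hs.equiv V le_rfl).surjective (a i)
  have hf₀ : MvPowerSeries.coeff 0 f = 0 := by
    have := (hs.mem_idealZero_iff V le_rfl _).mp (ha i)
    rwa [← hf, coeff_equiv] at this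
  -- `q` is the expansion of `a i` without its linear part; it has no terms of degree below two,
  -- since the constant term of `a i` vanishes.
  let q : MvPowerSeries (Fin n) Γ(Y, W) := MvPowerSeries.map (resO Y e) f -
    ∑ k, MvPowerSeries.C (resO Y e (MvPowerSeries.coeff (Finsupp.single k 1) f)) *
      MvPowerSeries.X k
  have hq : q ∈ idealX n Γ(Y, W) ^ (1 + 1) := by
    classical
    rw [mem_idealX_pow_iff]
    intro α hα
    rcases Nat.le_one_iff_eq_zero_or_eq_one.mp hα with h₀ | h₀
    · obtain rfl := (Finsupp.degree_eq_zero_iff _).mp h₀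
      simp [q, hf₀, -MvPowerSeries.coeff_zero_eq_constantCoeff, MvPowerSeries.coeff_C_mul,
        MvPowerSeries.coeff_zero_X]
    · obtain ⟨l, rfl⟩ := exists_eq_single_of_degree_eq_one h₀
      simp [q, MvPowerSeries.coeff_C_mul, MvPowerSeries.coeff_X, Finsupp.single_left_inj]
  have h₂ := Ideal.mem_map_of_mem ((hs d W e).evalPS) hq
  rw [Ideal.map_pow, idealX, Ideal.map_span, ← Set.range_comp] at h₂
  have h₃ : ((hs d W e).evalPS ∘ fun j => (MvPowerSeries.X j : MvPowerSeries (Fin n) Γ(Y, W))) =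
      fun j => T.proj W d (T.res e (s j)) := funext fun j => (hs d W e).evalPS_X j
  rw [h₃] at h₂
  convert h₂ using 1
  simp only [q, map_sub, map_sum, map_mul, IsTruncBasis.evalPS_C, IsTruncBasis.evalPS_X]
  congr 1
  · rw [← proj_eval hs]
    change _ = T.proj W d (hs.equiv W e _)
    rw [← hf, hs.res_equiv le_rfl e]
  · refine Finset.sum_congr rfl fun k _ => ?_
    rw [Matrix.map_apply, Matrix.of_apply, ← hf, coeff_equiv]

end IsCoord

/-! ### Differential operators in coordinates -/

section DiffOp

variable {S X : Scheme.{u}} {p : X ⟶ S} {n : ℕ} {U : X.Opens}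
  {s : Fin n → (principalParts p).Sections U}

theorem diffOp_ext {δ ε : DiffOp p U} (h : ∀ (W : X.Opens) (hW : W ≤ U) x,
    δ.1 ⟨W, hW⟩ x = ε.1 ⟨W, hW⟩ x) : δ = ε :=
  Subtype.ext (funext fun W => LinearMap.ext fun x => h W.1 W.2 x)

theorem diffOp_sum_apply {ι : Type*} (t : Finset ι) (δ : ι → DiffOp p U)
    (W : {W : X.Opens // W ≤ U}) (x : (principalParts p).Sections W.1) :
    (∑ i ∈ t, δ i).1 W x = ∑ i ∈ t, (δ i).1 W x := by
  let F : DiffOp p U →+ Γ(X, W.1) :=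
    { toFun := fun δ => δ.1 W x
      map_zero' := rfl
      map_add' := fun _ _ => rfl }
  exact map_sum F δ t

/-- The operator that takes a coefficient of the expansion in formal coordinates. -/
def dualOp (hs : IsCoord (principalParts p) U s) (α : Fin n →₀ ℕ) : DiffOp p U :=
  ⟨fun W => hs.coeff W.1 W.2 α, fun _ hV _ e x => hs.coeff_res hV e α x,
    fun _ hx => ⟨U, hx, α.degree, fun W hW _ x h =>
      (hs.proj_eq_zero_iff W hW x _).mp h α le_rfl⟩⟩

theorem dualOp_apply (hs : IsCoord (principalParts p) U s) (α : Fin n →₀ ℕ)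
    (W : X.Opens) (hW : W ≤ U) (x : (principalParts p).Sections W) :
    (dualOp hs α).1 ⟨W, hW⟩ x = hs.coeff W hW α x := rfl

theorem dualOp_mem (hs : IsCoord (principalParts p) U s) {α : Fin n →₀ ℕ} {d : ℕ}
    (h : α.degree ≤ d) : dualOp hs α ∈ diffOpLE p U d := fun W hW x hx =>
  (hs.proj_eq_zero_iff W hW x _).mp hx α h

theorem res_dualOp (hs : IsCoord (principalParts p) U s) (α : Fin n →₀ ℕ) {V : X.Opens}
    (e : V ≤ U) : DiffOp.res p e (dualOp hs α) = dualOp (hs.res e) α :=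
  diffOp_ext fun W hW x => (hs.coeff_res_coord e W hW α x).symm

/-- Operators of bounded order are combinations of coefficient operators. -/
theorem diffOp_eq_sum (hs : IsCoord (principalParts p) U s) {d : ℕ} (δ : DiffOp p U)
    (hδ : δ ∈ diffOpLE p U d) :
    δ = ∑ α ∈ degLE n d, δ.1 ⟨U, le_rfl⟩ (mono s α) • dualOp hs α := by
  refine diffOp_ext fun W hW x => ?_
  rw [diffOp_sum_apply, hs.functional_eq_sum W hW (δ.1 ⟨W, hW⟩) d (hδ W hW)]
  refine Finset.sum_congr rfl fun α _ => ?_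
  have : mono (fun j => (principalParts p).res hW (s j)) α =
      (principalParts p).res hW (mono s α) := (map_mono _ _ _).symm
  rw [this, δ.2.1 U le_rfl W hW, mul_comm]
  rfl

/-- Operators have only locally bounded order; compactness turns finitely many local bounds into a
global one. -/
theorem exists_mem_diffOpLE (hU : IsCompact (U : Set X)) (δ : DiffOp p U) :
    ∃ d, δ ∈ diffOpLE p U d := by
  choose V hV d hd using δ.2.2
  obtain ⟨t, ht⟩ := hU.elim_finite_subcover (fun x : U => (V x.1 x.2 : Set X))
    (fun x => (V x.1 x.2).2) fun x hx => Set.mem_iUnion.mpr ⟨⟨x, hx⟩, hV x hx⟩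
  refine ⟨t.sup fun x => d x.1 x.2, fun W hW x hx => ext_of_resO fun y hy => ?_⟩
  obtain ⟨z, hz, hyz⟩ := Set.mem_iUnion₂.mp (ht (hW hy))
  refine ⟨W ⊓ V z.1 z.2, inf_le_left, ⟨hy, hyz⟩, ?_⟩
  rw [map_zero, ← δ.2.1 W hW _ inf_le_left]
  refine hd z.1 z.2 _ _ inf_le_right _ ?_
  rw [Tower.proj_res, (principalParts p).proj_eq_zero_of_le W
    (Finset.le_sup (f := fun x : U => d x.1 x.2) hz) x hx, map_zero]

/-- The coefficient operators are a basis of the differential operators. -/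
def dualBasis (hs : IsCoord (principalParts p) U s) (hU : IsCompact (U : Set X)) :
    Module.Basis (Fin n →₀ ℕ) Γ(X, U) (DiffOp p U) :=
  Module.Basis.mk (v := dualOp hs) (by
    rw [linearIndependent_iff']
    intro t c hc β hβ
    have h₁ : (∑ α ∈ t, c α • dualOp hs α).1 ⟨U, le_rfl⟩ (mono s β) = 0 := by
      rw [hc]
      rfl
    have h₂ : ∀ α, (c α • dualOp hs α).1 ⟨U, le_rfl⟩ (mono s β) = if α = β then c α else 0 := by
      intro α
      have h₃ := hs.coeff_mono U le_rfl β α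
      simp only [Tower.res_self] at h₃
      change resO X le_rfl (c α) * hs.coeff U le_rfl α (mono s β) = _
      rw [resO_self, h₃, mul_ite, mul_one, mul_zero]
    rw [diffOp_sum_apply, Finset.sum_congr rfl fun α _ => h₂ α, Finset.sum_ite_eq' t β c,
      if_pos hβ] at h₁
    exact h₁) (fun δ _ => by
    obtain ⟨d, hd⟩ := exists_mem_diffOpLE hU δ
    rw [diffOp_eq_sum hs δ hd]
    exact Submodule.sum_mem _ fun α _ => Submodule.smul_mem _ _ (Submodule.subset_span ⟨α, rfl⟩))

theorem dualBasis_apply (hs : IsCoord (principalParts p) U s) (hU : IsCompact (U : Set X))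
    (α : Fin n →₀ ℕ) : dualBasis hs hU α = dualOp hs α :=
  Module.Basis.mk_apply _ _ _

end DiffOp

/-! ### Morphisms to the relative spectrum and sections of principal parts -/

section Correspondence

variable {S X : Scheme.{u}} {p : X ⟶ S} {n : ℕ}

namespace SymSpec

variable (A : SymSpec p n)

/-- The function `coord` as a semilinear map. -/
def coordHom (U : X.Opens) (j : Fin n) : DiffOp p U →ₛₗ[(A.π.app U).hom] Γ(A.E, A.π ⁻¹ᵁ U) :=
  (A.taut U).comp ((LinearMap.single _ (fun _ : Fin n => DiffOpModO p U) j).comp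
    (DiffOpModO.mk p U))

theorem coordHom_apply (U : X.Opens) (j : Fin n) (δ : DiffOp p U) :
    A.coordHom U j δ = A.coord U δ j := rfl

theorem coord_eq_zero (U : X.Opens) (j : Fin n) {δ : DiffOp p U} (h : δ ∈ diffOpLE p U 0) :
    A.coord U δ j = 0 := by
  rw [coord, show DiffOpModO.mk p U δ = 0 from (Submodule.Quotient.mk_eq_zero _).mpr h,
    Pi.single_zero, map_zero]

theorem resO_coord {U V : X.Opens} (e : V ≤ U) (j : Fin n) (δ : DiffOp p U) :
    resO A.E (A.π.preimage_mono e) (A.coord U δ j) = A.coord V (DiffOp.res p e δ) j := by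
  have h := A.taut_res U V e (Pi.single j δ)
  have h₁ : ∀ (W : X.Opens) (ε : DiffOp p W), (Pi.single j (DiffOpModO.mk p W ε) :
      Fin n → DiffOpModO p W) = fun i => DiffOpModO.mk p W ((Pi.single j ε : Fin n → _) i) := by
    intro W ε
    funext i
    exact (Pi.apply_single (fun _ => DiffOpModO.mk p W) (fun _ => map_zero _) j ε i).symm
  have h₂ : (fun i => DiffOpModO.mk p V (DiffOp.res p e ((Pi.single j δ : Fin n → _) i))) =
      fun i => DiffOpModO.mk p V ((Pi.single j (DiffOp.res p e δ) : Fin n → _) i) := by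
    funext i
    congr 1
    exact Pi.apply_single (fun _ => DiffOp.res p e) (fun _ => rfl) j δ i
  rw [h₂] at h
  rw [coord, coord, h₁, h₁]
  exact h.symm

/-- By linearity the coordinate functions of all operators are controlled by those of the
coefficient operators. -/
theorem coord_eq_sum {U : X.Opens} {s : Fin n → (principalParts p).Sections U}
    (hs : IsCoord (principalParts p) U s) {d : ℕ} {δ : DiffOp p U} (hδ : δ ∈ diffOpLE p U d)
    (j : Fin n) : A.coord U δ j =
      ∑ α ∈ degLE n d, A.π.app U (δ.1 ⟨U, le_rfl⟩ (mono s α)) * A.coord U (dualOp hs α) j := by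
  rw [← coordHom_apply]
  conv_lhs => rw [diffOp_eq_sum hs δ hδ]
  rw [map_sum]
  refine Finset.sum_congr rfl fun α _ => ?_
  rw [LinearMap.map_smulₛₗ]
  rfl

end SymSpec

/-- The pullback of formal coordinates. -/
theorem IsCoord.pb [IsSeparated p] {U : X.Opens} {s : Fin n → (principalParts p).Sections U}
    (hs : IsCoord (principalParts p) U s) {Y : Scheme.{u}} (g : Y ⟶ X) :
    IsCoord ((principalParts p).pullback g) (g ⁻¹ᵁ U)
      (fun j => ((principalParts p).pullbackSnd g).pull U (g ⁻¹ᵁ U) le_rfl (s j)) :=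
  hs.pull ((principalParts p).pullbackSnd_isCartesian g) le_rfl

theorem le_preimage_of_comp_eq {Y X E : Scheme.{u}} {f : Y ⟶ E} {π : E ⟶ X} {g : Y ⟶ X}
    (w : f ≫ π = g) {U : X.Opens} {W : Y.Opens} (e : W ≤ g ⁻¹ᵁ U) : W ≤ f ⁻¹ᵁ (π ⁻¹ᵁ U) := by
  subst w
  exact e

variable [IsSeparated p] {A : SymSpec p n} {Y : Scheme.{u}} {g : Y ⟶ X} {f : Y ⟶ A.E}

/-- The section `x` of the inverse image of the principal parts corresponds, in the chart `s`, to
the `j`-th component of the morphism `f` to the relative spectrum. -/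
def CorrAt (w : f ≫ A.π = g) {U : X.Opens} {s : Fin n → (principalParts p).Sections U}
    (hs : IsCoord (principalParts p) U s) {W : Y.Opens} (e : W ≤ g ⁻¹ᵁ U) (j : Fin n)
    (x : ((principalParts p).pullback g).Sections W) : Prop :=
  ∀ α, (hs.pb g).coeff W e α x =
    f.appLE (A.π ⁻¹ᵁ U) W (le_preimage_of_comp_eq w e) (A.coord U (dualOp hs α) j)

namespace CorrAt

variable {w : f ≫ A.π = g} {U U' : X.Opens} {s : Fin n → (principalParts p).Sections U}
    {hs : IsCoord (principalParts p) U s} {s' : Fin n → (principalParts p).Sections U'}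
    {W : Y.Opens} {e : W ≤ g ⁻¹ᵁ U} {j : Fin n}
    {x : ((principalParts p).pullback g).Sections W}

theorem res (h : CorrAt w hs e j x) {W' : Y.Opens} (e' : W' ≤ W) :
    CorrAt w hs (e'.trans e) j (((principalParts p).pullback g).res e' x) := by
  intro α
  rw [IsCoord.coeff_res (hs.pb g) e e' α x, h α, resO_appLE]

theorem of_local (h : ∀ y ∈ W, ∃ (W' : Y.Opens) (e' : W' ≤ W), y ∈ W' ∧
    CorrAt w hs (e'.trans e) j (((principalParts p).pullback g).res e' x)) :
    CorrAt w hs e j x := by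
  intro α
  refine ext_of_resO fun y hy => ?_
  obtain ⟨W', e', hy', h'⟩ := h y hy
  refine ⟨W', e', hy', ?_⟩
  rw [← IsCoord.coeff_res (hs.pb g) e e' α x, h' α, resO_appLE]

theorem eq {x' : ((principalParts p).pullback g).Sections W} (h : CorrAt w hs e j x)
    (h' : CorrAt w hs e j x') : x = x' :=
  (hs.pb g).ext_coeff W e fun α => (h α).trans (h' α).symm

theorem exists_section (w : f ≫ A.π = g) (hs : IsCoord (principalParts p) U s)
    (e : W ≤ g ⁻¹ᵁ U) (j : Fin n) : ∃ x, CorrAt w hs e j x :=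
  ⟨(hs.pb g).equiv W e (psMk fun α => f.appLE (A.π ⁻¹ᵁ U) W (le_preimage_of_comp_eq w e)
    (A.coord U (dualOp hs α) j)), fun α => by rw [IsCoord.coeff_equiv, coeff_psMk]⟩

theorem res_chart_iff (w : f ≫ A.π = g) (hs : IsCoord (principalParts p) U s)
    (eU : U' ≤ U) (e : W ≤ g ⁻¹ᵁ U') (j : Fin n)
    (x : ((principalParts p).pullback g).Sections W) :
    CorrAt w (hs.res eU) e j x ↔ CorrAt w hs (e.trans (g.preimage_mono eU)) j x := by
  refine forall_congr' fun α => ?_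
  rw [IsCoord.coeff_congr ((hs.res eU).pb g) (hs.pb g) W e (e.trans (g.preimage_mono eU))
    (fun j => by rw [TowerHom.res_pull, TowerHom.res_pull, TowerHom.pull_res]),
    ← res_dualOp, ← A.resO_coord eU, appLE_resO]

/-- Two linear expansions have the same matrix. The functional "coefficient `β` in `s'`" is expanded
over the monomials in `s`, and the operator `dualOp hs' β` over the operators `dualOp hs α`; both
times the entries are the values of that operator on `s^α`. -/
theorem change_chart (h : CorrAt w hs e j x) {s' : Fin n → (principalParts p).Sections U}
    (hs' : IsCoord (principalParts p) U s') : CorrAt w hs' e j x := by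
  intro β
  have h₁ := (hs.pb g).functional_eq_sum W e ((hs'.pb g).coeff W e β) β.degree
    (fun x hx => ((hs'.pb g).proj_eq_zero_iff W e x _).mp hx β le_rfl) x
  have h₂ : ∀ α, (hs'.pb g).coeff W e β (mono (fun j => ((principalParts p).pullback g).res e
      (((principalParts p).pullbackSnd g).pull U (g ⁻¹ᵁ U) le_rfl (s j))) α) =
        g.appLE U W e (hs'.coeff U le_rfl β (mono s α)) := by
    intro α
    rw [← IsCoord.coeff_pull ((principalParts p).pullbackSnd g) hs' (hs'.pb g) le_rfl e e
      (fun j => by rw [TowerHom.res_pull, Tower.res_self]), map_mono]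
    simp only [TowerHom.res_pull]
  rw [h₁, A.coord_eq_sum hs (dualOp_mem hs' le_rfl), map_sum]
  refine Finset.sum_congr rfl fun α _ => ?_
  rw [h₂, h α, map_mul, mul_comm, dualOp_apply, app_eq_appLE, appLE_appLE]
  congr 1
  exact appLE_congr w.symm _ _

/-- Both charts are restricted to the intersection of their domains and compared there. -/
theorem change (h : CorrAt w hs e j x) (hs' : IsCoord (principalParts p) U' s')
    (e' : W ≤ g ⁻¹ᵁ U') : CorrAt w hs' e' j x := by
  have e'' : W ≤ g ⁻¹ᵁ (U ⊓ U') := le_inf e e'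
  exact (res_chart_iff w hs' inf_le_right e'' j x).mp
    (((res_chart_iff w hs inf_le_left e'' j x).mpr h).change_chart (hs'.res inf_le_right))

theorem coord_eq (h : CorrAt w hs e j x) {δ : DiffOp p U} {d : ℕ} (hδ : δ ∈ diffOpLE p U d) :
    f.appLE (A.π ⁻¹ᵁ U) W (le_preimage_of_comp_eq w e) (A.coord U δ j) = ∑ α ∈ degLE n d,
      g.appLE U W e (δ.1 ⟨U, le_rfl⟩ (mono s α)) * (hs.pb g).coeff W e α x := by
  rw [A.coord_eq_sum hs hδ, map_sum]
  refine Finset.sum_congr rfl fun α _ => ?_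
  rw [h α, map_mul, app_eq_appLE, appLE_appLE]
  congr 1
  exact appLE_congr w _ _

/-- The constant coefficient is dual to an operator of order zero, whose class modulo `𝒪_X` is
trivial. -/
theorem mem_idealZero (h : CorrAt w hs e j x) :
    x ∈ ((principalParts p).pullback g).idealZero W := by
  rw [(hs.pb g).mem_idealZero_iff W e, h 0, A.coord_eq_zero U j (dualOp_mem hs (by simp)), map_zero]

theorem pull (h : CorrAt w hs e j x) {Y' : Scheme.{u}} {g' : Y' ⟶ X} (k : Y' ⟶ Y)
    (wg : k ≫ g = g') {f' : Y' ⟶ A.E} (wf : k ≫ f = f') {W' : Y'.Opens} (e' : W' ≤ k ⁻¹ᵁ W)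
    (e'' : W' ≤ g' ⁻¹ᵁ U) (w' : f' ≫ A.π = g') :
    CorrAt w' hs e'' j (((principalParts p).pullbackOver k wg).pull W W' e' x) := by
  intro α
  rw [IsCoord.coeff_pull ((principalParts p).pullbackOver k wg) (hs.pb g) (hs.pb g') e e'' e'
    (fun j => by
      rw [TowerHom.res_pull, TowerHom.res_pull]
      exact (principalParts p).pullbackOver_pullbackSnd k wg U W W' e e' (s j)), h α, appLE_appLE]
  exact appLE_congr wf _ _

end CorrAt

/-- The sequence `a` of global sections corresponds to the morphism `f`. -/
def Corr (w : f ≫ A.π = g) (a : Fin n → ((principalParts p).pullback g).Sections ⊤) : Prop :=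
  ∀ (U : X.Opens) (s : Fin n → (principalParts p).Sections U)
    (hs : IsCoord (principalParts p) U s) (j : Fin n),
    CorrAt w hs (le_refl (g ⁻¹ᵁ U)) j (((principalParts p).pullback g).res le_top (a j))

namespace Corr

theorem corrAt {w : f ≫ A.π = g} {a : Fin n → ((principalParts p).pullback g).Sections ⊤}
    (h : Corr w a) {U : X.Opens} {s : Fin n → (principalParts p).Sections U}
    (hs : IsCoord (principalParts p) U s) {W : Y.Opens} (e : W ≤ g ⁻¹ᵁ U) (j : Fin n) :
    CorrAt w hs e j (((principalParts p).pullback g).res le_top (a j)) := by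
  have := (h U s hs j).res e
  rwa [Tower.res_res] at this

theorem pull {w : f ≫ A.π = g} {a : Fin n → ((principalParts p).pullback g).Sections ⊤}
    (h : Corr w a) {Y' : Scheme.{u}} {g' : Y' ⟶ X} (k : Y' ⟶ Y) (wg : k ≫ g = g')
    {f' : Y' ⟶ A.E} (wf : k ≫ f = f') (w' : f' ≫ A.π = g') :
    Corr w' (fun j => ((principalParts p).pullbackOver k wg).pull ⊤ ⊤ le_top (a j)) := by
  intro U s hs j
  have e' : g' ⁻¹ᵁ U ≤ k ⁻¹ᵁ (g ⁻¹ᵁ U) := by rw [← Scheme.Hom.comp_preimage, wg]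
  have := (h U s hs j).pull k wg wf e' le_rfl w'
  rw [TowerHom.pull_res] at this
  convert this using 1
  exact TowerHom.res_pull _ ⊤ ⊤ _ le_top le_top _

variable [SmoothOfRelativeDimension n p]

theorem eq {w : f ≫ A.π = g} {a a' : Fin n → ((principalParts p).pullback g).Sections ⊤}
    (h : Corr w a) (h' : Corr w a') : a = a' := by
  funext j
  refine Tower.ext_of_res _ fun y _ => ?_
  obtain ⟨U, s, hU, -, hs⟩ := exists_chart p n (g y)
  exact ⟨g ⁻¹ᵁ U, le_top, hU, (h U s hs j).eq (h' U s hs j)⟩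

/-- In each chart the Taylor coefficients are prescribed and arbitrary, so a unique section exists;
independence of the chart makes these sections glue. -/
theorem exists_sections (w : f ≫ A.π = g) : ∃ a, Corr w a := by
  have key : ∀ j, ∃ x : ((principalParts p).pullback g).Sections ⊤,
      ∀ (U : X.Opens) (s : Fin n → (principalParts p).Sections U)
      (hs : IsCoord (principalParts p) U s),
      CorrAt w hs (le_refl (g ⁻¹ᵁ U)) j (((principalParts p).pullback g).res le_top x) := by
    intro j
    choose U s hU _ hs using exists_chart p n
    choose x hx using fun z => CorrAt.exists_section w (hs z) (le_refl (g ⁻¹ᵁ U z)) j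
    obtain ⟨a, ha⟩ := ((principalParts p).pullback g).exists_glue (fun z => g ⁻¹ᵁ U z) ⊤
      (fun _ => le_top) (fun y _ => ⟨g y, hU _⟩) x fun z z' W e e' =>
        ((hx z).res e).eq (((hx z').res e').change (hs z) e)
    refine ⟨a, fun V t ht => CorrAt.of_local fun y hy => ?_⟩
    refine ⟨g ⁻¹ᵁ V ⊓ g ⁻¹ᵁ U (g y), inf_le_left, ⟨hy, hU _⟩, ?_⟩
    rw [Tower.res_res]
    have := ((hx (g y)).res (inf_le_right (a := g ⁻¹ᵁ V))).change ht inf_le_left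
    rwa [← ha, Tower.res_res] at this
  choose a ha using key
  exact ⟨a, fun U s hs j => ha j U s hs⟩

end Corr

end Correspondence

/-! ### Morphisms to the relative spectrum -/

section SchemeMorphisms

variable {Y E : Scheme.{u}}

theorem ι_comp_eq_of_appLE_eq {f f' : Y ⟶ E} {W : Y.Opens} {V : E.Opens} (hV : IsAffineOpen V)
    (e : W ≤ f ⁻¹ᵁ V) (e' : W ≤ f' ⁻¹ᵁ V) (h : f.appLE V W e = f'.appLE V W e') :
    W.ι ≫ f = W.ι ≫ f' := by
  have : IsAffine _ := hV
  rw [← f.resLE_comp_ι e, ← f'.resLE_comp_ι e']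
  congr 1
  refine ext_of_isAffine ?_
  rw [Scheme.Hom.appTop, Scheme.Hom.appTop, Scheme.Hom.resLE_app_top, Scheme.Hom.resLE_app_top, h]

theorem hom_ext_of_opens {f f' : Y ⟶ E} {ι : Type u} (W : ι → Y.Opens) (hW : ∀ y, ∃ i, y ∈ W i)
    (h : ∀ i, (W i).ι ≫ f = (W i).ι ≫ f') : f = f' :=
  (Y.openCoverOfIsOpenCover W (top_le_iff.mp fun y _ => by simpa using hW y)).hom_ext _ _ h

/-- This is the adjunction between `Spec` and global sections, with target an affine open subscheme.
-/
theorem exists_appLE_eq {V : E.Opens} (hV : IsAffineOpen V) (χ : Γ(E, V) ⟶ Γ(Y, ⊤)) :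
    ∃ (f : Y ⟶ E) (e : ⊤ ≤ f ⁻¹ᵁ V), f.appLE V ⊤ e = χ := by
  have e : ⊤ ≤ (Y.toSpecΓ ≫ Spec.map χ ≫ hV.fromSpec) ⁻¹ᵁ V := by
    rw [Scheme.Hom.comp_preimage, Scheme.Hom.comp_preimage, hV.fromSpec_preimage_self]
    exact le_rfl
  refine ⟨Y.toSpecΓ ≫ Spec.map χ ≫ hV.fromSpec, e, ?_⟩
  have h₁ : hV.fromSpec.appLE V ⊤ hV.fromSpec_preimage_self.ge =
      (Scheme.ΓSpecIso Γ(E, V)).inv := by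
    rw [Scheme.Hom.appLE, hV.fromSpec_app_self, Category.assoc, ← Functor.map_comp]
    exact (congrArg _ (CategoryTheory.Functor.map_id _ _)).trans (Category.comp_id _)
  have e' : ⊤ ≤ (Spec.map χ ≫ hV.fromSpec) ⁻¹ᵁ V := by
    rw [Scheme.Hom.comp_preimage, hV.fromSpec_preimage_self]
    exact le_rfl
  rw [← Scheme.Hom.appLE_comp_appLE Y.toSpecΓ (Spec.map χ ≫ hV.fromSpec) V ⊤ ⊤ e' le_top,
    ← Scheme.Hom.appLE_comp_appLE (Spec.map χ) hV.fromSpec V ⊤ ⊤ hV.fromSpec_preimage_self.ge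
      le_top, h₁]
  have h₂ : (Spec.map χ).appLE ⊤ ⊤ le_top = (Spec.map χ).appTop := by
    rw [Scheme.Hom.appTop, Scheme.Hom.app_eq_appLE]
    rfl
  have h₃ : Y.toSpecΓ.appLE ⊤ ⊤ le_top = Y.toSpecΓ.appTop := by
    rw [Scheme.Hom.appTop, Scheme.Hom.app_eq_appLE]
    rfl
  rw [h₂, h₃, Scheme.toSpecΓ_appTop, ← Scheme.ΓSpecIso_inv_naturality, Category.assoc,
    Iso.inv_hom_id, Category.comp_id]

end SchemeMorphisms

/-! ### Construction and uniqueness of the morphism attached to sections. -/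

section Correspondence

variable {S X : Scheme.{u}} {p : X ⟶ S} {n : ℕ} {A : SymSpec p n}

theorem SymSpec.ringHom_ext {U : X.Opens} (hU : IsAffineOpen U) {B : Type u} [CommRing B]
    {F F' : Γ(A.E, A.π ⁻¹ᵁ U) →+* B} (h : ∀ r, F (A.π.app U r) = F' (A.π.app U r))
    (h' : ∀ δ j, F (A.coord U δ j) = F' (A.coord U δ j)) : F = F' := by
  obtain ⟨ψ, hψ, hψ'⟩ := A.isSymmetricAlgebra U hU
  have key : ∀ x, F (ψ x) = F' (ψ x) := by
    intro x
    induction x using SymmetricAlgebra.induction with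
    | algebraMap r => rw [hψ, h]
    | ι m =>
      rw [hψ', ← Finset.univ_sum_single m, map_sum, map_sum, map_sum]
      refine Finset.sum_congr rfl fun j _ => ?_
      obtain ⟨δ, hδ⟩ := Submodule.mkQ_surjective _ (m j)
      rw [← hδ]
      exact h' δ j
    | mul x y hx hy => rw [map_mul, map_mul, map_mul, hx, hy]
    | add x y hx hy => rw [map_add, map_add, map_add, hx, hy]
  ext x
  obtain ⟨y, rfl⟩ := ψ.surjective x
  exact key y

variable [IsSeparated p] {Y : Scheme.{u}} {g : Y ⟶ X}

/-- Over a chart `E` is affine with ring generated by functions on the base and coordinate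
functions. The former pull back through `g`, the latter are determined by the Taylor coefficients of
`a`. -/
theorem Corr.hom_eq [SmoothOfRelativeDimension n p] {f f' : Y ⟶ A.E} {w : f ≫ A.π = g}
    {w' : f' ≫ A.π = g}
    {a : Fin n → ((principalParts p).pullback g).Sections ⊤} (h : Corr w a) (h' : Corr w' a) :
    f = f' := by
  choose U s hU hUa hs using exists_chart p n
  refine hom_ext_of_opens (fun y => g ⁻¹ᵁ U (g y)) (fun y => ⟨y, hU _⟩) fun y => ?_
  have := A.isAffineHom
  refine ι_comp_eq_of_appLE_eq ((hUa (g y)).preimage A.π) (le_preimage_of_comp_eq w le_rfl)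
    (le_preimage_of_comp_eq w' le_rfl) ?_
  ext1
  refine SymSpec.ringHom_ext (hUa (g y)) (fun r => ?_) fun δ j => ?_
  · change f.appLE _ _ _ (A.π.app _ r) = f'.appLE _ _ _ (A.π.app _ r)
    rw [app_eq_appLE, appLE_appLE, appLE_appLE]
    exact appLE_congr (w.trans w'.symm) _ _
  · obtain ⟨d, hd⟩ := exists_mem_diffOpLE (hUa (g y)).isCompact δ
    exact ((h _ _ (hs (g y)) j).coord_eq hd).trans ((h' _ _ (hs (g y)) j).coord_eq hd).symm

/-- The coefficient operators form a basis, so the Taylor coefficients of `a j` define a linear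
functional on operators; the universal property of the symmetric algebra turns these into a ring
homomorphism, hence into a morphism. -/
theorem exists_hom_of_chart {U : X.Opens} (hU : IsAffineOpen U)
    {s : Fin n → (principalParts p).Sections U} (hs : IsCoord (principalParts p) U s)
    (hg : ⊤ ≤ g ⁻¹ᵁ U) (A : SymSpec p n) {a : Fin n → ((principalParts p).pullback g).Sections ⊤}
    (ha : ∀ j, a j ∈ ((principalParts p).pullback g).idealZero ⊤) :
    ∃ (f : Y ⟶ A.E) (w : f ≫ A.π = g), Corr w a := by
  let : Algebra Γ(X, U) Γ(Y, ⊤) := (g.appLE U ⊤ hg).hom.toAlgebra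
  let L (j : Fin n) : DiffOp p U →ₗ[Γ(X, U)] Γ(Y, ⊤) :=
    (dualBasis hs hU.isCompact).constr Γ(X, U) fun α => (hs.pb g).coeff ⊤ hg α (a j)
  have hL : ∀ j α, L j (dualOp hs α) = (hs.pb g).coeff ⊤ hg α (a j) := fun j α => by
    rw [← dualBasis_apply hs hU.isCompact]
    exact Module.Basis.constr_basis _ _ _ _
  -- The functional descends to `𝒟_X / 𝒪_X` because the constant coefficient of `a j` vanishes.
  have hL₀ : ∀ j, diffOpLE p U 0 ≤ LinearMap.ker (L j) := by
    intro j δ hδ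
    rw [LinearMap.mem_ker, diffOp_eq_sum hs δ hδ, map_sum]
    refine Finset.sum_eq_zero fun α hα => ?_
    obtain rfl : α = 0 := (Finsupp.degree_eq_zero_iff _).mp (Nat.le_zero.mp (mem_degLE.mp hα))
    rw [map_smul, hL, ((hs.pb g).mem_idealZero_iff ⊤ hg _).mp (ha j), smul_zero]
  let M : (Fin n → DiffOpModO p U) →ₗ[Γ(X, U)] Γ(Y, ⊤) :=
    ∑ j, ((diffOpLE p U 0).liftQ (L j) (hL₀ j)).comp (LinearMap.proj j)
  have hM : ∀ j δ, M (Pi.single j (DiffOpModO.mk p U δ)) = L j δ := by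
    intro j δ
    simp only [M, LinearMap.sum_apply, LinearMap.comp_apply, LinearMap.proj_apply]
    rw [Finset.sum_eq_single j]
    · rw [Pi.single_eq_same]
      exact Submodule.liftQ_apply _ _ _
    · intro k _ hk
      rw [Pi.single_eq_of_ne hk, map_zero]
    · intro h
      exact absurd (Finset.mem_univ j) h
  obtain ⟨ψ, hψ, hψ'⟩ := A.isSymmetricAlgebra U hU
  let χ : Γ(A.E, A.π ⁻¹ᵁ U) →+* Γ(Y, ⊤) :=
    (SymmetricAlgebra.lift M).toRingHom.comp ψ.symm.toRingHom
  have hχ : ∀ r, χ (A.π.app U r) = g.appLE U ⊤ hg r := by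
    intro r
    change SymmetricAlgebra.lift M (ψ.symm _) = _
    rw [← hψ, RingEquiv.symm_apply_apply, AlgHom.commutes]
    rfl
  have hχ' : ∀ j α, χ (A.coord U (dualOp hs α) j) = (hs.pb g).coeff ⊤ hg α (a j) := by
    intro j α
    change SymmetricAlgebra.lift M (ψ.symm _) = _
    rw [SymSpec.coord, ← hψ', RingEquiv.symm_apply_apply, SymmetricAlgebra.lift_ι_apply, hM, hL]
  have := A.isAffineHom
  obtain ⟨f, e, hf⟩ := exists_appLE_eq (hU.preimage A.π) (CommRingCat.ofHom χ)
  have w : f ≫ A.π = g := by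
    refine hom_ext_of_opens (fun _ : PUnit => ⊤) (fun y => ⟨⟨⟩, trivial⟩) fun _ => ?_
    refine ι_comp_eq_of_appLE_eq hU e hg ?_
    ext r
    rw [← hχ, app_eq_appLE, ← appLE_appLE f A.π U (A.π ⁻¹ᵁ U) ⊤ le_rfl e, hf]
    rfl
  refine ⟨f, w, fun U' s' hs' j => ?_⟩
  have h₁ : CorrAt w hs hg j (a j) := by
    intro α
    rw [← hχ', hf]
    rfl
  exact (h₁.res le_top).change hs' le_rfl

/-- Local morphisms agree on overlaps, since there they correspond to the same sections, and so they
glue. -/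
theorem exists_hom [SmoothOfRelativeDimension n p] (A : SymSpec p n)
    {a : Fin n → ((principalParts p).pullback g).Sections ⊤}
    (ha : ∀ j, a j ∈ ((principalParts p).pullback g).idealZero ⊤) :
    ∃ (f : Y ⟶ A.E) (w : f ≫ A.π = g), Corr w a := by
  choose U s hU hUa hs using exists_chart p n
  let W (y : Y) : Y.Opens := g ⁻¹ᵁ U (g y)
  let b (y : Y) (j : Fin n) : ((principalParts p).pullback ((W y).ι ≫ g)).Sections ⊤ :=
    ((principalParts p).pullbackOver (W y).ι rfl).pull ⊤ ⊤ le_top (a j)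
  have hb : ∀ y j, b y j ∈ ((principalParts p).pullback ((W y).ι ≫ g)).idealZero ⊤ := by
    intro y j
    exact TowerHom.proj_pull_eq_zero _ _ _ _ _ _ (ha j)
  choose f w hf using fun y => exists_hom_of_chart (hUa (g y)) (hs (g y)) (g := (W y).ι ≫ g)
    (by rw [Scheme.Hom.comp_preimage]; simp [W]) A (hb y)
  have overlap : ∀ y z : Y, pullback.fst (W y).ι (W z).ι ≫ f y =
      pullback.snd (W y).ι (W z).ι ≫ f z := by
    intro y z
    have hyz : pullback.snd (W y).ι (W z).ι ≫ (W z).ι ≫ g =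
        pullback.fst (W y).ι (W z).ι ≫ (W y).ι ≫ g := by
      rw [← Category.assoc, ← pullback.condition, Category.assoc]
    have h₁ := (hf y).pull (pullback.fst (W y).ι (W z).ι) rfl rfl (by rw [Category.assoc, w])
    have h₂ := (hf z).pull (pullback.snd (W y).ι (W z).ι) hyz rfl (by rw [Category.assoc, w, hyz])
    refine Corr.hom_eq h₁ (a := _) (w' := by rw [Category.assoc, w, hyz]) ?_
    convert h₂ using 2 with j
    have e₁ := (principalParts p).pullbackOver_pullbackOver (W y).ι (rfl : (W y).ι ≫ g = _)
      (pullback.fst (W y).ι (W z).ι) rfl _ rfl (Category.assoc _ _ _) ⊤ ⊤ ⊤ le_top le_top le_top (a j)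
    have e₂ := (principalParts p).pullbackOver_pullbackOver (W z).ι (rfl : (W z).ι ≫ g = _)
      (pullback.snd (W y).ι (W z).ι) hyz _ pullback.condition.symm
      (Category.assoc _ _ _) ⊤ ⊤ ⊤ le_top le_top le_top (a j)
    exact e₁.trans e₂.symm
  let 𝒰 := Y.openCoverOfIsOpenCover W (top_le_iff.mp fun y _ => by simpa using ⟨y, hU (g y)⟩)
  let F : Y ⟶ A.E := 𝒰.glueMorphisms f overlap
  have hF : ∀ y, (W y).ι ≫ F = f y := fun y => 𝒰.ι_glueMorphisms f _ y
  have wF : F ≫ A.π = g := hom_ext_of_opens W (fun y => ⟨y, hU _⟩) fun y => by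
    rw [← Category.assoc, hF, w]
  -- The glued morphism has some corresponding sections `a'`; uniqueness on the members of the cover
  -- identifies them with `a`.
  obtain ⟨a', ha'⟩ := Corr.exists_sections wF
  have : a' = a := by
    funext j
    refine Tower.ext_of_res _ fun y _ => ⟨W y, le_top, hU _, ?_⟩
    have h₁ := (ha'.pull (W y).ι rfl (hF y) (w y)).eq (hf y)
    have h₂ := congrFun h₁ j
    have hc := ((principalParts p).pullbackOver_isCartesian (W y).ι
      (rfl : (W y).ι ≫ g = _)).pull_bijective (W y) (by simp)
    refine hc.1 ?_
    rw [TowerHom.pull_res, TowerHom.pull_res]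
    have h₃ := congrArg (((principalParts p).pullback ((W y).ι ≫ g)).res
      (le_top : (W y).ι ⁻¹ᵁ W y ≤ ⊤)) h₂
    refine ((TowerHom.res_pull _ ⊤ ⊤ _ le_top le_top _).symm.trans h₃).trans ?_
    exact TowerHom.res_pull _ ⊤ ⊤ _ le_top le_top _
  exact ⟨F, wF, this ▸ ha'⟩

end Correspondence

/-! ### The moduli space -/

section Moduli

variable {S X : Scheme.{u}} {p : X ⟶ S} {n : ℕ} {A : SymSpec p n}

theorem SymSpec.coord_eq_linear {U : X.Opens} {s : Fin n → (principalParts p).Sections U}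
    (hs : IsCoord (principalParts p) U s) {δ : DiffOp p U} (hδ : δ ∈ diffOpLE p U 1)
    (j : Fin n) : A.coord U δ j = ∑ k, A.π.app U (δ.1 ⟨U, le_rfl⟩ (s k)) *
      A.coord U (dualOp hs (Finsupp.single k 1)) j := by
  rw [A.coord_eq_sum hs hδ, sum_degLE_one, A.coord_eq_zero U j (dualOp_mem hs (by simp)), mul_zero,
    zero_add]
  simp [mono, Finsupp.single_apply]

theorem DiffOp.res_mem {U V : X.Opens} (e : V ≤ U) {δ : DiffOp p U} {d : ℕ}
    (hδ : δ ∈ diffOpLE p U d) : DiffOp.res p e δ ∈ diffOpLE p V d :=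
  fun W hW x hx => hδ W (hW.trans e) x hx

/-- The morphism to the relative spectrum underlying a morphism to `Coor X`. -/
abbrev SymSpec.toE (A : SymSpec p n) {Y : Over X} (σ : Y ⟶ A.coor) : Y.left ⟶ A.E :=
  σ.left ≫ A.coorOpen.ι

theorem SymSpec.toE_π (A : SymSpec p n) {Y : Over X} (σ : Y ⟶ A.coor) : A.toE σ ≫ A.π = Y.hom :=
  (Category.assoc _ _ _).trans (Over.w σ)

variable [IsSeparated p]

/-- The rows are indexed by operators on the left and by sections on the right, whence the
transpose. -/
theorem CorrAt.det_coord {Y : Scheme.{u}} {g : Y ⟶ X} {f : Y ⟶ A.E} {w : f ≫ A.π = g}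
    {U : X.Opens} {s : Fin n → (principalParts p).Sections U}
    {hs : IsCoord (principalParts p) U s}
    {x : Fin n → ((principalParts p).pullback g).Sections (g ⁻¹ᵁ U)}
    (h : ∀ j, CorrAt w hs le_rfl j (x j)) :
    f.appLE (A.π ⁻¹ᵁ U) (g ⁻¹ᵁ U) (le_preimage_of_comp_eq w le_rfl)
      (Matrix.of fun i j => A.coord U (dualOp hs (Finsupp.single i 1)) j).det =
    (Matrix.of fun j k => (hs.pb g).coeff (g ⁻¹ᵁ U) le_rfl (Finsupp.single k 1) (x j)).det := by
  rw [← Matrix.det_transpose (Matrix.of fun j k =>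
    (hs.pb g).coeff (g ⁻¹ᵁ U) le_rfl (Finsupp.single k 1) (x j))]
  refine (RingHom.map_det _ _).trans (congrArg Matrix.det ?_)
  ext i j
  exact (h j (Finsupp.single i 1)).symm

variable [SmoothOfRelativeDimension n p]

/-- The morphisms to `Coor X` correspond to the formal coordinates. -/
theorem Corr.isCoord_iff {Y : Scheme.{u}} {g : Y ⟶ X} {f : Y ⟶ A.E} {w : f ≫ A.π = g}
    {a : Fin n → ((principalParts p).pullback g).Sections ⊤} (h : Corr w a) :
    IsCoord ((principalParts p).pullback g) ⊤ a ↔ ∀ y, f y ∈ A.coorOpen := by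
  constructor
  · intro ha y
    obtain ⟨U, s, hU, -, hs⟩ := exists_chart p n (g y)
    -- The operators dual to the linear monomials of a chart serve as witnesses: their determinant
    -- pulls back to the Jacobian.
    refine Opens.mem_iSup.mpr ⟨U, Opens.mem_iSup.mpr
      ⟨fun i => ⟨dualOp hs (Finsupp.single i 1), dualOp_mem hs (by simp)⟩, ?_⟩⟩
    have h₁ := (hs.pb g).isUnit_det (ha.res (le_top (a := g ⁻¹ᵁ U)))
    rw [← CorrAt.det_coord (fun j => h U s hs j)] at h₁
    have h₂ := Y.basicOpen_of_isUnit h₁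
    rw [Scheme.basicOpen_appLE] at h₂
    have h₃ : y ∈ g ⁻¹ᵁ U := hU
    rw [← h₂] at h₃
    exact h₃.2
  · intro hf
    refine IsCoord.of_cover fun y _ => ?_
    obtain ⟨V, hV⟩ := Opens.mem_iSup.mp (hf y)
    obtain ⟨δ, hδ⟩ := Opens.mem_iSup.mp hV
    have hyV : g y ∈ V := by
      have : f y ∈ A.π ⁻¹ᵁ V := A.E.basicOpen_le _ hδ
      rw [← w]
      exact this
    obtain ⟨U', s', hU', -, hs'⟩ := exists_chart p n (g y)
    have hs := hs'.res (inf_le_right : V ⊓ U' ≤ U')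
    have hyU : g y ∈ V ⊓ U' := ⟨hyV, hU'⟩
    generalize (fun j => (principalParts p).res (inf_le_right : V ⊓ U' ≤ U') (s' j)) = s at hs
    have eV : V ⊓ U' ≤ V := inf_le_left
    generalize V ⊓ U' = U at s hs hyU eV
    let D := (Matrix.of fun i j => A.coord U (dualOp hs (Finsupp.single i 1)) j).det
    have hyD : f y ∈ A.E.basicOpen D := by
      -- Modulo operators of order zero, arbitrary first order operators are combinations of the
      -- dual ones. Their determinant is therefore a multiple of `D`, so `D` does not vanish either.
      have h₁ : resO A.E (A.π.preimage_mono eV)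
          (Matrix.of fun i j : Fin n => A.coord V (δ i).1 j).det =
            (Matrix.of fun i k => A.π.app U ((DiffOp.res p eV (δ i).1).1 ⟨U, le_rfl⟩ (s k))).det *
              D := by
        rw [← Matrix.det_mul]
        refine (RingHom.map_det _ _).trans (congrArg Matrix.det ?_)
        ext i j
        rw [Matrix.mul_apply]
        refine (A.resO_coord eV j _).trans ?_
        exact SymSpec.coord_eq_linear hs (DiffOp.res_mem eV (δ i).2) j
      have h₂ : f y ∈ A.E.basicOpen (resO A.E (A.π.preimage_mono eV)
          (Matrix.of fun i j : Fin n => A.coord V (δ i).1 j).det) := by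
        rw [Scheme.basicOpen_res]
        refine ⟨?_, hδ⟩
        rw [← w] at hyU
        exact hyU
      rw [h₁, Scheme.basicOpen_mul] at h₂
      exact h₂.2
    let q := f.appLE (A.π ⁻¹ᵁ U) (g ⁻¹ᵁ U) (le_preimage_of_comp_eq w le_rfl) D
    have hq : Y.basicOpen q ≤ g ⁻¹ᵁ U := Y.basicOpen_le q
    refine ⟨Y.basicOpen q, le_top, ?_, ?_⟩
    · rw [Scheme.basicOpen_appLE]
      exact ⟨hyU, hyD⟩
    · refine ((hs.pb g).res hq).of_isUnit_det (fun j => ?_) ?_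
      · exact (h.corrAt hs hq j).mem_idealZero
      · have h₁ : IsUnit (resO Y hq q) := Y.toRingedSpace.isUnit_res_basicOpen q
        have h₂ := congrArg (resO Y hq) (CorrAt.det_coord fun j => h U s hs j)
        replace h₁ := h₂ ▸ h₁
        convert h₁ using 1
        refine Eq.trans ?_ (RingHom.map_det _ _).symm
        congr 1
        ext j k
        refine ((hs.pb g).coeff_res_coord hq _ le_rfl _ _).trans ?_
        rw [← Tower.res_res (e := le_top) (e' := hq)]
        exact (hs.pb g).coeff_res le_rfl hq _ _

namespace SymSpec

variable (A)

/-- The formal coordinates that correspond to a morphism to `Coor X`. -/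
def coordsOf {Y : Over X} (σ : Y ⟶ A.coor) (j : Fin n) :
    ((principalParts p).pullback Y.hom).Sections ⊤ :=
  (Corr.exists_sections (A.toE_π σ)).choose j

theorem corr_coordsOf {Y : Over X} (σ : Y ⟶ A.coor) : Corr (A.toE_π σ) (A.coordsOf σ) :=
  (Corr.exists_sections (A.toE_π σ)).choose_spec

theorem isCoord_coordsOf {Y : Over X} (σ : Y ⟶ A.coor) :
    IsCoord ((principalParts p).pullback Y.hom) ⊤ (A.coordsOf σ) := by
  rw [(A.corr_coordsOf σ).isCoord_iff]
  intro y
  have : A.coorOpen.ι (σ.left y) ∈ Set.range A.coorOpen.ι := ⟨_, rfl⟩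
  rwa [Scheme.Opens.range_ι] at this

theorem coordsOf_injective {Y : Over X} {σ τ : Y ⟶ A.coor} (h : A.coordsOf σ = A.coordsOf τ) :
    σ = τ := by
  have h₂ := A.corr_coordsOf σ
  rw [h] at h₂
  have h₃ := h₂.hom_eq (A.corr_coordsOf τ)
  exact Over.OverMorphism.ext ((cancel_mono A.coorOpen.ι).mp h₃)

/-- The morphism to `E` attached to `a` factors through the open subscheme `Coor X` because `a` is a
system of coordinates. -/
theorem exists_coordsOf_eq {Y : Over X}
    {a : Fin n → ((principalParts p).pullback Y.hom).Sections ⊤}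
    (ha : IsCoord ((principalParts p).pullback Y.hom) ⊤ a) :
    ∃ σ : Y ⟶ A.coor, A.coordsOf σ = a := by
  obtain ⟨f, w, hf⟩ := exists_hom A (g := Y.hom) ha.mem_idealZero
  have hr := hf.isCoord_iff.mp ha
  let l : Y.left ⟶ A.coorOpen := IsOpenImmersion.lift A.coorOpen.ι f (by
    rintro _ ⟨y, rfl⟩
    rw [Scheme.Opens.range_ι]
    exact hr y)
  have hl : l ≫ A.coorOpen.ι = f := IsOpenImmersion.lift_fac _ _ _
  let σ : Y ⟶ A.coor := Over.homMk l (by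
    change l ≫ A.coorOpen.ι ≫ A.π = Y.hom
    rw [← Category.assoc, hl, w])
  have h₃ : ∀ (f' : Y.left ⟶ A.E) (w' : f' ≫ A.π = Y.hom), A.toE σ = f' →
      Corr w' a → A.coordsOf σ = a := by
    rintro _ _ rfl hf'
    exact (A.corr_coordsOf σ).eq hf'
  exact ⟨σ, h₃ f w hl hf⟩

theorem bijective_ofIsCoord (Y : Over X) : Function.Bijective
    fun σ : Y ⟶ A.coor => FormalIso.ofIsCoord Y (A.isCoord_coordsOf σ) := by
  constructor
  · intro σ τ h
    refine A.coordsOf_injective (funext fun j => ?_)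
    rw [← FormalIso.coords_ofIsCoord Y (A.isCoord_coordsOf σ),
      ← FormalIso.coords_ofIsCoord Y (A.isCoord_coordsOf τ)]
    exact congr(($h).coords j)
  · intro φ
    obtain ⟨σ, hσ⟩ := A.exists_coordsOf_eq φ.isCoord
    exact ⟨σ, FormalIso.ext fun j => by rw [FormalIso.coords_ofIsCoord, hσ]⟩

theorem coordsOf_comp {Y' Y : Over X} (h : Y' ⟶ Y) (σ : Y ⟶ A.coor) (j : Fin n) :
    A.coordsOf (h ≫ σ) j =
      ((principalParts p).pullbackOver h.left (Over.w h)).pull ⊤ ⊤ le_top (A.coordsOf σ j) :=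
  congrFun ((A.corr_coordsOf (h ≫ σ)).eq ((A.corr_coordsOf σ).pull h.left (Over.w h)
    (Category.assoc _ _ _).symm
    (A.toE_π (h ≫ σ)))) j

end SymSpec

variable (p n)

/-- The moduli functor of formal isomorphisms. -/
def formalIsoFunctor : (Over X)ᵒᵖ ⥤ Type u where
  obj Y := FormalIso p n Y.unop
  map h := TypeCat.ofHom fun φ => (FormalIso.exists_isBaseChange h.unop φ).choose
  map_id Y := by
    refine ConcreteCategory.hom_ext _ _ fun φ => ?_
    -- Functoriality follows from uniqueness of the inverse image; here `φ` itself is an inverse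
    -- image along the identity.
    refine (FormalIso.exists_isBaseChange (𝟙 Y.unop) φ).unique
      (FormalIso.exists_isBaseChange (𝟙 Y.unop) φ).choose_spec.1 ?_
    refine (FormalIso.isBaseChange_iff _ _ _).mpr fun j => ?_
    refine Eq.symm ((TowerHom.pull_congr _ (Tower.idHom _) (fun d => ?_) _ _ _ le_rfl _).trans
      (Tower.res_self _ le_rfl _))
    apply pullback.hom_ext
    · exact (Tower.pullbackMap_fst _ _ (Over.w (𝟙 Y.unop)) _).trans (by simp [Tower.idHom, Tower.pullback])
    · exact (Tower.pullbackMap_snd _ _ (Over.w (𝟙 Y.unop)) _).trans (by simp [Tower.idHom, Tower.pullback])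
  map_comp {Y₁ Y₂ Y₃} h k := by
    refine ConcreteCategory.hom_ext _ _ fun φ => ?_
    refine (FormalIso.exists_isBaseChange (h ≫ k).unop φ).unique
      (FormalIso.exists_isBaseChange (h ≫ k).unop φ).choose_spec.1 ?_
    have h₁ := (FormalIso.exists_isBaseChange h.unop φ).choose_spec.1
    have h₂ := (FormalIso.exists_isBaseChange k.unop
      (FormalIso.exists_isBaseChange h.unop φ).choose).choose_spec.1
    refine (FormalIso.isBaseChange_iff _ _ _).mpr fun j => ?_
    refine ((FormalIso.isBaseChange_iff _ _ _).mp h₂ j).trans ?_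
    rw [(FormalIso.isBaseChange_iff _ _ _).mp h₁ j]
    exact Tower.pullbackOver_pullbackOver _ _ _ _ _ _ rfl _ _ _ _ _ _ _ _

theorem formalIsoFunctor_map {Y' Y : Over X} (h : Y' ⟶ Y) (φ : FormalIso p n Y) :
    FormalIso.IsBaseChange h φ ((formalIsoFunctor p n).map h.op φ) :=
  (FormalIso.exists_isBaseChange h φ).choose_spec.1

theorem isModuliFunctor_formalIsoFunctor :
    IsModuliFunctor p n (formalIsoFunctor p n) fun _ => Equiv.refl _ :=
  fun _ _ h φ => formalIsoFunctor_map p n h φ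

variable {p n}

/-- The bundle of formal coordinate systems represents the moduli functor. -/
def SymSpec.representableBy (A : SymSpec p n) : (formalIsoFunctor p n).RepresentableBy A.coor where
  homEquiv {Y} := Equiv.ofBijective _ (A.bijective_ofIsCoord Y)
  homEquiv_comp {Y' Y} h σ := by
    refine (FormalIso.exists_isBaseChange h _).unique ?_ (formalIsoFunctor_map p n h _)
    refine (FormalIso.isBaseChange_iff _ _ _).mpr fun j => ?_
    refine (FormalIso.coords_ofIsCoord _ _ j).trans ((A.coordsOf_comp h σ j).trans ?_)
    exact congrArg _ (FormalIso.coords_ofIsCoord _ _ j).symm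

/-- A section over `U` is a morphism from the scheme `U`, hence coordinates of the tower pulled back
to `U`. Along an open immersion this is the same as coordinates on `U ⊆ X`, and naturality at the
identity of `Coor X` expresses them through the universal isomorphism. -/
theorem SymSpec.exists_sections_equiv (A : SymSpec p n) (U : X.Opens) :
    ∃ b : (Over.mk U.ι ⟶ A.coor) ≃ FormalCoords p n U,
      ∀ (σ : Over.mk U.ι ⟶ A.coor) (j : Fin n),
        ((principalParts p).pullbackSnd U.ι).pull U ⊤ (by simp) ((b σ).1 j) =
          ((principalParts p).pullbackOver σ.left (Over.w σ)).pull ⊤ ⊤ le_top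
            ((A.representableBy.homEquiv (𝟙 A.coor) : FormalIso p n A.coor).coords j) := by
  have hU : U ≤ U.ι.opensRange := U.opensRange_ι.ge
  have hc := (principalParts p).pullbackSnd_isCartesian U.ι
  have hb : ∀ (V : (U : Scheme).Opens) (hV : V = U.ι ⁻¹ᵁ U),
      Function.Bijective (((principalParts p).pullbackSnd U.ι).pull U V hV.le) := by
    rintro _ rfl
    exact hc.pull_bijective U hU
  have hi : ∀ (V : (U : Scheme).Opens) (hV : V = U.ι ⁻¹ᵁ U)
      (t : Fin n → (principalParts p).Sections U),
      IsCoord ((principalParts p).pullback U.ι) V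
        (fun j => ((principalParts p).pullbackSnd U.ι).pull U V hV.le (t j)) ↔
      IsCoord (principalParts p) U t := by
    rintro _ rfl t
    exact hc.isCoord_pull_iff U hU t
  replace hb := hb ⊤ (by simp)
  replace hi := hi ⊤ (by simp)
  have h₁ : ∀ σ : Over.mk U.ι ⟶ A.coor, ∃ t : FormalCoords p n U, ∀ j,
      ((principalParts p).pullbackSnd U.ι).pull U ⊤ (by simp) (t.1 j) = A.coordsOf σ j := by
    intro σ
    choose t ht using fun j => hb.2 (A.coordsOf σ j)
    refine ⟨⟨t, (isCoord_iff_formalCoords t).mp ((hi t).mp ?_)⟩, ht⟩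
    rw [funext ht]
    exact A.isCoord_coordsOf σ
  choose b hb' using h₁
  refine ⟨Equiv.ofBijective b ⟨fun σ τ h => A.coordsOf_injective (funext fun j => ?_),
    fun t => ?_⟩, fun σ j => (hb' σ j).trans ?_⟩
  · rw [← hb', ← hb', h]
  · obtain ⟨σ, hσ⟩ := A.exists_coordsOf_eq (Y := Over.mk U.ι)
      ((hi _).mpr ((isCoord_iff_formalCoords _).mpr t.2))
    refine ⟨σ, Subtype.ext (funext fun j => hb.1 ?_)⟩
    rw [hb', hσ]
  · have h₂ := A.coordsOf_comp σ (𝟙 A.coor) j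
    rw [Category.comp_id] at h₂
    exact h₂.trans (congrArg _ (FormalIso.coords_ofIsCoord _ _ j).symm)

end Moduli

/-! ### Localization of symmetric algebras -/

section SymmetricAlgebra

variable {R R' T : Type*} [CommRing R] [CommRing R'] [CommRing T] {M M' : Type*} [AddCommGroup M]
  [AddCommGroup M'] [Module R M] [Module R' M']

/-- The ring homomorphism from a symmetric algebra given by a semilinear map. -/
def symLift (a : R →+* T) (b : M →ₛₗ[a] T) : SymmetricAlgebra R M →+* T :=
  letI := a.toAlgebra
  AlgHom.toRingHom (SymmetricAlgebra.lift (R := R) (A := T)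
    { toFun := b, map_add' := map_add b, map_smul' := fun r m =>
        (b.map_smulₛₗ r m).trans (Algebra.smul_def r (b m)).symm })

@[simp]
theorem symLift_algebraMap (a : R →+* T) (b : M →ₛₗ[a] T) (r : R) :
    symLift a b (algebraMap R _ r) = a r :=
  let _ := a.toAlgebra
  AlgHom.commutes _ r

@[simp]
theorem symLift_ι (a : R →+* T) (b : M →ₛₗ[a] T) (m : M) :
    symLift a b (SymmetricAlgebra.ι R M m) = b m :=
  let _ := a.toAlgebra
  SymmetricAlgebra.lift_ι_apply (R := R) (A := T) (f := _) m

theorem sym_ringHom_ext {f g : SymmetricAlgebra R M →+* T}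
    (h₁ : ∀ r, f (algebraMap R _ r) = g (algebraMap R _ r))
    (h₂ : ∀ m, f (SymmetricAlgebra.ι R M m) = g (SymmetricAlgebra.ι R M m)) : f = g := by
  refine RingHom.ext fun x => ?_
  induction x using SymmetricAlgebra.induction with
  | algebraMap r => exact h₁ r
  | ι m => exact h₂ m
  | mul a b ha hb => rw [map_mul, map_mul, ha, hb]
  | add a b ha hb => rw [map_add, map_add, ha, hb]

/-- The homomorphism of symmetric algebras induced by a semilinear map. -/
def symMap {φ : R →+* R'} (f : M →ₛₗ[φ] M') : SymmetricAlgebra R M →+* SymmetricAlgebra R' M' :=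
  symLift ((algebraMap R' _).comp φ)
    { toFun := fun m => SymmetricAlgebra.ι R' M' (f m)
      map_add' := by simp
      map_smul' := fun r m => by simp [Algebra.smul_def] }

@[simp]
theorem symMap_algebraMap {φ : R →+* R'} (f : M →ₛₗ[φ] M') (r : R) :
    symMap f (algebraMap R _ r) = algebraMap R' _ (φ r) := symLift_algebraMap _ _ r

@[simp]
theorem symMap_ι {φ : R →+* R'} (f : M →ₛₗ[φ] M') (m : M) :
    symMap f (SymmetricAlgebra.ι R M m) = SymmetricAlgebra.ι R' M' (f m) := symLift_ι _ _ m

/-- Semilinear maps extend to localizations. -/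
theorem exists_semilinear_extension {φ : R →+* R'} (r : R)
    (hφ : letI := φ.toAlgebra; IsLocalization.Away r R') (f : M →ₛₗ[φ] M')
    (hinj : ∀ m, f m = 0 → ∃ k : ℕ, r ^ k • m = 0)
    (hsurj : ∀ m', ∃ (k : ℕ) (m : M), f m = φ r ^ k • m')
    (a : R' →+* T) (b : M →ₛₗ[a.comp φ] T) : ∃ c : M' →ₛₗ[a] T, ∀ m, c (f m) = b m := by
  algebraize [φ, a, a.comp φ]
  let : Module R M' := Module.compHom M' φ
  have : IsScalarTower R R' M' := ⟨fun x y z => by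
    rw [Algebra.smul_def, mul_smul]
    rfl⟩
  have hr : ∀ m' : M', ∀ k : ℕ, r ^ k • m' = φ r ^ k • m' := fun m' k => by
    rw [← map_pow]
    rfl
  let f' : M →ₗ[R] M' := { toFun := f, map_add' := map_add f, map_smul' := f.map_smulₛₗ }
  let b' : M →ₗ[R] T := { toFun := b, map_add' := map_add b, map_smul' := fun x m =>
    (b.map_smulₛₗ x m).trans (Algebra.smul_def x (b m)).symm }
  have hu : IsUnit (φ r) := IsLocalization.Away.algebraMap_isUnit (S := R') r
  -- `hinj` and `hsurj` say that `M'` is `M` with `r` inverted.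
  have : IsLocalizedModule (Submonoid.powers r) f' := by
    refine ⟨?_, ?_, ?_⟩
    · rintro ⟨_, k, rfl⟩
      rw [Module.End.isUnit_iff]
      have : ∀ m', algebraMap R (Module.End R M') (r ^ k) m' = φ r ^ k • m' := fun m' => hr m' k
      constructor
      · intro x y h
        rw [this, this] at h
        exact (hu.pow k).smul_left_cancel.mp h
      · intro y
        obtain ⟨u, hu'⟩ := hu.pow k
        refine ⟨(↑u⁻¹ : R') • y, ?_⟩
        rw [this, ← hu', smul_smul, Units.mul_inv, one_smul]
    · intro m'
      obtain ⟨k, m, h⟩ := hsurj m'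
      exact ⟨(m, ⟨_, k, rfl⟩), ((h.trans (hr m' k).symm)).symm⟩
    · intro x y h
      obtain ⟨k, hk⟩ := hinj (x - y) (by rw [map_sub]; exact sub_eq_zero.mpr h)
      exact ⟨⟨_, k, rfl⟩, sub_eq_zero.mp ((smul_sub _ _ _).symm.trans hk)⟩
  have hb : ∀ x : Submonoid.powers r, IsUnit (algebraMap R (Module.End R T) x) := by
    rintro ⟨_, k, rfl⟩
    have := (hu.map a).pow k
    rw [Module.End.isUnit_iff]
    have h' : ∀ t, algebraMap R (Module.End R T) (r ^ k) t = a (φ r) ^ k * t := fun t => by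
      rw [← map_pow, ← map_pow]
      exact Algebra.smul_def (r ^ k) t
    constructor
    · intro x y h
      rw [h', h'] at h
      exact this.mul_left_cancel h
    · intro y
      obtain ⟨u, hu'⟩ := this
      refine ⟨(↑u⁻¹ : T) • y, ?_⟩
      rw [h', ← hu', smul_eq_mul, Units.mul_inv_cancel_left]
  let c := (IsLocalizedModule.lift (Submonoid.powers r) f' b' hb).extendScalarsOfIsLocalization
    (Submonoid.powers r) R'
  refine ⟨{ toFun := c, map_add' := map_add c, map_smul' := fun x m =>
    (map_smul c x m).trans (Algebra.smul_def _ _) }, fun m => ?_⟩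
  exact IsLocalizedModule.lift_apply (Submonoid.powers r) f' b' hb m

/-- Denominators are cleared by induction on the generators. For the kernel, the universal property
gives a map back to the localization that extends the canonical one, so an element killed by `symMap
f` is killed by a power of `r`. -/
theorem isLocalization_symMap {φ : R →+* R'} (r : R)
    (hφ : letI := φ.toAlgebra; IsLocalization.Away r R') (f : M →ₛₗ[φ] M')
    (hinj : ∀ m, f m = 0 → ∃ k : ℕ, r ^ k • m = 0)
    (hsurj : ∀ m', ∃ (k : ℕ) (m : M), f m = φ r ^ k • m') :
    letI := (symMap f).toAlgebra
    IsLocalization.Away (algebraMap R (SymmetricAlgebra R M) r) (SymmetricAlgebra R' M') := by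
  let := (symMap f).toAlgebra
  have hu : IsUnit (φ r) := let := φ.toAlgebra; IsLocalization.Away.algebraMap_isUnit (S := R') r
  have hs : ∀ x, algebraMap (SymmetricAlgebra R M) (SymmetricAlgebra R' M') x = symMap f x :=
    fun _ => rfl
  have key : ∀ z : SymmetricAlgebra R' M', ∃ (k : ℕ) (x : SymmetricAlgebra R M),
      symMap f x = algebraMap R' _ (φ r) ^ k * z := by
    intro z
    induction z using SymmetricAlgebra.induction with
    | algebraMap x =>
      let := φ.toAlgebra
      obtain ⟨k, y, h⟩ := IsLocalization.Away.surj (S := R') r x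
      refine ⟨k, algebraMap R _ y, ?_⟩
      rw [symMap_algebraMap, ← map_pow, ← map_mul, mul_comm]
      exact congrArg _ h.symm
    | ι m =>
      obtain ⟨k, y, h⟩ := hsurj m
      refine ⟨k, SymmetricAlgebra.ι R M y, ?_⟩
      rw [symMap_ι, h, map_smul, Algebra.smul_def, map_pow]
    | mul a b ha hb =>
      obtain ⟨k, x, hx⟩ := ha
      obtain ⟨l, y, hy⟩ := hb
      exact ⟨k + l, x * y, by rw [map_mul, hx, hy]; ring⟩
    | add a b ha hb =>
      obtain ⟨k, x, hx⟩ := ha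
      obtain ⟨l, y, hy⟩ := hb
      refine ⟨k + l, algebraMap R _ r ^ l * x + algebraMap R _ r ^ k * y, ?_⟩
      rw [map_add, map_mul, map_mul, hx, hy, map_pow, map_pow, symMap_algebraMap]
      ring
  let L := Localization.Away (algebraMap R (SymmetricAlgebra R M) r)
  let ℓ : SymmetricAlgebra R M →+* L := algebraMap _ _
  have hrL : IsUnit (ℓ (algebraMap R _ r)) := IsLocalization.Away.algebraMap_isUnit _
  obtain ⟨ψ, hψ⟩ : ∃ ψ : SymmetricAlgebra R' M' →+* L, ψ.comp (symMap f) = ℓ := by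
    obtain ⟨a, ha⟩ : ∃ a : R' →+* L, a.comp φ = ℓ.comp (algebraMap R _) := by
      let := φ.toAlgebra
      exact ⟨IsLocalization.Away.lift r (g := ℓ.comp (algebraMap R _)) hrL,
        IsLocalization.Away.lift_comp r hrL⟩
    have ha' : ∀ x, a (φ x) = ℓ (algebraMap R _ x) := fun x => congr($ha x)
    obtain ⟨c, hc⟩ := exists_semilinear_extension r hφ f hinj hsurj a
      { toFun := fun m => ℓ (SymmetricAlgebra.ι R M m)
        map_add' := by simp
        map_smul' := fun x m => by simp [Algebra.smul_def, ha'] }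
    refine ⟨symLift a c, sym_ringHom_ext (fun x => ?_) fun m => ?_⟩
    · simp [ha']
    · simp only [RingHom.comp_apply, symMap_ι, symLift_ι, hc]
      rfl
  refine (isLocalization_iff _ _).mpr ⟨?_, fun z => ?_, fun {x y} h => ?_⟩
  · rintro ⟨_, k, rfl⟩
    change IsUnit (symMap f (algebraMap R _ r ^ k))
    rw [map_pow, symMap_algebraMap]
    exact (hu.map _).pow k
  · obtain ⟨k, x, h⟩ := key z
    refine ⟨(x, ⟨_, k, rfl⟩), ?_⟩
    rw [hs, hs, h, mul_comm]
    simp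
  · refine IsLocalization.exists_of_eq (M := Submonoid.powers (algebraMap R (SymmetricAlgebra R M) r))
      (S := L) ?_
    have h₁ := congrArg ψ (show symMap f x = symMap f y from h)
    exact (congr($hψ x).symm.trans h₁).trans congr($hψ y)

end SymmetricAlgebra

/-! ### Localization of differential operators -/

section LocalFunctions

variable {X : Scheme.{u}} {W : X.Opens}

theorem exists_pow_mul_eq_zero {κ : Type*} (hW : IsCompact (W : Set X)) (r : Γ(X, W)) (t : Finset κ)
    (c : κ → Γ(X, W)) : ∃ N : ℕ, ∀ α ∈ t, resO X (X.basicOpen_le r) (c α) = 0 → r ^ N * c α = 0 := by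
  have h : ∀ α, ∃ N : ℕ, resO X (X.basicOpen_le r) (c α) = 0 → r ^ N * c α = 0 := by
    intro α
    by_cases hα : resO X (X.basicOpen_le r) (c α) = 0
    · obtain ⟨N, hN⟩ := exists_pow_mul_eq_zero_of_res_basicOpen_eq_zero_of_isCompact X hW (c α) r hα
      exact ⟨N, fun _ => hN⟩
    · exact ⟨0, fun h => absurd h hα⟩
  choose N hN using h
  refine ⟨t.sup N, fun α hα hc => ?_⟩
  rw [← Nat.sub_add_cancel (Finset.le_sup (f := N) hα), pow_add, mul_assoc, hN α hc, mul_zero]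

/-- The extra `k` lets exponents found on different charts be raised to a common value. -/
theorem exists_res_eq_pow_mul {κ : Type*} (hW : IsAffineOpen W) (r : Γ(X, W)) (t : Finset κ)
    (c : κ → Γ(X, X.basicOpen r)) : ∃ N : ℕ, ∀ k, ∃ c' : κ → Γ(X, W), ∀ α ∈ t,
      resO X (X.basicOpen_le r) (c' α) = resO X (X.basicOpen_le r) r ^ (N + k) * c α := by
  have h : ∀ α, ∃ (N : ℕ) (y : Γ(X, W)),
      resO X (X.basicOpen_le r) y = resO X (X.basicOpen_le r) r ^ N * c α :=
    fun α => exists_eq_pow_mul_of_isAffineOpen X W hW r (c α)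
  choose N y hy using h
  refine ⟨t.sup N, fun k => ⟨fun α => r ^ (t.sup N + k - N α) * y α, fun α hα => ?_⟩⟩
  have hle : N α ≤ t.sup N + k := (Finset.le_sup hα).trans (Nat.le_add_right _ _)
  rw [map_mul, map_pow, hy, ← mul_assoc, ← pow_add, Nat.sub_add_cancel hle]

end LocalFunctions

section DiffOpSheaf

variable {S X : Scheme.{u}} {p : X ⟶ S} {U V : X.Opens}

variable (p) in
/-- Restriction of differential operators as a semilinear map. -/
def DiffOp.resₛₗ (e : V ≤ U) : DiffOp p U →ₛₗ[resO X e] DiffOp p V where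
  toFun := DiffOp.res p e
  map_add' _ _ := rfl
  map_smul' f δ := diffOp_ext fun W hW x => by
    change resO X _ f * _ = resO X hW (resO X e f) * _
    rw [resO_resO]
    rfl

theorem DiffOp.res_res {W : X.Opens} (e : V ≤ U) (e' : W ≤ V) (δ : DiffOp p U) :
    DiffOp.res p e' (DiffOp.res p e δ) = DiffOp.res p (e'.trans e) δ := rfl

theorem DiffOp.res_smul (e : V ≤ U) (f : Γ(X, U)) (δ : DiffOp p U) :
    DiffOp.res p e (f • δ) = resO X e f • DiffOp.res p e δ :=
  map_smulₛₗ (DiffOp.resₛₗ p e) f δ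

theorem DiffOp.res_sub (e : V ≤ U) (δ ε : DiffOp p U) :
    DiffOp.res p e (δ - ε) = DiffOp.res p e δ - DiffOp.res p e ε :=
  map_sub (DiffOp.resₛₗ p e) δ ε

theorem mem_diffOpLE_of_cover {δ : DiffOp p U} {d : ℕ}
    (h : ∀ x ∈ U, ∃ (W : X.Opens) (e : W ≤ U), x ∈ W ∧ DiffOp.res p e δ ∈ diffOpLE p W d) :
    δ ∈ diffOpLE p U d := by
  intro W hW s hs
  refine ext_of_resO fun x hx => ?_
  obtain ⟨W', e, hxW', h'⟩ := h x (hW hx)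
  refine ⟨W ⊓ W', inf_le_left, ⟨hx, hxW'⟩, ?_⟩
  rw [map_zero, ← δ.2.1 W hW _ inf_le_left]
  refine h' (W ⊓ W') inf_le_right _ ?_
  rw [Tower.proj_res, hs, map_zero]

theorem diffOp_ext_of_cover {δ ε : DiffOp p U}
    (h : ∀ x ∈ U, ∃ (W : X.Opens) (e : W ≤ U), x ∈ W ∧ DiffOp.res p e δ = DiffOp.res p e ε) :
    δ = ε := by
  refine diffOp_ext fun W hW s => ext_of_resO fun x hx => ?_
  obtain ⟨W', e, hxW', h'⟩ := h x (hW hx)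
  refine ⟨W ⊓ W', inf_le_left, ⟨hx, hxW'⟩, ?_⟩
  rw [← δ.2.1 W hW _ inf_le_left, ← ε.2.1 W hW _ inf_le_left]
  exact congr(($h').1 ⟨W ⊓ W', inf_le_right⟩ ((principalParts p).res inf_le_left s))

/-- The value on a section over `W` is glued from the values of the `δ i` over `W ⊓ U i`. Linearity,
compatibility with restriction and local boundedness of the order can all be checked locally. -/
theorem exists_diffOp_glue {ι : Type*} (U : ι → X.Opens) (V : X.Opens) (hU : ∀ i, U i ≤ V)
    (hV : ∀ x ∈ V, ∃ i, x ∈ U i) (δ : ∀ i, DiffOp p (U i))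
    (hδ : ∀ i j (W : X.Opens) (e : W ≤ U i) (e' : W ≤ U j),
      DiffOp.res p e (δ i) = DiffOp.res p e' (δ j)) :
    ∃ ε : DiffOp p V, ∀ i, DiffOp.res p (hU i) ε = δ i := by
  have h₁ : ∀ (W : {W : X.Opens // W ≤ V}) (s : (principalParts p).Sections W.1), ∃ t : Γ(X, W.1),
      ∀ i, resO X (inf_le_left : W.1 ⊓ U i ≤ W.1) t =
        (δ i).1 ⟨W.1 ⊓ U i, inf_le_right⟩ ((principalParts p).res inf_le_left s) := by
    rintro ⟨W, hW⟩ s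
    refine exists_glue (fun i => W ⊓ U i) W (fun i => inf_le_left)
      (fun x hx => (hV x (hW hx)).imp fun i hi => ⟨hx, hi⟩) _ fun i j W' e e' => ?_
    have h₂ := (δ i).2.1 (W ⊓ U i) inf_le_right W' e ((principalParts p).res inf_le_left s)
    have h₃ := (δ j).2.1 (W ⊓ U j) inf_le_right W' e' ((principalParts p).res inf_le_left s)
    rw [Tower.res_res] at h₂ h₃
    refine h₂.symm.trans (Eq.trans ?_ h₃)
    exact congr(($(hδ i j W' (e.trans inf_le_right) (e'.trans inf_le_right))).1 ⟨W', le_rfl⟩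
      ((principalParts p).res (e.trans inf_le_left) s))
  choose g hg using h₁
  have ext' : ∀ (W : {W : X.Opens // W ≤ V}) (a b : Γ(X, W.1)),
      (∀ i, resO X (inf_le_left : W.1 ⊓ U i ≤ W.1) a = resO X inf_le_left b) → a = b := by
    rintro ⟨W, hW⟩ a b h
    refine ext_of_resO fun x hx => ?_
    obtain ⟨i, hi⟩ := hV x (hW hx)
    exact ⟨W ⊓ U i, inf_le_left, ⟨hx, hi⟩, h i⟩
  let ε : LinearFamily (principalParts p) V := fun W =>
    { toFun := g W
      map_add' := fun s t => ext' W _ _ fun i => by simp only [hg, map_add]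
      map_smul' := fun f s => ext' W _ _ fun i => by
        rw [hg, RingHom.id_apply, smul_eq_mul, map_mul, hg, Tower.res_smul, map_smul, smul_eq_mul] }
  have hε : ∀ (W : X.Opens) (hW : W ≤ V) (i : ι) (hWi : W ≤ U i) (s), ε ⟨W, hW⟩ s =
      (δ i).1 ⟨W, hWi⟩ s := by
    intro W hW i hWi s
    refine ext' ⟨W, hW⟩ _ _ fun j => ?_
    refine (hg ⟨W, hW⟩ s j).trans ?_
    rw [← (δ i).2.1 W hWi _ inf_le_left]
    exact congr(($(hδ j i (W ⊓ U j) inf_le_right (inf_le_left.trans hWi))).1 ⟨W ⊓ U j, le_rfl⟩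
      ((principalParts p).res inf_le_left s))
  refine ⟨⟨ε, fun W hW W' e s => ?_, fun x hx => ?_⟩, fun i => diffOp_ext fun W hW s =>
    hε W (hW.trans (hU i)) i hW s⟩
  · refine ext' ⟨W', e.trans hW⟩ _ _ fun i => ?_
    refine (hg ⟨W', e.trans hW⟩ _ i).trans ?_
    rw [resO_resO, Tower.res_res]
    have h₂ := congrArg (resO X (inf_le_inf_right (U i) e)) (hg ⟨W, hW⟩ s i)
    rw [resO_resO] at h₂
    refine Eq.trans ?_ h₂.symm
    rw [← (δ i).2.1 (W ⊓ U i) inf_le_right _ (inf_le_inf_right (U i) e), Tower.res_res]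
  · obtain ⟨i, hi⟩ := hV x hx
    obtain ⟨V', hxV', d, h⟩ := (δ i).2.2 x hi
    refine ⟨V' ⊓ U i, ⟨hxV', hi⟩, d, fun W hW hWV s hs => ?_⟩
    rw [hε W hW i (hWV.trans inf_le_right)]
    exact h W _ (hWV.trans inf_le_left) s hs

end DiffOpSheaf

/-! ### Quasi-coherence of differential operators on affine open sets. -/

section DiffOpLocalization

variable {S X : Scheme.{u}} {p : X ⟶ S} {n : ℕ} {W : X.Opens}
  {s : Fin n → (principalParts p).Sections W}

/-- In a chart an operator is a finite sum of coefficient operators, so the claim reduces to its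
function coefficients. For the second part only those with `α ≠ 0` need to be killed. -/
theorem exists_pow_smul_diffOp (hs : IsCoord (principalParts p) W s) (hW : IsAffineOpen W)
    (r : Γ(X, W)) (δ : DiffOp p W) : ∃ N : ℕ,
      (DiffOp.res p (X.basicOpen_le r) δ = 0 → r ^ N • δ = 0) ∧
      (DiffOp.res p (X.basicOpen_le r) δ ∈ diffOpLE p _ 0 → r ^ N • δ ∈ diffOpLE p W 0) := by
  obtain ⟨d, hd⟩ := exists_mem_diffOpLE hW.isCompact δ
  obtain ⟨N, hN⟩ := exists_pow_mul_eq_zero hW.isCompact r (degLE n d)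
    fun α => δ.1 ⟨W, le_rfl⟩ (mono s α)
  have hsum : r ^ N • δ = ∑ α ∈ degLE n d,
      (r ^ N * δ.1 ⟨W, le_rfl⟩ (mono s α)) • dualOp hs α := by
    conv_lhs => rw [diffOp_eq_sum hs δ hd, Finset.smul_sum]
    exact Finset.sum_congr rfl fun α _ => smul_smul _ _ _
  have hres : ∀ α, resO X (X.basicOpen_le r) (δ.1 ⟨W, le_rfl⟩ (mono s α)) =
      (DiffOp.res p (X.basicOpen_le r) δ).1 ⟨_, le_rfl⟩
        ((principalParts p).res (X.basicOpen_le r) (mono s α)) := fun α =>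
    (δ.2.1 W le_rfl _ (X.basicOpen_le r) _).symm
  refine ⟨N, fun h => ?_, fun h => ?_⟩
  · rw [hsum]
    refine Finset.sum_eq_zero fun α hα => ?_
    rw [hN α hα (by rw [hres, h]; rfl), zero_smul]
  · rw [hsum]
    refine Submodule.sum_mem _ fun α hα => ?_
    by_cases h0 : α = 0
    · subst h0
      exact Submodule.smul_mem _ _ (dualOp_mem hs (by simp))
    · rw [hN α hα ?_, zero_smul]
      · exact Submodule.zero_mem _
      · rw [hres]
        refine h _ le_rfl _ ?_
        rw [map_mono]
        refine RingHom.mem_ker.mp ((hs.mem_idealZero_iff _ (X.basicOpen_le r) _).mpr ?_)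
        rw [hs.coeff_mono, if_neg (Ne.symm h0)]

theorem exists_diffOp_extension (hs : IsCoord (principalParts p) W s) (hW : IsAffineOpen W)
    (r : Γ(X, W)) (ε : DiffOp p (X.basicOpen r)) : ∃ N : ℕ, ∀ k, ∃ δ : DiffOp p W,
      DiffOp.res p (X.basicOpen_le r) δ = resO X (X.basicOpen_le r) r ^ (N + k) • ε := by
  obtain ⟨d, hd⟩ := exists_mem_diffOpLE (hW.basicOpen r).isCompact ε
  have hs' := hs.res (X.basicOpen_le r)
  obtain ⟨N, hN⟩ := exists_res_eq_pow_mul hW r (degLE n d) fun α => ε.1 ⟨_, le_rfl⟩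
    (mono (fun j => (principalParts p).res (X.basicOpen_le r) (s j)) α)
  refine ⟨N, fun k => ?_⟩
  obtain ⟨c, hc⟩ := hN k
  refine ⟨∑ α ∈ degLE n d, c α • dualOp hs α, ?_⟩
  conv_rhs => rw [diffOp_eq_sum hs' ε hd, Finset.smul_sum]
  refine (map_sum (DiffOp.resₛₗ p (X.basicOpen_le r)) _ _).trans
    (Finset.sum_congr rfl fun α hα => ?_)
  refine (DiffOp.res_smul (X.basicOpen_le r) _ _).trans ?_
  rw [hc α hα, res_dualOp, smul_smul]

theorem exists_pow_smul_eq (hs : IsCoord (principalParts p) W s) (hW : IsAffineOpen W)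
    (r : Γ(X, W)) {δ ε : DiffOp p W} (h : DiffOp.res p (X.basicOpen_le r) δ =
      DiffOp.res p (X.basicOpen_le r) ε) : ∃ N : ℕ, ∀ M, N ≤ M → r ^ M • δ = r ^ M • ε := by
  obtain ⟨N, hN, -⟩ := exists_pow_smul_diffOp hs hW r (δ - ε)
  refine ⟨N, fun M hM => ?_⟩
  have h₁ := hN (by rw [DiffOp.res_sub, h, sub_self])
  rw [← sub_eq_zero, ← smul_sub, ← Nat.sub_add_cancel hM, pow_add, mul_smul, h₁, smul_zero]

theorem basicOpen_resO_le {U : X.Opens} (e : W ≤ U) (r : Γ(X, U)) :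
    X.basicOpen (resO X e r) ≤ X.basicOpen r := by
  rw [Scheme.basicOpen_res]
  exact inf_le_right

/-- Two local extensions agree on an overlap after multiplication by a power of `r`, because there
they agree where `r` is invertible. Finiteness of the cover gives one power for all overlaps. -/
theorem exists_diffOp_glue_pow {ι : Type*} [Finite ι] {U : X.Opens} (W : ι → X.Opens)
    (hW : ∀ i, W i ≤ U) (hU : ∀ x ∈ U, ∃ i, x ∈ W i) (haff : ∀ i j, IsAffineOpen (W i ⊓ W j))
    (s : ∀ i, Fin n → (principalParts p).Sections (W i))
    (hs : ∀ i, IsCoord (principalParts p) (W i) (s i)) (r : Γ(X, U))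
    (ε : DiffOp p (X.basicOpen r)) (δ : ∀ i, DiffOp p (W i))
    (hδ : ∀ i, DiffOp.res p (X.basicOpen_le (resO X (hW i) r)) (δ i) =
      DiffOp.res p (basicOpen_resO_le (hW i) r) ε) :
    ∃ (N : ℕ) (θ : DiffOp p U),
      DiffOp.res p (X.basicOpen_le r) θ = resO X (X.basicOpen_le r) r ^ N • ε := by
  have := Fintype.ofFinite ι
  have h₃ : ∀ q : ι × ι, ∃ N : ℕ, ∀ M, N ≤ M →
      resO X (inf_le_left.trans (hW q.1) : W q.1 ⊓ W q.2 ≤ U) r ^ M •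
        DiffOp.res p (inf_le_left : W q.1 ⊓ W q.2 ≤ _) (δ q.1) =
      resO X (inf_le_left.trans (hW q.1) : W q.1 ⊓ W q.2 ≤ U) r ^ M •
        DiffOp.res p (inf_le_right : W q.1 ⊓ W q.2 ≤ _) (δ q.2) := by
    rintro ⟨i, j⟩
    refine exists_pow_smul_eq ((hs i).res inf_le_left) (haff i j) _ ?_
    rw [DiffOp.res_res, DiffOp.res_res]
    have hi : X.basicOpen (resO X (inf_le_left.trans (hW i) : W i ⊓ W j ≤ U) r) ≤
        X.basicOpen (resO X (hW i) r) := by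
      rw [← resO_resO X (hW i) inf_le_left]
      exact basicOpen_resO_le _ _
    have hj : X.basicOpen (resO X (inf_le_left.trans (hW i) : W i ⊓ W j ≤ U) r) ≤
        X.basicOpen (resO X (hW j) r) := by
      rw [← resO_resO X (hW j) inf_le_right]
      exact basicOpen_resO_le _ _
    have h₁ := congrArg (DiffOp.res p hi) (hδ i)
    have h₂ := congrArg (DiffOp.res p hj) (hδ j)
    rw [DiffOp.res_res, DiffOp.res_res] at h₁ h₂
    exact h₁.trans h₂.symm
  choose L hL using h₃
  obtain ⟨M, hM⟩ : ∃ M, ∀ q, L q ≤ M :=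
    ⟨Finset.univ.sup L, fun q => Finset.le_sup (Finset.mem_univ q)⟩
  obtain ⟨θ, hθ⟩ := exists_diffOp_glue W U hW hU (fun i => resO X (hW i) r ^ M • δ i) (by
    intro i j V hi hj
    have h := congrArg (DiffOp.res p (le_inf hi hj)) (hL (i, j) M (hM _))
    rw [DiffOp.res_smul, DiffOp.res_smul, map_pow, resO_resO, DiffOp.res_res, DiffOp.res_res] at h
    rw [DiffOp.res_smul, DiffOp.res_smul, map_pow, map_pow, resO_resO, resO_resO]
    exact h)
  refine ⟨M, θ, diffOp_ext_of_cover fun x hx => ?_⟩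
  obtain ⟨i, hi⟩ := hU x (X.basicOpen_le r hx)
  refine ⟨_, basicOpen_resO_le (hW i) r, ?_, ?_⟩
  · rw [Scheme.basicOpen_res]
    exact ⟨hi, hx⟩
  · have h := congrArg (DiffOp.res p (X.basicOpen_le (resO X (hW i) r))) (hθ i)
    rw [DiffOp.res_smul, hδ, DiffOp.res_res, map_pow, resO_resO] at h
    rw [DiffOp.res_smul, DiffOp.res_res, map_pow, resO_resO]
    exact h

variable [IsSeparated p]

variable (p) in
-- Charts on basic open sets are chosen so that their pairwise intersections are again basic, hence
-- affine.
theorem exists_basicOpen_charts (n : ℕ) [SmoothOfRelativeDimension n p] {U : X.Opens}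
    (hU : IsAffineOpen U) : ∃ t : Finset Γ(X, U),
    (∀ x ∈ U, ∃ f : t, x ∈ X.basicOpen f.1) ∧
    ∀ f : t, ∃ s : Fin n → (principalParts p).Sections (X.basicOpen f.1),
      IsCoord (principalParts p) (X.basicOpen f.1) s := by
  have h : ∀ x : U, ∃ f : Γ(X, U), x.1 ∈ X.basicOpen f ∧
      ∃ s : Fin n → (principalParts p).Sections (X.basicOpen f),
        IsCoord (principalParts p) (X.basicOpen f) s := by
    intro x
    obtain ⟨V, s, hxV, -, hs⟩ := exists_chart p n x.1
    obtain ⟨f, hf, hxf⟩ := hU.exists_basicOpen_le ⟨x.1, hxV⟩ x.2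
    exact ⟨f, hxf, _, hs.res hf⟩
  choose f hf hs using h
  obtain ⟨t, ht⟩ := hU.isCompact.elim_finite_subcover (fun x => (X.basicOpen (f x) : Set X))
    (fun x => (X.basicOpen (f x)).2) fun x hx => Set.mem_iUnion.mpr ⟨⟨x, hx⟩, hf ⟨x, hx⟩⟩
  classical
  refine ⟨t.image f, fun x hx => ?_, fun g => ?_⟩
  · obtain ⟨z, hz, hxz⟩ := Set.mem_iUnion₂.mp (ht hx)
    exact ⟨⟨f z, Finset.mem_image_of_mem f hz⟩, hxz⟩
  · obtain ⟨z, -, hz⟩ := Finset.mem_image.mp g.2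
    rw [← hz]
    exact hs z

theorem exists_pow_smul_mem_diffOpLE (n : ℕ) [SmoothOfRelativeDimension n p]
    {U : X.Opens} (hU : IsAffineOpen U) (r : Γ(X, U))
    (δ : DiffOp p U) (hδ : DiffOp.res p (X.basicOpen_le r) δ ∈ diffOpLE p _ 0) :
    ∃ N : ℕ, r ^ N • δ ∈ diffOpLE p U 0 := by
  obtain ⟨t, ht, hs⟩ := exists_basicOpen_charts p n hU
  have h₁ : ∀ f : t, ∃ N : ℕ, resO X (X.basicOpen_le f.1) r ^ N •
      DiffOp.res p (X.basicOpen_le f.1) δ ∈ diffOpLE p _ 0 := by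
    intro f
    obtain ⟨s, hs⟩ := hs f
    obtain ⟨N, -, hN⟩ := exists_pow_smul_diffOp hs (hU.basicOpen f.1)
      (resO X (X.basicOpen_le f.1) r) (DiffOp.res p (X.basicOpen_le f.1) δ)
    refine ⟨N, hN ?_⟩
    exact DiffOp.res_mem (basicOpen_resO_le _ r) hδ
  choose N hN using h₁
  refine ⟨Finset.univ.sup N, mem_diffOpLE_of_cover fun x hx => ?_⟩
  obtain ⟨f, hf⟩ := ht x hx
  refine ⟨_, X.basicOpen_le f.1, hf, ?_⟩
  rw [DiffOp.res_smul, map_pow, ← Nat.sub_add_cancel (Finset.le_sup (f := N) (Finset.mem_univ f)),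
    pow_add, mul_smul]
  exact Submodule.smul_mem _ _ (hN f)

/-- Denominators are cleared twice: once to extend over each chart, once more to make the extensions
agree. -/
theorem exists_diffOp_extension_of_isAffineOpen (n : ℕ) [SmoothOfRelativeDimension n p]
    {U : X.Opens} (hU : IsAffineOpen U) (r : Γ(X, U))
    (ε : DiffOp p (X.basicOpen r)) : ∃ (N : ℕ) (δ : DiffOp p U),
      DiffOp.res p (X.basicOpen_le r) δ = resO X (X.basicOpen_le r) r ^ N • ε := by
  obtain ⟨t, ht, hs⟩ := exists_basicOpen_charts p n hU
  choose s hs using hs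
  have h₁ : ∀ f : t, ∃ N : ℕ, ∀ k, ∃ δ : DiffOp p (X.basicOpen f.1),
      DiffOp.res p (X.basicOpen_le (resO X (X.basicOpen_le f.1) r)) δ =
        DiffOp.res p (basicOpen_resO_le (X.basicOpen_le f.1) r)
          (resO X (X.basicOpen_le r) r ^ (N + k) • ε) := by
    intro f
    obtain ⟨N, hN⟩ := exists_diffOp_extension (hs f) (hU.basicOpen f.1)
      (resO X (X.basicOpen_le f.1) r) (DiffOp.res p (basicOpen_resO_le (X.basicOpen_le f.1) r) ε)
    refine ⟨N, fun k => (hN k).imp fun δ hδ => hδ.trans ?_⟩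
    rw [DiffOp.res_smul, map_pow, resO_resO, resO_resO]
  choose N hN using h₁
  have h₂ : ∀ f : t, ∃ δ : DiffOp p (X.basicOpen f.1),
      DiffOp.res p (X.basicOpen_le (resO X (X.basicOpen_le f.1) r)) δ =
        DiffOp.res p (basicOpen_resO_le (X.basicOpen_le f.1) r)
          (resO X (X.basicOpen_le r) r ^ (Finset.univ.sup N) • ε) := by
    intro f
    have := hN f (Finset.univ.sup N - N f)
    rwa [Nat.add_sub_cancel' (Finset.le_sup (f := N) (Finset.mem_univ f))] at this
  choose δ hδ using h₂
  obtain ⟨M, θ, hθ⟩ := exists_diffOp_glue_pow (fun f : t => X.basicOpen f.1)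
    (fun f => X.basicOpen_le f.1) ht (fun f g => by
      rw [← Scheme.basicOpen_mul]
      exact hU.basicOpen _) s hs r _ δ hδ
  exact ⟨M + Finset.univ.sup N, θ, by rw [hθ, smul_smul, pow_add]⟩

end DiffOpLocalization

/-! ### Relative spectra of quasi-coherent algebras -/

section RelativeSpec

open Scheme AffineZariskiSite

theorem specMap_appLE {R R' : CommRingCat.{u}} (χ : R ⟶ R') (x : R) :
    (Spec.map χ).appLE ⊤ ⊤ le_top ((Scheme.ΓSpecIso R).inv x) = (Scheme.ΓSpecIso R').inv (χ x) := by
  have h : (Spec.map χ).appLE ⊤ ⊤ le_top = (Spec.map χ).appTop := by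
    rw [Scheme.Hom.appTop, Scheme.Hom.app_eq_appLE]
    rfl
  rw [h]
  exact congr($(Scheme.ΓSpecIso_inv_naturality χ) x).symm

theorem fromSpec_appLE {X : Scheme.{u}} {U : X.Opens} (hU : IsAffineOpen U) (x : Γ(X, U)) :
    hU.fromSpec.appLE U ⊤ hU.fromSpec_preimage_self.ge x = (Scheme.ΓSpecIso Γ(X, U)).inv x := by
  have h : hU.fromSpec.appLE U ⊤ hU.fromSpec_preimage_self.ge = (Scheme.ΓSpecIso Γ(X, U)).inv := by
    rw [Scheme.Hom.appLE, hU.fromSpec_app_self, Category.assoc, ← Functor.map_comp]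
    refine (congrArg _ (CategoryTheory.Functor.map_id _ _)).trans (Category.comp_id _)
  rw [h]

variable {X : Scheme.{u}} {F : X.AffineZariskiSiteᵒᵖ ⥤ CommRingCat.{u}}
  {α : (toOpensFunctor X).op ⋙ X.presheaf ⟶ F}

/-- Being coequifibered means that restriction to a basic open set is localization. The spectra of
the algebras over affine open sets then form open immersions and glue along `X`. -/
theorem exists_relativeSpec (H : α.Coequifibered) :
    ∃ (E : Scheme.{u}) (π : E ⟶ X) (θ : ∀ U : X.AffineZariskiSite,
      F.obj (op U) ≃+* Γ(E, π ⁻¹ᵁ U.1)), IsAffineHom π ∧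
      (∀ (U : X.AffineZariskiSite) (f : Γ(X, U.1)), θ U (α.app (op U) f) = π.app U.1 f) ∧
      ∀ (U V : X.AffineZariskiSite) (i : V ⟶ U) (x : F.obj (op U)),
        θ V (F.map i.op x) = resO E (π.preimage_mono (toOpens_mono i.le)) (θ U x) := by
  let D := relativeGluingData H
  have hloc : (D.functor ⋙ Scheme.forget).IsLocallyDirected :=
    Cover.RelativeGluingData.instIsLocallyDirectedI₀CompFunctorForgetOfIsThin ..
  let E := D.glued
  let π : E ⟶ X := D.toBase
  let j : ∀ U : X.AffineZariskiSite, Spec (F.obj (op U)) ⟶ E := fun U => colimit.ι D.functor U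
  have hj : ∀ U, IsOpenImmersion (j U) := fun U => D.cover.map_prop U
  have hjπ : ∀ U, j U ≫ π = Spec.map (α.app (op U)) ≫ U.2.fromSpec := fun U => colimit.ι_desc _ _
  have hjj : ∀ {U V : X.AffineZariskiSite} (i : V ⟶ U), Spec.map (F.map i.op) ≫ j U = j V :=
    fun i => colimit.w D.functor i
  have hrange : ∀ U : X.AffineZariskiSite, π ⁻¹ᵁ U.1 = (j U).opensRange := fun U => by
    simpa using! D.toBase_preimage_eq_opensRange_ι U
  have htop : ∀ U : X.AffineZariskiSite, (⊤ : (Spec (F.obj (op U))).Opens) = j U ⁻¹ᵁ (π ⁻¹ᵁ U.1) := by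
    intro U
    rw [hrange, Scheme.Hom.preimage_opensRange]
  have hiso : ∀ U : X.AffineZariskiSite, IsIso ((j U).appLE (π ⁻¹ᵁ U.1) ⊤ (htop U).le) := fun U =>
    isIso_appLE_of_isOpenImmersion (j U) _ (hrange U).le _ (htop U)
  let θ : ∀ U : X.AffineZariskiSite, F.obj (op U) ≃+* Γ(E, π ⁻¹ᵁ U.1) := fun U =>
    ((asIso ((j U).appLE (π ⁻¹ᵁ U.1) ⊤ (htop U).le)) ≪≫
      Scheme.ΓSpecIso _).symm.commRingCatIsoToRingEquiv
  have hθ : ∀ U x, (j U).appLE (π ⁻¹ᵁ U.1) ⊤ (htop U).le (θ U x) = (Scheme.ΓSpecIso _).inv x := by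
    intro U x
    have := hiso U
    exact congr($(IsIso.inv_hom_id ((j U).appLE (π ⁻¹ᵁ U.1) ⊤ (htop U).le))
      ((Scheme.ΓSpecIso (F.obj (op U))).inv x))
  have hinj : ∀ U, Function.Injective ((j U).appLE (π ⁻¹ᵁ U.1) ⊤ (htop U).le) := fun U =>
    have := hiso U
    (ConcreteCategory.bijective_of_isIso ((j U).appLE (π ⁻¹ᵁ U.1) ⊤ (htop U).le)).1
  refine ⟨E, π, θ, ?_, fun U f => hinj U ?_, fun U V i x => hinj V ?_⟩
  · refine isAffineHom_of_forall_exists_isAffineOpen _ fun x => ?_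
    obtain ⟨U, hU, hxU, -⟩ := exists_affine_le (show x ∈ (⊤ : X.Opens) from trivial)
    refine ⟨U, hxU, hU, ?_⟩
    have := hj ⟨U, hU⟩
    rw [hrange ⟨U, hU⟩]
    exact isAffineOpen_opensRange _
  · rw [hθ, app_eq_appLE, appLE_appLE, appLE_congr (hjπ U)]
    refine (specMap_appLE (α.app (op U)) f).symm.trans ?_
    refine (congrArg _ (fromSpec_appLE U.2 f).symm).trans ?_
    exact appLE_appLE (Spec.map (α.app (op U))) U.2.fromSpec U.1 ⊤ ⊤
      U.2.fromSpec_preimage_self.ge le_top f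
  · rw [hθ, appLE_resO, ← appLE_congr (hjj i)
      (by rw [hjj i]; exact (htop V).le.trans ((j V).preimage_mono
        (π.preimage_mono (toOpens_mono i.le))))]
    refine (specMap_appLE (F.map i.op) x).symm.trans ?_
    refine (congrArg _ (hθ U x).symm).trans ?_
    exact appLE_appLE (Spec.map (F.map i.op)) (j U) _ ⊤ ⊤ (htop U).le le_top (θ U x)

end RelativeSpec

/-! ### The presheaf of symmetric algebras and its localization. -/

section SymSpec

variable {S X : Scheme.{u}} (p : X ⟶ S) (n : ℕ)

variable {p} in
/-- Restriction of sections of `𝒟_X / 𝒪_X`. -/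
def DiffOpModO.res {U V : X.Opens} (e : V ≤ U) : DiffOpModO p U →ₛₗ[resO X e] DiffOpModO p V :=
  Submodule.mapQ (diffOpLE p U 0) (diffOpLE p V 0) (DiffOp.resₛₗ p e) fun _ h => DiffOp.res_mem e h

theorem DiffOpModO.res_mk {U V : X.Opens} (e : V ≤ U) (δ : DiffOp p U) :
    DiffOpModO.res e (DiffOpModO.mk p U δ) = DiffOpModO.mk p V (DiffOp.res p e δ) := rfl

theorem DiffOpModO.res_res {U V W : X.Opens} (e : V ≤ U) (e' : W ≤ V) (m : DiffOpModO p U) :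
    DiffOpModO.res e' (DiffOpModO.res e m) = DiffOpModO.res (e'.trans e) m := by
  obtain ⟨δ, rfl⟩ := Submodule.mkQ_surjective _ m
  rfl

theorem DiffOpModO.res_self {U : X.Opens} (e : U ≤ U) (m : DiffOpModO p U) :
    DiffOpModO.res e m = m := by
  obtain ⟨δ, rfl⟩ := Submodule.mkQ_surjective _ m
  rfl

variable {p} in
/-- Restriction of sections of `(𝒟_X / 𝒪_X)^{⊕ n}`. -/
def modRes {U V : X.Opens} (e : V ≤ U) :
    (Fin n → DiffOpModO p U) →ₛₗ[resO X e] (Fin n → DiffOpModO p V) where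
  toFun m j := DiffOpModO.res e (m j)
  map_add' _ _ := funext fun _ => map_add _ _ _
  map_smul' f m := funext fun j => map_smulₛₗ (DiffOpModO.res e) f (m j)

theorem modRes_modRes {U V W : X.Opens} (e : V ≤ U) (e' : W ≤ V) (m : Fin n → DiffOpModO p U) :
    modRes n e' (modRes n e m) = modRes n (e'.trans e) m :=
  funext fun j => DiffOpModO.res_res p e e' (m j)

theorem modRes_self {U : X.Opens} (e : U ≤ U) (m : Fin n → DiffOpModO p U) :
    modRes n e m = m :=
  funext fun j => DiffOpModO.res_self p e (m j)

/-- The presheaf of symmetric algebras of `(𝒟_X / 𝒪_X)^{⊕ n}`. -/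
def symPresheaf : X.Opensᵒᵖ ⥤ CommRingCat.{u} where
  obj U := CommRingCat.of (SymmetricAlgebra Γ(X, U.unop) (Fin n → DiffOpModO p U.unop))
  map i := CommRingCat.ofHom (symMap (modRes n i.unop.le))
  map_id U := by
    refine CommRingCat.hom_ext (sym_ringHom_ext (fun r => ?_) fun m => ?_)
    · exact (symMap_algebraMap _ _).trans (congrArg _ (resO_self X _ r))
    · exact (symMap_ι _ _).trans (congrArg _ (modRes_self p n _ m))
  map_comp i j := by
    refine CommRingCat.hom_ext (sym_ringHom_ext (fun r => ?_) fun m => ?_)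
    · refine (symMap_algebraMap _ _).trans (Eq.trans ?_
        (congrArg (symMap (modRes n j.unop.le)) (symMap_algebraMap (modRes n i.unop.le) r)).symm)
      exact (congrArg _ (resO_resO X _ _ r).symm).trans (symMap_algebraMap _ _).symm
    · refine (symMap_ι _ _).trans (Eq.trans ?_
        (congrArg (symMap (modRes n j.unop.le)) (symMap_ι (modRes n i.unop.le) m)).symm)
      exact (congrArg _ (modRes_modRes p n _ _ m).symm).trans (symMap_ι _ _).symm

/-- The structure of an algebra on the presheaf of symmetric algebras. -/
def symPresheafMap : X.presheaf ⟶ symPresheaf p n where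
  app U := CommRingCat.ofHom (algebraMap Γ(X, U.unop) _)
  naturality U V i := by
    refine CommRingCat.hom_ext (RingHom.ext fun r => ?_)
    exact (symMap_algebraMap (modRes n i.unop.le) r).symm

variable [IsSeparated p] [SmoothOfRelativeDimension n p]

theorem exists_pow_smul_eq_zero_of_modRes {U : X.Opens} (hU : IsAffineOpen U) (r : Γ(X, U))
    (m : Fin n → DiffOpModO p U) (hm : modRes n (X.basicOpen_le r) m = 0) :
    ∃ k : ℕ, r ^ k • m = 0 := by
  have h : ∀ j, ∃ k : ℕ, r ^ k • m j = 0 := by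
    intro j
    obtain ⟨δ, hδ⟩ := Submodule.mkQ_surjective _ (m j)
    have h₁ : DiffOpModO.mk p _ (DiffOp.res p (X.basicOpen_le r) δ) = 0 := by
      rw [← DiffOpModO.res_mk]
      exact (congrArg _ hδ).trans (congrFun hm j)
    obtain ⟨N, hN⟩ := exists_pow_smul_mem_diffOpLE n hU r δ
      ((Submodule.Quotient.mk_eq_zero _).mp h₁)
    refine ⟨N, ?_⟩
    rw [← hδ, ← map_smul]
    exact (Submodule.Quotient.mk_eq_zero _).mpr hN
  choose k hk using h
  refine ⟨Finset.univ.sup k, funext fun j => ?_⟩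
  rw [Pi.smul_apply, ← Nat.sub_add_cancel (Finset.le_sup (f := k) (Finset.mem_univ j)), pow_add,
    mul_smul, hk, smul_zero]
  rfl

theorem exists_modRes_eq_pow_smul {U : X.Opens} (hU : IsAffineOpen U) (r : Γ(X, U))
    (m' : Fin n → DiffOpModO p (X.basicOpen r)) : ∃ (k : ℕ) (m : Fin n → DiffOpModO p U),
      modRes n (X.basicOpen_le r) m = resO X (X.basicOpen_le r) r ^ k • m' := by
  have h : ∀ j, ∃ (k : ℕ) (m : DiffOpModO p U),
      DiffOpModO.res (X.basicOpen_le r) m = resO X (X.basicOpen_le r) r ^ k • m' j := by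
    intro j
    obtain ⟨ε, hε⟩ := Submodule.mkQ_surjective _ (m' j)
    obtain ⟨N, δ, hδ⟩ := exists_diffOp_extension_of_isAffineOpen n hU r ε
    refine ⟨N, DiffOpModO.mk p U δ, ?_⟩
    rw [DiffOpModO.res_mk, hδ, map_smul]
    exact congrArg _ hε
  choose k m hm using h
  refine ⟨Finset.univ.sup k, fun j => r ^ (Finset.univ.sup k - k j) • m j, funext fun j => ?_⟩
  refine (map_smulₛₗ (DiffOpModO.res (X.basicOpen_le r)) _ _).trans ?_
  rw [hm, map_pow, smul_smul, ← pow_add,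
    Nat.sub_add_cancel (Finset.le_sup (f := k) (Finset.mem_univ j))]
  rfl

theorem coequifibered_symPresheafMap :
    ((Scheme.AffineZariskiSite.toOpensFunctor X).op.whiskerLeft
      (symPresheafMap p n)).Coequifibered := by
  refine Scheme.AffineZariskiSite.coequifibered_iff_forall_isLocalizationAway.mpr fun U r => ?_
  exact isLocalization_symMap r (U.2.isLocalization_basicOpen r) (modRes n (X.basicOpen_le r))
    (exists_pow_smul_eq_zero_of_modRes p n U.2 r) (exists_modRes_eq_pow_smul p n U.2 r)

end SymSpec

/-! ### Existence of the relative spectrum -/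

section Existence

variable {S X : Scheme.{u}} (p : X ⟶ S) (n : ℕ) [IsSeparated p] [SmoothOfRelativeDimension n p]

/-- Gluing spectra yields the tautological map on affine open sets only, compatible with restriction
to basic open sets; the sheaf property on `E` extends it to all open sets. -/
theorem nonempty_symSpec : Nonempty (SymSpec p n) := by
  obtain ⟨E, π, θ, hπ, hα, hθ⟩ := exists_relativeSpec (coequifibered_symPresheafMap p n)
  let τ : ∀ U : X.AffineZariskiSite, (Fin n → DiffOpModO p U.1) → Γ(E, π ⁻¹ᵁ U.1) := fun U m =>
    θ U (SymmetricAlgebra.ι Γ(X, U.1) (Fin n → DiffOpModO p U.1) m)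
  have τ_add : ∀ U m m', τ U (m + m') = τ U m + τ U m' := fun U m m' =>
    (congrArg (θ U) (map_add _ m m')).trans (map_add (θ U) _ _)
  have τ_smul : ∀ U (f : Γ(X, U.1)) m, τ U (f • m) = π.app U.1 f * τ U m := fun U f m => by
    rw [← hα U f]
    refine Eq.trans (congrArg (θ U) ?_) (map_mul (θ U) _ _)
    exact (map_smul (SymmetricAlgebra.ι Γ(X, U.1) (Fin n → DiffOpModO p U.1)) f m).trans
      (Algebra.smul_def (A := SymmetricAlgebra Γ(X, U.1) (Fin n → DiffOpModO p U.1)) f _)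
  have τ_basic : ∀ (U V : X.AffineZariskiSite) (i : V ⟶ U) m,
      τ V (modRes n (Scheme.AffineZariskiSite.toOpens_mono i.le) m) =
        resO E (π.preimage_mono (Scheme.AffineZariskiSite.toOpens_mono i.le)) (τ U m) :=
    fun U V i m => (congrArg (θ V) (symMap_ι _ m).symm).trans (hθ U V i _)
  -- An inclusion of affine open sets need not be a morphism of the site, which only knows basic
  -- open sets. The two sides are compared on open sets that are basic in both.
  have τ_res : ∀ (U V : X.AffineZariskiSite) (e : V.1 ≤ U.1) m, τ V (modRes n e m) =
      resO E (π.preimage_mono e) (τ U m) := by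
    intro U V e m
    refine ext_of_resO fun z hz => ?_
    obtain ⟨f, g, hfg, hzf⟩ := exists_basicOpen_le_affine_inter V.2 U.2 (π z) ⟨hz, e hz⟩
    let B : X.AffineZariskiSite := V.basicOpen f
    have iV : B ⟶ V := homOfLE (V.basicOpen_le f)
    have iU : B ⟶ U := homOfLE ⟨g, hfg.symm⟩
    have h₁ := τ_basic V B iV (modRes n e m)
    have h₂ := τ_basic U B iU m
    rw [modRes_modRes] at h₁
    refine ⟨π ⁻¹ᵁ B.1, π.preimage_mono (X.basicOpen_le f), hzf, ?_⟩
    rw [resO_resO]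
    exact h₁.symm.trans h₂
  have glue : ∀ (V : X.Opens) (m : Fin n → DiffOpModO p V), ∃ t : Γ(E, π ⁻¹ᵁ V),
      ∀ W : {W : X.AffineZariskiSite // W.1 ≤ V},
        resO E (π.preimage_mono W.2) t = τ W.1 (modRes n W.2 m) := by
    intro V m
    refine exists_glue (fun W : {W : X.AffineZariskiSite // W.1 ≤ V} => π ⁻¹ᵁ W.1.1) _
      (fun W => π.preimage_mono W.2) (fun z hz => ?_) _ fun W W' V' e e' => ?_
    · obtain ⟨U, hU, hzU, hUV⟩ := exists_affine_le (show π z ∈ V from hz)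
      exact ⟨⟨⟨U, hU⟩, hUV⟩, hzU⟩
    · refine ext_of_resO fun z hz => ?_
      obtain ⟨B, hB, hzB, hBW⟩ := exists_affine_le
        (show π z ∈ W.1.1 ⊓ W'.1.1 from ⟨e hz, e' hz⟩)
      refine ⟨V' ⊓ π ⁻¹ᵁ B, inf_le_left, ⟨hz, hzB⟩, ?_⟩
      have h₁ := τ_res W.1 ⟨B, hB⟩ (hBW.trans inf_le_left) (modRes n W.2 m)
      have h₂ := τ_res W'.1 ⟨B, hB⟩ (hBW.trans inf_le_right) (modRes n W'.2 m)
      rw [modRes_modRes] at h₁ h₂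
      have h₃ := congrArg (resO E (inf_le_right : V' ⊓ π ⁻¹ᵁ B ≤ _)) (h₁.symm.trans h₂)
      rw [resO_resO, resO_resO] at h₃
      rw [resO_resO, resO_resO]
      exact h₃
  choose T hT using glue
  have ext' : ∀ (V : X.Opens) (a b : Γ(E, π ⁻¹ᵁ V)), (∀ W : {W : X.AffineZariskiSite // W.1 ≤ V},
      resO E (π.preimage_mono W.2) a = resO E (π.preimage_mono W.2) b) → a = b := by
    intro V a b h
    refine ext_of_resO fun z hz => ?_
    obtain ⟨U, hU, hzU, hUV⟩ := exists_affine_le (show π z ∈ V from hz)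
    exact ⟨_, π.preimage_mono hUV, hzU, h ⟨⟨U, hU⟩, hUV⟩⟩
  have T_res : ∀ (U V : X.Opens) (e : V ≤ U) m,
      T V (modRes n e m) = resO E (π.preimage_mono e) (T U m) := by
    intro U V e m
    refine ext' V _ _ fun W => ?_
    rw [hT, resO_resO, modRes_modRes]
    exact (hT U m ⟨W.1, W.2.trans e⟩).symm
  have T_affine : ∀ (U : X.Opens) (hU : IsAffineOpen U) m, T U m = τ ⟨U, hU⟩ m := by
    intro U hU m
    have h := hT U m ⟨⟨U, hU⟩, le_rfl⟩
    rw [modRes_self] at h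
    exact (resO_self E _ _).symm.trans h
  let taut : ∀ U : X.Opens, (Fin n → DiffOpModO p U) →ₛₗ[(π.app U).hom] Γ(E, π ⁻¹ᵁ U) := fun U =>
    { toFun := T U
      map_add' := fun m m' => ext' U _ _ fun W => by
        rw [map_add, hT, hT, hT, map_add, τ_add]
      map_smul' := fun f m => ext' U _ _ fun W => by
        rw [smul_eq_mul, map_mul, hT, hT, map_smulₛₗ, τ_smul]
        congr 1
        rw [app_eq_appLE, appLE_resO]
        refine Eq.symm ((congrArg _ (app_eq_appLE π U f)).trans (resO_appLE _ _ _ _)) }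
  refine ⟨⟨E, π, hπ, taut, fun U V e δ =>
    T_res U V e fun j => DiffOpModO.mk p U (δ j), fun U hU => ⟨θ ⟨U, hU⟩, hα ⟨U, hU⟩,
    fun m => (T_affine U hU m).symm⟩⟩⟩

end Existence

end FormalGeometry

end

/-- The functor is fixed before the model `A` of the relative spectrum, and the representation
before `U`, so one universal isomorphism serves all open sets. The last equation is read on the
scheme `U`, after pulling back along its inclusion. -/
theorem theorem4p1 {K : Type u} [Field K] [CharZero K] {X : Scheme.{u}}
    (p : X ⟶ Spec (CommRingCat.of K)) (n : ℕ) [SmoothOfRelativeDimension n p] [IsSeparated p]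
    [IrreducibleSpace X] :
    (∀ (Y' Y : Over X) (h : Y' ⟶ Y) (φ : FormalGeometry.FormalIso p n Y),
      ∃! φ' : FormalGeometry.FormalIso p n Y', FormalGeometry.FormalIso.IsBaseChange h φ φ') ∧
    Nonempty (FormalGeometry.SymSpec p n) ∧
    ∃ (F : (Over X)ᵒᵖ ⥤ Type u)
      (e : ∀ Y : Over X, F.obj (op Y) ≃ FormalGeometry.FormalIso p n Y),
      FormalGeometry.IsModuliFunctor p n F e ∧
      ∀ A : FormalGeometry.SymSpec p n,
        ∃ r : F.RepresentableBy A.coor,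
          ∀ U : X.Opens,
            ∃ b : (Over.mk U.ι ⟶ A.coor) ≃ FormalGeometry.FormalCoords p n U,
              ∀ (σ : Over.mk U.ι ⟶ A.coor) (j : Fin n),
                ((FormalGeometry.principalParts p).pullbackSnd U.ι).pull U ⊤ (by simp)
                    ((b σ).1 j) =
                  ((FormalGeometry.principalParts p).pullbackOver σ.left (Over.w σ)).pull ⊤ ⊤ le_top
                    ((e A.coor (r.homEquiv (𝟙 A.coor))).coords j) :=
  ⟨fun _ _ h φ => FormalGeometry.FormalIso.exists_isBaseChange h φ,
    FormalGeometry.nonempty_symSpec p n, FormalGeometry.formalIsoFunctor p n, fun _ => Equiv.refl _,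
    FormalGeometry.isModuliFunctor_formalIsoFunctor p n, fun A =>
      ⟨A.representableBy, fun U => A.exists_sections_equiv U⟩⟩
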